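/- Let $a,\delta\in\mathbb C$ with $0<|\delta|<\frac1{4\pi^4}$, let $q_1(z)=z^2+az^3$ and let $q_2$ be a polynomial with $q_2(w)=-w^2+O(w^3)$. Put $$F(z,x)=\bigl(z+q_1(z+\delta x),\ \delta x-q_1(z+\delta x)\bigr),\qquad G(w,y)=\bigl(w+q_2(w+\delta y),\ \delta y-q_2(w+\delta y)\bigr),$$ $$F_w(z,x)=F(z,x)+\bigl(\tfrac{\pi^2}{4}w,0\bigr).$$ Let $\mathcal B_G$ be the parabolic basin of $G$ at the origin, i.e. the set of points having a neighbourhood on which $G^n\to 0$ uniformly. Let $U$ be a biholomorphic map from a neighbourhood of the origin in $\mathbb C^2$ onto an open set, of the form $U(z,x)=(z+O(x^2,zx),x)$, such that $\widetilde F:=U\circ F\circ U^{-1}$ has the form $$\widetilde F(z,x)=\bigl(z+z^2+a_3z^3+O(z^4),\ b_0(x)+b_1(x)z+b_2(x)z^2+\cdots\bigr)$$ near the origin, with $a_3$ constant and $b_0(x)=\delta x+O(x^2)$. Put $\widetilde F_w:=U\circ F_w\circ U^{-1}$, $b:=1-a_3$, $\omega^\iota(z):=-\frac1z-b\log(-\frac1z)$,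 $\omega^o(z):=-\frac1z-b\log(\frac1z)$ and let $$\Phi(z,x)=\lim_{n\to\infty}\bigl(\omega^\iota(\pi_z\widetilde F^n(z,x))-n\bigr),\qquad \Psi(Z)=\lim_{n\to\infty}\widetilde F^n\bigl((\omega^o)^{-1}(Z-n),0\bigr)$$ be the attracting and the repelling Fatou coordinate of $\widetilde F$ (with $\pi_z$ the projection to the first coordinate). For $R,\eta>0$ let $P^{att}=\{(z,x):\operatorname{Re}(-1/z)>R,\ |x|<\eta\}$ and $P^{rep}=\Psi(\{Z:\operatorname{Re}Z<-R\})$. The following holds if $\eta$ is small enough and then $R$ is large enough (depending only on the data fixed so far). Let $\frac12<\alpha<\frac23$, $k_n=\lfloor n^\alpha\rfloor$, $C>1$, $s>0$, and let $C_G\subset\mathcal B_G$ be compact. For $(w,y)\in C_G$ let $w_m$ be the first coordinate of $G^m(w,y)$, and let $\widetilde{\boldsymbol F}_{m_2,m_1}=\widetilde F_{w_{m_2-1}}\circ\dots\circ\widetilde F_{w_{m_1}}$. Let $(z^\iota_n,x^\iota_n)$ be a sequence of points in $\mathbb C^2$ with $z^\iota_n\sim-1/k_n$, with $$(z^\iota_n,x^\iota_n)\in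 P^{att},\quad |x^\iota_n|<C\max\{|z^\iota_n|^2,|w_{n^2+k_n}|^2\},\quad |z^\iota_n|<s,\ |x^\iota_n|<s$$ for all large $n$, and with $\Phi(z^\iota_n,x^\iota_n)=k_n+O(1)$. The point $(w,y)\in C_G$ and the sequence may depend on a parameter (in an arbitrary set), in which case these conditions are assumed uniformly in the parameter, and everything below holds uniformly in it. Put $(z^o_n,x^o_n):=\widetilde{\boldsymbol F}_{(n+1)^2-k_n,\,n^2+k_n}(z^\iota_n,x^\iota_n)$. Then there is an integer $\kappa_1\ge1$ such that, for all large $n$, the orbit of $(z^\iota_n,x^\iota_n)$ under the maps $\widetilde F_{w_m}$, $n^2+k_n\le m<(n+1)^2-\kappa_1$, is well defined, there is a $u^o_n\in\mathbb C$ with $(z^o_n,u^o_n)\in P^{rep}$, and for every such choice of $u^o_n$ the iterate $\widetilde F^{k_n-\kappa_1}(z^o_n,u^o_n)$ is well defined and $$\widetilde{\boldsymbol F}_{(n+1)^2-\kappa_1,\,(n+1)^2-k_n}(z^o_n,x^o_n)=\widetilde F^{\,k_n-\kappa_1}(z^o_n,u^o_n)+o(1)\qquad(n\to\infty);$$ moreover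 $U^{-1}$ is defined at the point on the left-hand side. -/

import Mathlib

open Filter Topology

noncomputable section

namespace Eggbeater

/-! ### The maps -/

/-- The map `(z, x) ↦ (z + q (z + δ x), δ x - q (z + δ x))`. -/
def henonMap (q : ℂ → ℂ) (δ : ℂ) (p : ℂ × ℂ) : ℂ × ℂ :=
  (p.1 + q (p.1 + δ * p.2), δ * p.2 - q (p.1 + δ * p.2))

/-- The map `F`, built from `q₁(z) = z² + a z³`. -/
def mapF (a δ : ℂ) : ℂ × ℂ → ℂ × ℂ :=
  henonMap (fun z => z ^ 2 + a * z ^ 3) δ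

/-- The map `G`, built from the polynomial `q₂`. -/
def mapG (q₂ : Polynomial ℂ) (δ : ℂ) : ℂ × ℂ → ℂ × ℂ :=
  henonMap (fun w => q₂.eval w) δ

/-- The perturbed map `F_w = F + (π² w / 4, 0)`. -/
def mapFw (a δ w : ℂ) (p : ℂ × ℂ) : ℂ × ℂ :=
  mapF a δ p + ((Real.pi : ℂ) ^ 2 / 4 * w, 0)

/-- The parabolic basin of the fixed point `0`: the points that have a neighbourhood on which the
iterates converge uniformly to `0`. -/
def basin (T : ℂ × ℂ → ℂ × ℂ) : Set (ℂ × ℂ) :=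
  {p | ∃ V ∈ 𝓝 p, TendstoUniformlyOn (fun (n : ℕ) (v : ℂ × ℂ) => T^[n] v) (fun _ => 0) atTop V}

/-- `w_m`, the first coordinate of `G^m (w, y)`. -/
def wSeq (q₂ : Polynomial ℂ) (δ : ℂ) (g : ℂ × ℂ) (m : ℕ) : ℂ :=
  ((mapG q₂ δ)^[m] g).1

/-- `k_n = ⌊n ^ α⌋`. -/
def kSeq (α : ℝ) (n : ℕ) : ℕ := ⌊(n : ℝ) ^ α⌋₊

/-! ### The local coordinate change and the local form of the maps -/

/-- The map `T` in the local coordinate `U`, that is `U ∘ T ∘ U⁻¹`. It is meaningful at the points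
satisfying `DefinedAt`. -/
def localConj (U : OpenPartialHomeomorph (ℂ × ℂ) (ℂ × ℂ)) (T : ℂ × ℂ → ℂ × ℂ) (p : ℂ × ℂ) :
    ℂ × ℂ :=
  U (T (U.symm p))

/-- `U ∘ T ∘ U⁻¹` is defined at `p`: `U⁻¹` is defined at `p`, and `U` is defined at
`T (U⁻¹ p)`. -/
def DefinedAt (U : OpenPartialHomeomorph (ℂ × ℂ) (ℂ × ℂ)) (T : ℂ × ℂ → ℂ × ℂ) (p : ℂ × ℂ) : Prop :=
  p ∈ U.target ∧ T (U.symm p) ∈ U.source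

/-- `U` is a local holomorphic coordinate change near the origin, of the form
`U (z, x) = (z + O(x², z x), x)`, which brings `F` to the form
`(z, x) ↦ (z + z² + a₃ z³ + O(z⁴), b₀(x) + b₁(x) z + b₂(x) z² + ⋯)`
with `a₃` constant and `b₀(x) = δ x + O(x²)`. -/
structure IsNormalizingChart (a δ : ℂ) (U : OpenPartialHomeomorph (ℂ × ℂ) (ℂ × ℂ)) (a₃ : ℂ) :
    Prop where
  zero_mem : (0 : ℂ × ℂ) ∈ U.source
  holo : DifferentiableOn ℂ U U.source
  holo_symm : DifferentiableOn ℂ U.symm U.target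
  snd_eq : ∀ p ∈ U.source, (U p).2 = p.2
  fst_eq : (fun p : ℂ × ℂ => (U p).1 - p.1)
    =O[𝓝 0] (fun p : ℂ × ℂ => ‖p.2‖ ^ 2 + ‖p.1‖ * ‖p.2‖)
  form_fst : (fun p : ℂ × ℂ =>
      (localConj U (mapF a δ) p).1 - (p.1 + p.1 ^ 2 + a₃ * p.1 ^ 3))
    =O[𝓝 0] (fun p : ℂ × ℂ => p.1 ^ 4)
  form_snd : (fun x : ℂ => (localConj U (mapF a δ) (0, x)).2 - δ * x)
    =O[𝓝 0] (fun x : ℂ => x ^ 2)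

/-- `compSteps S m j = S (m + j - 1) ∘ ⋯ ∘ S m`. -/
def compSteps {X : Type*} (S : ℕ → X → X) (m : ℕ) : ℕ → X → X
  | 0, p => p
  | j + 1, p => S (m + j) (compSteps S m j p)

/-- The composition `F̃_{w_{m₂-1}} ∘ ⋯ ∘ F̃_{w_{m₁}}` of the perturbed maps in local coordinates,
for `m₁ ≤ m₂`. -/
def tildeComp (a δ : ℂ) (U : OpenPartialHomeomorph (ℂ × ℂ) (ℂ × ℂ)) (w : ℕ → ℂ) (m₂ m₁ : ℕ) :
    ℂ × ℂ → ℂ × ℂ :=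
  compSteps (fun m => localConj U (mapFw a δ (w m))) m₁ (m₂ - m₁)

/-- The exit point `(z°, x°)` that belongs to the entry point `p`. -/
def exitPoint (a δ : ℂ) (U : OpenPartialHomeomorph (ℂ × ℂ) (ℂ × ℂ)) (w : ℕ → ℂ) (α : ℝ) (n : ℕ)
    (p : ℂ × ℂ) : ℂ × ℂ :=
  tildeComp a δ U w ((n + 1) ^ 2 - kSeq α n) (n ^ 2 + kSeq α n) p

/-! ### Fatou coordinates, petals, and the regions `Ω_w` -/

/-- The incoming coordinate `-1/z - b log (-1/z)`. -/
def omegaIn (b z : ℂ) : ℂ := -1 / z - b * Complex.log (-1 / z)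

/-- The outgoing coordinate `-1/z - b log (1/z)`. -/
def omegaOut (b z : ℂ) : ℂ := -1 / z - b * Complex.log (1 / z)

/-- The inverse of the outgoing coordinate on the repelling side. The map `omegaOut b` is injective
on the given region, because in terms of `t = 1/z` it is `t ↦ -t - b log t` on a half plane on which
`|b / t| < 1`. -/
def omegaOutInv (b : ℂ) : ℂ → ℂ :=
  Function.invFunOn (omegaOut b) {z : ℂ | ‖b‖ + 1 < (1 / z).re}

/-- The attracting Fatou coordinate of `T(z, x) = (z + z² + a₃ z³ + O(z⁴), ⋯)`:
`Φ(z, x) = lim (ω^ι (π_z (T^n (z, x))) - n)`, where `b = 1 - a₃`. -/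
def attFatou (a₃ : ℂ) (T : ℂ × ℂ → ℂ × ℂ) (p : ℂ × ℂ) : ℂ :=
  limUnder atTop (fun n : ℕ => omegaIn (1 - a₃) (T^[n] p).1 - (n : ℂ))

/-- The repelling Fatou coordinate (a parametrization)
`Ψ(Z) = lim T^n ((ω^o)⁻¹ (Z - n), 0)`, where `b = 1 - a₃`. -/
def repFatou (a₃ : ℂ) (T : ℂ × ℂ → ℂ × ℂ) (Z : ℂ) : ℂ × ℂ :=
  limUnder atTop (fun n : ℕ => T^[n] (omegaOutInv (1 - a₃) (Z - (n : ℂ)), 0))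

/-- The attracting petal of the local map. -/
def attPetal (R η : ℝ) : Set (ℂ × ℂ) := {p | R < (-1 / p.1).re ∧ ‖p.2‖ < η}

/-- The one-dimensional repelling petal of the local map `T`. -/
def repPetal (a₃ : ℂ) (T : ℂ × ℂ → ℂ × ℂ) (R : ℝ) : Set (ℂ × ℂ) :=
  repFatou a₃ T '' {Z : ℂ | Z.re < -R}

/-- `Ω_w`, with constant `C`. -/
def omegaRegion (C : ℝ) (w : ℂ) : Set (ℂ × ℂ) := {p | ‖p.2‖ < C * max (‖p.1‖ ^ 2) (‖w‖ ^ 2)}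

/-- The open polydisk of radius `s` centred at the origin. -/
def polydisk (s : ℝ) : Set (ℂ × ℂ) := {p | ‖p.1‖ < s ∧ ‖p.2‖ < s}

/-- A family (indexed by `ι`) of sequences of entry points `(zι_n, xι_n)`, where `g i` is the point
`(w, y)` whose orbit under `G` drives the perturbation of the `i`-th sequence. All asymptotic
conditions are uniform in the index. -/
structure IsEntryFamily (a δ : ℂ) (q₂ : Polynomial ℂ) (U : OpenPartialHomeomorph (ℂ × ℂ) (ℂ × ℂ))
    (a₃ : ℂ) (R η s C α : ℝ) {ι : Type*} (g : ι → ℂ × ℂ) (e : ι → ℕ → ℂ × ℂ) : Prop where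
  /-- `zι_n ∼ -1 / k_n` -/
  asymp : TendstoUniformly (fun (n : ℕ) (i : ι) => -(kSeq α n : ℂ) * (e i n).1) (fun _ => 1) atTop
  mem : ∀ᶠ n : ℕ in atTop, ∀ i, e i n ∈
    attPetal R η ∩ omegaRegion C (wSeq q₂ δ (g i) (n ^ 2 + kSeq α n)) ∩ polydisk s
  /-- `Φ(zι_n, xι_n) = k_n + O(1)` -/
  fatou : ∃ K : ℝ, ∀ᶠ n : ℕ in atTop, ∀ i,
    ‖attFatou a₃ (localConj U (mapF a δ)) (e i n) - (kSeq α n : ℂ)‖ ≤ K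

end Eggbeater

end

open Eggbeater

namespace Eggbeater

/-! Write k = k_n, b = 1 - a₃, ε = π/(2n). In the normalizing chart one step of the perturbed map is
z ↦ z + z² + a₃z³ + (π²/4) w_m plus small terms, while x is contracted by a factor 1/2 up to O(z²)
(`IsNormalizingChart.exists_localForm`). On compact subsets of the basin of `G` one has 1/w_m = m +
O(√m) uniformly (`exists_wSeq_bound`), so for n² ≤ m ≤ (n+1)² the forcing (π²/4) w_m equals ε²(1 +
O(1/n)).

Passage through the gate. Put z = ε tan φ. Each step advances φ by about ε, and the time coordinate
φ/ε - b log cos φ advances by 1 + O(|z|² + |x| + 1/n), because the choice of b cancels the terms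
linear in z. After j of the N = 2n + 1 - 2k steps, |z| is at most a constant over min(k + j, k + N -
j), hence the accumulated error is O(1) (`LocalForm.transit_orbit`). Near φ = -π/2 the time
coordinate is ω^ι(z) - n - b log ε + O(1), and near φ = π/2 it is ω^o(z) + n - b log ε + O(1); the
cubic term of tan costs (εk)³/ε, of order k³/n², which is bounded. Since Φ = ω^ι + O(1), subtraction
gives ω^o(z°) = k + N - 2n + O(1) = -k + O(1) (`LocalForm.transit`).

The last k - κ₁ steps. A bounded κ₁ absorbs the O(1), so the orbits of (z°, x°) under the perturbed
maps and of (z°, u) under the unperturbed map both remain on the repelling side. In the coordinate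
-1/z their separation is multiplied by 1 + O(|z|²) per step, with bounded product. The second
coordinates differ by O(1/k) at the start and are contracted. The forcing, of size ε², moves -1/z by
at most O(ε²k²) per step, in total O(k³/n²), which tends to 0 because α < 2/3
(`RepellingScale.compare`, `RepellingScale.shadow`).

The petal. The limit defining Ψ exists by the same comparison of orbits, and -1/Ψ₁ is
Lipschitz-close to the identity, so its first coordinate takes the value z°
(`RepellingScale.exists_repFatou_fst_eq`). Every point (z, u) of the petal satisfies |u| ≤ 4K|z|²
(`RepellingScale.repFatou_bounds`), which is all that the last stretch needs to know about u. -/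

/-- Quantitative form of a map `T (z, x) = (z + z² + a₃ z³ + O(z⁴), O(x) + O(z²))` on the closed
polydisk of radius `ρ`. -/
structure LocalForm (T : ℂ × ℂ → ℂ × ℂ) (a₃ : ℂ) (ρ K : ℝ) : Prop where
  pos : 0 < ρ
  le_one : ρ ≤ 1
  one_le : 1 ≤ K
  fst : ∀ z x : ℂ, ‖z‖ ≤ ρ → ‖x‖ ≤ ρ →
    ‖(T (z, x)).1 - (z + z ^ 2 + a₃ * z ^ 3)‖ ≤ K * ‖z‖ ^ 4
  snd : ∀ z x : ℂ, ‖z‖ ≤ ρ → ‖x‖ ≤ ρ → ‖(T (z, x)).2‖ ≤ ‖x‖ / 2 + K * ‖z‖ ^ 2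
  fst_lip : ∀ (M : ℝ) (z z' x x' : ℂ), M ≤ ρ → ‖z‖ ≤ M → ‖z'‖ ≤ M → ‖x‖ ≤ ρ → ‖x'‖ ≤ ρ →
    ‖((T (z, x)).1 - (z + z ^ 2 + a₃ * z ^ 3)) - ((T (z', x')).1 - (z' + z' ^ 2 + a₃ * z' ^ 3))‖
      ≤ K * (M ^ 3 * ‖z - z'‖ + M ^ 4 * ‖x - x'‖)
  snd_lip : ∀ z z' x x' : ℂ, ‖z‖ ≤ ρ → ‖z'‖ ≤ ρ → ‖x‖ ≤ ρ → ‖x'‖ ≤ ρ →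
    ‖(T (z, x)).2 - (T (z', x')).2‖ ≤ ‖x - x'‖ / 2 + K * ‖z - z'‖

/-- Quantitative form of the perturbations `S w` of `T` by `w` in the first coordinate. -/
structure PerturbedForm (S : ℂ → ℂ × ℂ → ℂ × ℂ) (T : ℂ × ℂ → ℂ × ℂ) (ρ K : ℝ) : Prop where
  snd_eq : ∀ w z x : ℂ, ‖w‖ ≤ ρ → ‖z‖ ≤ ρ → ‖x‖ ≤ ρ → (S w (z, x)).2 = (T (z, x)).2
  fst : ∀ w z x : ℂ, ‖w‖ ≤ ρ → ‖z‖ ≤ ρ → ‖x‖ ≤ ρ →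
    ‖(S w (z, x)).1 - (T (z, x)).1 - (Real.pi : ℂ) ^ 2 / 4 * w‖ ≤ K * ‖w‖ * (‖x‖ + ‖z‖ ^ 2)

/-! ### Cauchy estimates and the local form in the normalizing chart. -/

/-- Cauchy's estimate on discs of radius `r` bounds the derivative by `B / r` on the ball of radius
`M`, which is convex. -/
theorem norm_sub_le_of_bound {f : ℂ → ℂ} {M r B : ℝ} (hr : 0 < r)
    (hf : ∀ z, ‖z‖ ≤ M + r → DifferentiableAt ℂ f z) (hB : ∀ z, ‖z‖ ≤ M + r → ‖f z‖ ≤ B)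
    {a b : ℂ} (ha : ‖a‖ ≤ M) (hb : ‖b‖ ≤ M) : ‖f a - f b‖ ≤ B / r * ‖a - b‖ := by
  have hin : ∀ c z : ℂ, ‖c‖ ≤ M → dist z c ≤ r → ‖z‖ ≤ M + r := by
    intro c z hc hz
    have := norm_le_norm_add_norm_sub' z c
    rw [dist_eq_norm] at hz
    linarith
  have hd : ∀ c ∈ Metric.closedBall (0 : ℂ) M, ‖deriv f c‖ ≤ B / r := by
    intro c hc
    rw [mem_closedBall_zero_iff] at hc
    refine Complex.norm_deriv_le_of_forall_mem_sphere_norm_le hr ?_ ?_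
    · have : DifferentiableOn ℂ f (Metric.closedBall c r) := fun z hz =>
        (hf z (hin c z hc hz)).differentiableWithinAt
      exact this.diffContOnCl_ball subset_rfl
    · intro z hz
      exact hB z (hin c z hc (le_of_eq hz))
  exact (convex_closedBall (0 : ℂ) M).norm_image_sub_le_of_norm_deriv_le
    (fun c hc => hf c (by rw [mem_closedBall_zero_iff] at hc; linarith)) hd
    (by simpa using hb) (by simpa using ha)

variable {a δ : ℂ} {U : OpenPartialHomeomorph (ℂ × ℂ) (ℂ × ℂ)} {a₃ : ℂ}

theorem IsNormalizingChart.map_zero (hU : IsNormalizingChart a δ U a₃) : U 0 = 0 := by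
  have h2 := hU.snd_eq 0 hU.zero_mem
  have h1 : (U 0).1 = 0 := by
    obtain ⟨c, hc⟩ := hU.fst_eq.bound
    simpa using hc.self_of_nhds
  exact Prod.ext h1 h2

theorem IsNormalizingChart.zero_mem_target (hU : IsNormalizingChart a δ U a₃) :
    (0 : ℂ × ℂ) ∈ U.target := by
  simpa [hU.map_zero] using U.map_source hU.zero_mem

theorem IsNormalizingChart.symm_zero (hU : IsNormalizingChart a δ U a₃) : U.symm 0 = 0 := by
  simpa [hU.map_zero] using U.left_inv hU.zero_mem

theorem IsNormalizingChart.symm_snd (hU : IsNormalizingChart a δ U a₃) {p : ℂ × ℂ}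
    (hp : p ∈ U.target) : (U.symm p).2 = p.2 := by
  have := hU.snd_eq _ (U.map_target hp)
  rw [U.right_inv hp] at this
  exact this.symm

theorem differentiable_mapF (a δ : ℂ) : Differentiable ℂ (mapF a δ) := by
  unfold mapF henonMap
  fun_prop

theorem mapF_zero (a δ : ℂ) : mapF a δ 0 = 0 := by simp [mapF, henonMap]

/-- Only the linear consequence of O(x², zx) is kept: the deviation of `U` from the identity
vanishes on x = 0. Cauchy's estimate then shows that `U` commutes with translations in z up to a
factor of size |x|. -/
theorem IsNormalizingChart.exists_source (hU : IsNormalizingChart a δ U a₃) :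
    ∃ ρ K : ℝ, 0 < ρ ∧ ρ ≤ 1 ∧ 1 ≤ K ∧ ∀ q : ℂ × ℂ, ‖q‖ < ρ →
      q ∈ U.source ∧ ‖(U q).1 - q.1‖ ≤ K * ‖q.2‖ := by
  obtain ⟨c, hc0, hc⟩ := hU.fst_eq.exists_pos
  have h := hc.bound.and (U.open_source.mem_nhds hU.zero_mem)
  obtain ⟨r, hr, h⟩ := Metric.eventually_nhds_iff.1 h
  refine ⟨min r 1, 2 * c + 1, by positivity, min_le_right _ _, by linarith, fun q hq => ?_⟩
  obtain ⟨h1, h2⟩ := h (y := q) (by simpa using hq.trans_le (min_le_left _ _))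
  refine ⟨h2, h1.trans ?_⟩
  have hq1 : ‖q‖ ≤ 1 := (hq.trans_le (min_le_right _ _)).le
  have hqa : ‖q.1‖ ≤ 1 := (norm_fst_le q).trans hq1
  have hqb : ‖q.2‖ ≤ 1 := (norm_snd_le q).trans hq1
  rw [Real.norm_of_nonneg (by positivity)]
  have h3 : ‖q.2‖ ^ 2 + ‖q.1‖ * ‖q.2‖ ≤ 2 * ‖q.2‖ := by
    nlinarith [norm_nonneg q.2, norm_nonneg q.1]
  nlinarith [norm_nonneg q.2]

theorem IsNormalizingChart.exists_target (hU : IsNormalizingChart a δ U a₃) {r : ℝ} (hr : 0 < r) :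
    ∃ ρ K : ℝ, 0 < ρ ∧ ρ ≤ 1 ∧ 1 ≤ K ∧ ∀ p : ℂ × ℂ, ‖p‖ < ρ →
      p ∈ U.target ∧ ‖mapF a δ (U.symm p)‖ < r ∧
      ‖(localConj U (mapF a δ) p).1 - (p.1 + p.1 ^ 2 + a₃ * p.1 ^ 3)‖ ≤ K * ‖p.1‖ ^ 4 ∧
      ‖U.symm p‖ ≤ K * ‖p‖ := by
  obtain ⟨c, hc0, hc⟩ := hU.form_fst.exists_pos
  have hda : DifferentiableAt ℂ U.symm 0 :=
    hU.holo_symm.differentiableAt (U.open_target.mem_nhds hU.zero_mem_target)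
  obtain ⟨d, hd0, hd⟩ := hda.isBigO_sub.exists_pos
  have hcont : Tendsto (fun p => mapF a δ (U.symm p)) (𝓝 0) (𝓝 0) := by
    have h1 : ContinuousAt (fun p => mapF a δ (U.symm p)) 0 :=
      ((differentiable_mapF a δ).continuous.continuousAt).comp hda.continuousAt
    simpa [ContinuousAt, hU.symm_zero, mapF_zero] using h1
  have h := ((hc.bound.and hd.bound).and (U.open_target.mem_nhds hU.zero_mem_target)).and
    (hcont.norm.eventually (gt_mem_nhds (by simpa using hr)))
  obtain ⟨s, hs, h⟩ := Metric.eventually_nhds_iff.1 h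
  refine ⟨min s 1, c + d + 1, by positivity, min_le_right _ _, by linarith, fun q hq => ?_⟩
  obtain ⟨⟨⟨h1, h2⟩, h3⟩, h4⟩ := h (y := q) (by simpa using hq.trans_le (min_le_left _ _))
  refine ⟨h3, h4, h1.trans ?_, ?_⟩
  · rw [norm_pow]
    nlinarith [pow_nonneg (norm_nonneg q.1) 4]
  · rw [hU.symm_zero, sub_zero, sub_zero] at h2
    nlinarith [norm_nonneg q]

theorem IsNormalizingChart.localConj_snd (hU : IsNormalizingChart a δ U a₃) {p : ℂ × ℂ}
    (hp : p ∈ U.target) (hq : mapF a δ (U.symm p) ∈ U.source) :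
    (localConj U (mapF a δ) p).2 = δ * p.2 -
      (((U.symm p).1 + δ * p.2) ^ 2 + a * ((U.symm p).1 + δ * p.2) ^ 3) := by
  rw [localConj, hU.snd_eq _ hq, mapF, henonMap, hU.symm_snd hp]

theorem IsNormalizingChart.differentiableAt_localConj (hU : IsNormalizingChart a δ U a₃)
    {p : ℂ × ℂ} (hp : p ∈ U.target) (hq : mapF a δ (U.symm p) ∈ U.source) :
    DifferentiableAt ℂ (localConj U (mapF a δ)) p := by
  have h1 := hU.holo_symm.differentiableAt (U.open_target.mem_nhds hp)
  have h2 := hU.holo.differentiableAt (U.open_source.mem_nhds hq)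
  exact h2.comp p (((differentiable_mapF a δ) _).comp p h1)

set_option maxHeartbeats 1000000 in
/-- Near the origin the normalized map and its perturbations have the quantitative local forms. -/
theorem IsNormalizingChart.exists_localForm (hU : IsNormalizingChart a δ U a₃)
    (hδ : ‖δ‖ ≤ 1 / 4) :
    ∃ ρ K : ℝ, LocalForm (localConj U (mapF a δ)) a₃ ρ K ∧
      PerturbedForm (fun w => localConj U (mapFw a δ w)) (localConj U (mapF a δ)) ρ K ∧
      ∀ p : ℂ × ℂ, ‖p.1‖ ≤ ρ → ‖p.2‖ ≤ ρ →
        DefinedAt U (mapF a δ) p ∧ ∀ w : ℂ, ‖w‖ ≤ ρ → DefinedAt U (mapFw a δ w) p := by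
  obtain ⟨ρc, Kc, hρc, hρc1, hKc, hC⟩ := hU.exists_source
  obtain ⟨ρa, Ka, hρa, hρa1, hKa, hA⟩ := hU.exists_target (r := ρc / 2) (by positivity)
  set T := localConj U (mapF a δ) with hT
  -- Bound for y² + a y³ = y²(1 + a y), where y = (U⁻¹)₁ + δx has |y| ≤ min(1, (Ka + 1) max(|z|,
  -- |x|)).
  set K₂ : ℝ := (1 + ‖a‖) * (Ka + 1) ^ 2 with hK₂
  have hK₂1 : 1 ≤ K₂ := by
    have : 0 ≤ ‖a‖ := norm_nonneg a
    nlinarith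
  -- All estimates are proved on radius `2 * ρ`, leaving room for Cauchy discs of radius up to `ρ`.
  -- The condition on `K₂` makes the nonlinear part of the second coordinate small against the
  -- contraction by `δ`.
  obtain ⟨ρ, hρ0, hρ1, hρ2, hρ3, hρ4⟩ : ∃ ρ : ℝ, 0 < ρ ∧ ρ ≤ ρa / 4 ∧ ρ ≤ ρc / 16 ∧
      ρ * (64 * K₂) ≤ 1 ∧ ρ * (4 * (Ka + 1)) ≤ 1 := by
    refine ⟨min (min (ρa / 4) (ρc / 16)) (min (1 / (64 * K₂)) (1 / (4 * (Ka + 1)))),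
      by positivity, (min_le_left _ _).trans (min_le_left _ _),
      (min_le_left _ _).trans (min_le_right _ _), ?_, ?_⟩
    · rw [← le_div_iff₀ (by positivity)]
      exact (min_le_right _ _).trans (min_le_left _ _)
    · rw [← le_div_iff₀ (by positivity)]
      exact (min_le_right _ _).trans (min_le_right _ _)
  have hdb : ∀ y : ℂ, ‖y‖ ≤ ρ → ‖y‖ ≤ 2 * ρ := fun y hy => by linarith
  have hsup : ∀ z x : ℂ, ‖z‖ ≤ 2 * ρ → ‖x‖ ≤ 2 * ρ → ‖((z, x) : ℂ × ℂ)‖ < ρa := by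
    intro z x hz hx
    rw [Prod.norm_def]
    exact max_lt (by simp; linarith) (by simp; linarith)
  have hsrc : ∀ z x : ℂ, ‖z‖ ≤ 2 * ρ → ‖x‖ ≤ 2 * ρ → mapF a δ (U.symm (z, x)) ∈ U.source := by
    intro z x hz hx
    exact (hC _ ((hA _ (hsup z x hz hx)).2.1.trans (by linarith))).1
  have hdiff : ∀ z x : ℂ, ‖z‖ ≤ 2 * ρ → ‖x‖ ≤ 2 * ρ → DifferentiableAt ℂ T (z, x) := by
    intro z x hz hx
    exact hU.differentiableAt_localConj (hA _ (hsup z x hz hx)).1 (hsrc z x hz hx)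
  have hdz : ∀ z x : ℂ, DifferentiableAt ℂ (fun z : ℂ => (z, x)) z := fun z x => by fun_prop
  have hdx : ∀ z x : ℂ, DifferentiableAt ℂ (fun x : ℂ => (z, x)) x := fun z x => by fun_prop
  have hTz : ∀ z x : ℂ, ‖z‖ ≤ 2 * ρ → ‖x‖ ≤ 2 * ρ →
      DifferentiableAt ℂ (fun z => T (z, x)) z := fun z x hz hx =>
    DifferentiableAt.comp (g := T) (f := fun z : ℂ => (z, x)) z (hdiff z x hz hx) (hdz z x)
  have hTx : ∀ z x : ℂ, ‖z‖ ≤ 2 * ρ → ‖x‖ ≤ 2 * ρ →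
      DifferentiableAt ℂ (fun x => T (z, x)) x := fun z x hz hx =>
    DifferentiableAt.comp (g := T) (f := fun x : ℂ => (z, x)) x (hdiff z x hz hx) (hdx z x)
  -- the second coordinate
  have hg : ∀ z x : ℂ, ‖z‖ ≤ 2 * ρ → ‖x‖ ≤ 2 * ρ →
      ‖(T (z, x)).2 - δ * x‖ ≤ K₂ * max ‖z‖ ‖x‖ ^ 2 := by
    intro z x hz hx
    have h0 := hA _ (hsup z x hz hx)
    rw [hT, hU.localConj_snd h0.1 (hsrc z x hz hx)]
    set y := (U.symm (z, x)).1 + δ * x with hy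
    set m := max ‖z‖ ‖x‖ with hm
    have hm0 : 0 ≤ m := (norm_nonneg z).trans (le_max_left _ _)
    have hm1 : m ≤ 2 * ρ := max_le hz hx
    have hyn : ‖y‖ ≤ (Ka + 1) * m := by
      have h1 : ‖(U.symm (z, x)).1‖ ≤ Ka * m := (norm_fst_le _).trans h0.2.2.2
      have h2 : ‖δ * x‖ ≤ 1 * m := by
        rw [norm_mul]
        exact mul_le_mul (by linarith) (le_max_right _ _) (norm_nonneg _) zero_le_one
      linarith [norm_add_le (U.symm (z, x)).1 (δ * x)]
    have hy1 : ‖y‖ ≤ 1 := by nlinarith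
    have e : δ * ((z, x) : ℂ × ℂ).2 - (y ^ 2 + a * y ^ 3) - δ * x = -(y ^ 2 * (1 + a * y)) := by
      simp only; ring
    rw [e, norm_neg, norm_mul, norm_pow]
    have h3 : ‖1 + a * y‖ ≤ 1 + ‖a‖ := by
      refine (norm_add_le _ _).trans ?_
      rw [norm_one, norm_mul]
      linarith [mul_le_of_le_one_right (norm_nonneg a) hy1]
    have h4 : ‖y‖ ^ 2 ≤ ((Ka + 1) * m) ^ 2 := pow_le_pow_left₀ (norm_nonneg _) hyn 2
    calc ‖y‖ ^ 2 * ‖1 + a * y‖ ≤ ((Ka + 1) * m) ^ 2 * (1 + ‖a‖) := by gcongr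
      _ = K₂ * m ^ 2 := by rw [hK₂]; ring
  have hfst : ∀ z x : ℂ, ‖z‖ ≤ 2 * ρ → ‖x‖ ≤ 2 * ρ →
      ‖(T (z, x)).1 - (z + z ^ 2 + a₃ * z ^ 3)‖ ≤ Ka * ‖z‖ ^ 4 := fun z x hz hx =>
    (hA _ (hsup z x hz hx)).2.2.1
  have hsnd : ∀ z x : ℂ, ‖z‖ ≤ ρ → ‖x‖ ≤ ρ → ‖(T (z, x)).2‖ ≤ ‖x‖ / 2 + K₂ * ‖z‖ ^ 2 := by
    intro z x hz hx
    have h1 := hg z x (hdb z hz) (hdb x hx)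
    have h2 : ‖δ * x‖ ≤ 1 / 4 * ‖x‖ := by
      rw [norm_mul]; gcongr
    have h3 : ‖(T (z, x)).2‖ ≤ ‖(T (z, x)).2 - δ * x‖ + ‖δ * x‖ := by
      simpa using norm_add_le ((T (z, x)).2 - δ * x) (δ * x)
    have h4 : max ‖z‖ ‖x‖ ^ 2 ≤ ‖z‖ ^ 2 + ‖x‖ ^ 2 := by
      rcases max_choice ‖z‖ ‖x‖ with h | h <;> rw [h] <;> linarith [sq_nonneg ‖z‖, sq_nonneg ‖x‖]
    have h5 : K₂ * max ‖z‖ ‖x‖ ^ 2 ≤ K₂ * (‖z‖ ^ 2 + ‖x‖ ^ 2) := by gcongr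
    have h6 : K₂ * ‖x‖ ^ 2 ≤ 1 / 64 * ‖x‖ := by
      have : K₂ * ‖x‖ ≤ 1 / 64 := by
        have : K₂ * ‖x‖ ≤ K₂ * ρ := by gcongr
        linarith
      calc K₂ * ‖x‖ ^ 2 = K₂ * ‖x‖ * ‖x‖ := by ring
        _ ≤ 1 / 64 * ‖x‖ := by gcongr
    linarith [norm_nonneg x]
  have hmax : ∀ z x : ℂ, ‖z‖ ≤ 2 * ρ → ‖x‖ ≤ 2 * ρ →
      ‖(T (z, x)).2 - δ * x‖ ≤ K₂ * (2 * ρ) ^ 2 := by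
    intro z x hz hx
    refine (hg z x hz hx).trans ?_
    have : max ‖z‖ ‖x‖ ≤ 2 * ρ := max_le hz hx
    have h0 : 0 ≤ max ‖z‖ ‖x‖ := (norm_nonneg z).trans (le_max_left _ _)
    gcongr
  refine ⟨ρ, 16 * Ka + Ka / ρ + K₂ + 32 * Kc * (1 / ρc) * (1 + K₂), ⟨hρ0, by linarith, ?_, ?_, ?_, ?_, ?_⟩, ⟨?_, ?_⟩, ?_⟩
  · have : 0 ≤ Ka / ρ + K₂ + 32 * Kc * (1 / ρc) * (1 + K₂) := by positivity
    linarith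
  · intro z x hz hx
    refine (hfst z x (hdb z hz) (hdb x hx)).trans ?_
    gcongr
    have : 0 ≤ Ka / ρ + K₂ + 32 * Kc * (1 / ρc) * (1 + K₂) := by positivity
    linarith
  · intro z x hz hx
    refine (hsnd z x hz hx).trans ?_
    gcongr
    have : 0 ≤ 16 * Ka + Ka / ρ + 32 * Kc * (1 / ρc) * (1 + K₂) := by positivity
    linarith
  · intro M z z' x x' hM hz hz' hx hx'
    have hM0 : 0 ≤ M := (norm_nonneg z).trans hz
    have h1 : ‖((T (z, x)).1 - (z + z ^ 2 + a₃ * z ^ 3)) -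
        ((T (z', x)).1 - (z' + z' ^ 2 + a₃ * z' ^ 3))‖ ≤ 16 * Ka * M ^ 3 * ‖z - z'‖ := by
      rcases hM0.eq_or_lt with h | h
      · have e1 : z = 0 := norm_le_zero_iff.1 (h ▸ hz)
        have e2 : z' = 0 := norm_le_zero_iff.1 (h ▸ hz')
        simp [e1, e2]
      -- Cauchy radius `M` itself: on |z| ≤ 2M the remainder is O(M⁴), so its z-derivative is O(M³).
      -- In the x direction the radius is `ρ` and the full power M⁴ survives.
      · have := norm_sub_le_of_bound (f := fun z => (T (z, x)).1 - (z + z ^ 2 + a₃ * z ^ 3))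
          (M := M) (r := M) (B := Ka * (2 * M) ^ 4) h ?_ ?_ hz hz'
        · refine this.trans_eq ?_
          field_simp
          ring
        · intro y hy
          have := (hTz y x (by linarith) (hdb x hx)).fst
          fun_prop
        · intro y hy
          refine (hfst y x (by linarith) (hdb x hx)).trans ?_
          have : ‖y‖ ≤ 2 * M := by linarith
          gcongr
    have h2 : ‖((T (z', x)).1 - (z' + z' ^ 2 + a₃ * z' ^ 3)) -
        ((T (z', x')).1 - (z' + z' ^ 2 + a₃ * z' ^ 3))‖ ≤ Ka / ρ * M ^ 4 * ‖x - x'‖ := by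
      have := norm_sub_le_of_bound (f := fun x => (T (z', x)).1 - (z' + z' ^ 2 + a₃ * z' ^ 3))
          (M := ρ) (r := ρ) (B := Ka * M ^ 4) hρ0 ?_ ?_ hx hx'
      · refine this.trans_eq ?_
        ring
      · intro y hy
        have := (hTx z' y (hdb z' (hz'.trans hM)) (by linarith)).fst
        fun_prop
      · intro y hy
        refine (hfst z' y (hdb z' (hz'.trans hM)) (by linarith)).trans ?_
        gcongr
    have h3 := norm_add_le _ _ |>.trans (add_le_add h1 h2)
    rw [sub_add_sub_cancel] at h3
    refine h3.trans ?_
    rw [mul_add, ← mul_assoc, ← mul_assoc]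
    have : 0 ≤ K₂ + 32 * Kc * (1 / ρc) * (1 + K₂) := by positivity
    have : 0 ≤ Ka / ρ := by positivity
    gcongr <;> linarith
  · intro z z' x x' hz hz' hx hx'
    have h1 : ‖((T (z, x)).2 - δ * x) - ((T (z', x)).2 - δ * x)‖ ≤ 4 * K₂ * ρ * ‖z - z'‖ := by
      have := norm_sub_le_of_bound (f := fun z => (T (z, x)).2 - δ * x)
          (M := ρ) (r := ρ) (B := K₂ * (2 * ρ) ^ 2) hρ0 ?_ ?_ hz hz'
      · refine this.trans_eq ?_
        field_simp
        ring
      · intro y hy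
        have := (hTz y x (by linarith) (hdb x hx)).snd
        fun_prop
      · intro y hy
        exact hmax y x (by linarith) (hdb x hx)
    have h2 : ‖((T (z', x)).2 - δ * x) - ((T (z', x')).2 - δ * x')‖ ≤ 4 * K₂ * ρ * ‖x - x'‖ := by
      have := norm_sub_le_of_bound (f := fun x => (T (z', x)).2 - δ * x)
          (M := ρ) (r := ρ) (B := K₂ * (2 * ρ) ^ 2) hρ0 ?_ ?_ hx hx'
      · refine this.trans_eq ?_
        field_simp
        ring
      · intro y hy
        have := (hTx z' y (hdb z' hz') (by linarith)).snd
        fun_prop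
      · intro y hy
        exact hmax z' y (hdb z' hz') (by linarith)
    have h3 := norm_add_le _ _ |>.trans (add_le_add h1 h2)
    rw [sub_add_sub_cancel] at h3
    have h4 : ‖(T (z, x)).2 - (T (z', x')).2‖ ≤
        ‖((T (z, x)).2 - δ * x) - ((T (z', x')).2 - δ * x')‖ + ‖δ * (x - x')‖ := by
      refine le_trans (le_of_eq ?_) (norm_add_le _ _)
      congr 1; ring
    have h5 : ‖δ * (x - x')‖ ≤ 1 / 4 * ‖x - x'‖ := by
      rw [norm_mul]; gcongr
    have h6 : 4 * K₂ * ρ * ‖x - x'‖ ≤ 1 / 4 * ‖x - x'‖ := by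
      gcongr; linarith
    have h7 : 4 * K₂ * ρ * ‖z - z'‖ ≤ 1 * ‖z - z'‖ := by
      gcongr; linarith
    have h8 : 1 * ‖z - z'‖ ≤ (16 * Ka + Ka / ρ + K₂ + 32 * Kc * (1 / ρc) * (1 + K₂)) * ‖z - z'‖ := by
      gcongr
      have : 0 ≤ 16 * Ka + Ka / ρ + 32 * Kc * (1 / ρc) * (1 + K₂) := by positivity
      linarith
    linarith
  all_goals
    have hw3 : ∀ w : ℂ, ‖w‖ ≤ ρ → ‖(Real.pi : ℂ) ^ 2 / 4 * w‖ ≤ 4 * ‖w‖ := by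
      intro w _
      rw [norm_mul]
      gcongr
      rw [norm_div, norm_pow, Complex.norm_real, Real.norm_of_nonneg Real.pi_pos.le]
      have := Real.pi_le_four
      have : Real.pi ^ 2 ≤ 4 ^ 2 := by gcongr
      norm_num
      linarith
    have hnear : ∀ w z x : ℂ, ‖w‖ ≤ ρ → ‖z‖ ≤ 2 * ρ → ‖x‖ ≤ 2 * ρ →
        ‖mapFw a δ w (U.symm (z, x))‖ < ρc := by
      intro w z x hw hz hx
      have h1 := (hA _ (hsup z x hz hx)).2.1
      have h2 : ‖(((Real.pi : ℂ) ^ 2 / 4 * w, 0) : ℂ × ℂ)‖ ≤ 4 * ‖w‖ := by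
        rw [Prod.norm_def]
        exact max_le (hw3 w hw) (by simp)
      have h3 := norm_add_le (mapF a δ (U.symm (z, x))) (((Real.pi : ℂ) ^ 2 / 4 * w, 0) : ℂ × ℂ)
      rw [mapFw]
      linarith
  · intro w z x hw hz hx
    have h1 := (hC _ (hnear w z x hw (hdb z hz) (hdb x hx))).1
    have h2 := hsrc z x (hdb z hz) (hdb x hx)
    simp only [hT, localConj]
    rw [hU.snd_eq _ h1, hU.snd_eq _ h2, mapFw]
    simp
  · intro w z x hw hz hx
    have h2 := hsrc z x (hdb z hz) (hdb x hx)
    have hn := (hA _ (hsup z x (hdb z hz) (hdb x hx))).2.1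
    set q := mapF a δ (U.symm (z, x)) with hq
    set c := (Real.pi : ℂ) ^ 2 / 4 * w with hc
    have hq2 : q.2 = (T (z, x)).2 := by
      rw [hT, localConj, hU.snd_eq _ h2]
    have hin : ∀ y : ℂ, ‖y‖ ≤ ρc * (3 / 4) + ρc / 8 → ‖((y, q.2) : ℂ × ℂ)‖ < ρc := by
      intro y hy
      rw [Prod.norm_def]
      exact max_lt (by simp; linarith) (by simp; linarith [norm_snd_le q])
    have hc4 := hw3 w hw
    -- The deviation U₁(y, q₂) - y is at most Kc|q₂|, so a shift of y by `c` changes it by O(|q₂|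
    -- |c|), and q₂ = O(|x| + |z|²).
    have := norm_sub_le_of_bound (f := fun y => (U (y, q.2)).1 - y)
          (M := ρc * (3 / 4)) (r := ρc / 8) (B := Kc * ‖q.2‖) (by positivity)
          (a := q.1 + c) (b := q.1) ?_ ?_ ?_ ?_
    · have e : (localConj U (mapFw a δ w) (z, x)).1 - (T (z, x)).1 - c =
          ((U (q.1 + c, q.2)).1 - (q.1 + c)) - ((U (q.1, q.2)).1 - q.1) := by
        have e1 : mapFw a δ w (U.symm (z, x)) = (q.1 + c, q.2) := by
          rw [mapFw, ← hq]; ext <;> simp [hc]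
        have e2 : (q.1, q.2) = q := rfl
        rw [hT, localConj, localConj, e1, e2, hq]; ring
      rw [e]
      refine this.trans ?_
      rw [add_sub_cancel_left]
      have h5 : ‖q.2‖ ≤ ‖x‖ / 2 + K₂ * ‖z‖ ^ 2 := hq2 ▸ hsnd z x hz hx
      have h6 : ‖q.2‖ ≤ (1 + K₂) * (‖x‖ + ‖z‖ ^ 2) := by
        have h8 := mul_nonneg (by linarith : (0 : ℝ) ≤ K₂) (norm_nonneg x)
        linarith [norm_nonneg x, sq_nonneg ‖z‖]
      have h7 : Kc * ‖q.2‖ / (ρc / 8) * ‖c‖ ≤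
          Kc * ((1 + K₂) * (‖x‖ + ‖z‖ ^ 2)) / (ρc / 8) * (4 * ‖w‖) := by
        gcongr
      refine h7.trans ?_
      have e3 : Kc * ((1 + K₂) * (‖x‖ + ‖z‖ ^ 2)) / (ρc / 8) * (4 * ‖w‖) =
          (32 * Kc * (1 / ρc) * (1 + K₂)) * ‖w‖ * (‖x‖ + ‖z‖ ^ 2) := by
        field_simp; ring
      rw [e3]
      gcongr
      have : 0 ≤ 16 * Ka + Ka / ρ + K₂ := by positivity
      linarith
    · intro y hy
      have h5 := hU.holo.differentiableAt (U.open_source.mem_nhds (hC _ (hin y hy)).1)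
      have h6 : DifferentiableAt ℂ (fun y => U (y, q.2)) y := h5.comp y (hdz y q.2)
      have := h6.fst
      fun_prop
    · intro y hy
      exact (hC _ (hin y hy)).2
    · have := norm_add_le q.1 c
      have := norm_fst_le q
      linarith
    · have := norm_fst_le q
      linarith
  · rintro ⟨z, x⟩ hz hx
    simp only at hz hx
    have h1 := (hA _ (hsup z x (hdb z hz) (hdb x hx))).1
    exact ⟨⟨h1, hsrc z x (hdb z hz) (hdb x hx)⟩, fun w hw =>
      ⟨h1, (hC _ (hnear w z x hw (hdb z hz) (hdb x hx))).1⟩⟩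

/-! ### Branches of the logarithm -/

theorem abs_arg_le_of_cos_le {a : ℂ} {θ : ℝ} (ha : a ≠ 0) (h0 : 0 ≤ θ)
    (h : Real.cos θ * ‖a‖ ≤ a.re) : |a.arg| ≤ θ := by
  by_contra! hlt
  have h1 := Real.cos_lt_cos_of_nonneg_of_le_pi h0 (Complex.abs_arg_le_pi a) hlt
  rw [Real.cos_abs, Complex.cos_arg ha, div_lt_iff₀ (norm_pos_iff.2 ha)] at h1
  linarith

theorem log_mul_of_re_pos {a b : ℂ} (ha : 0 < a.re) (hb : 0 < b.re) :
    Complex.log (a * b) = Complex.log a + Complex.log b := by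
  have ha0 : a ≠ 0 := by rintro rfl; simp at ha
  have hb0 : b ≠ 0 := by rintro rfl; simp at hb
  have h1 := abs_lt.1 (Complex.abs_arg_lt_pi_div_two_iff.2 (Or.inl ha))
  have h2 := abs_lt.1 (Complex.abs_arg_lt_pi_div_two_iff.2 (Or.inl hb))
  exact Complex.log_mul ha0 hb0 ⟨by linarith, by linarith⟩

/-- The arguments of `a` and `b` lie in [-2π/3, 2π/3] and (-π/3, π/3), so their sum does not leave
the principal branch. -/
theorem log_mul_of_near_one {a b : ℂ} (ha0 : a ≠ 0) (ha : -(‖a‖ / 2) ≤ a.re)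
    (hb : ‖b - 1‖ ≤ 1 / 4) : Complex.log (a * b) = Complex.log a + Complex.log b := by
  have hre : 3 / 4 ≤ b.re := by
    have := (Complex.abs_re_le_norm (b - 1)).trans hb
    rw [Complex.sub_re, Complex.one_re] at this
    linarith [(abs_le.1 this).1]
  have hn : ‖b‖ ≤ 5 / 4 := by
    have := norm_add_le (b - 1) 1
    rw [sub_add_cancel, norm_one] at this
    linarith
  have hb0 : b ≠ 0 := by rintro rfl; norm_num at hre
  have hpi := Real.pi_pos
  have h1 : |a.arg| ≤ Real.pi - Real.pi / 3 := by
    refine abs_arg_le_of_cos_le ha0 (by linarith) ?_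
    rw [Real.cos_pi_sub, Real.cos_pi_div_three]
    linarith
  have h2 : |b.arg| ≤ Real.pi / 3 := by
    refine abs_arg_le_of_cos_le hb0 (by linarith) ?_
    rw [Real.cos_pi_div_three]
    linarith
  have h2' : |b.arg| < Real.pi / 3 := by
    refine lt_of_le_of_ne h2 fun h => ?_
    have h3 : Real.cos |b.arg| = 1 / 2 := by rw [h, Real.cos_pi_div_three]
    rw [Real.cos_abs, Complex.cos_arg hb0, div_eq_iff (norm_pos_iff.2 hb0).ne'] at h3
    linarith
  have h1 := abs_le.1 h1
  have h2 := abs_lt.1 h2'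
  exact Complex.log_mul ha0 hb0 ⟨by linarith, by linarith⟩

theorem norm_log_sub_log_le {r : ℝ} (hr : 0 < r) {a b : ℂ} (ha : r ≤ a.re) (hb : r ≤ b.re) :
    ‖Complex.log a - Complex.log b‖ ≤ r⁻¹ * ‖a - b‖ := by
  have hconv : Convex ℝ {z : ℂ | r ≤ z.re} := convex_halfSpace_re_ge r
  refine hconv.norm_image_sub_le_of_norm_deriv_le (𝕜 := ℂ) (f := Complex.log) ?_ ?_ hb ha
  · intro x hx
    exact (Complex.hasDerivAt_log (Or.inl (hr.trans_le hx))).differentiableAt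
  · intro x hx
    rw [(Complex.hasDerivAt_log (Or.inl (hr.trans_le hx))).deriv, norm_inv]
    exact inv_anti₀ hr (le_trans hx ((le_abs_self _).trans (Complex.abs_re_le_norm x)))

theorem norm_log_le (a : ℂ) : ‖Complex.log a‖ ≤ |Real.log ‖a‖| + Real.pi := by
  refine (Complex.norm_le_abs_re_add_abs_im _).trans ?_
  rw [Complex.log_re, Complex.log_im]
  gcongr
  exact Complex.abs_arg_le_pi a

/-- The `4` makes room for the argument, which contributes at most π to the norm of the logarithm.
-/
theorem exists_mul_log_le (B : ℝ) {η : ℝ} (hη : 0 < η) :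
    ∃ R : ℝ, 1 ≤ R ∧ ∀ t, R ≤ t → B * (Real.log t + 4) ≤ η * t := by
  have h : (fun t : ℝ => B * (Real.log t + 4)) =o[atTop] (fun t : ℝ => t) := by
    have h1 : (fun t : ℝ => Real.log t + 4) =o[atTop] (fun t : ℝ => t) :=
      Real.isLittleO_log_id_atTop.add (Asymptotics.isLittleO_const_id_atTop 4)
    exact h1.const_mul_left B
  obtain ⟨R, hR⟩ := eventually_atTop.1 ((h.bound hη).and (eventually_ge_atTop 1))
  refine ⟨max R 1, le_max_right _ _, fun t ht => ?_⟩
  obtain ⟨h1, h2⟩ := hR t ((le_max_left _ _).trans ht)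
  rw [Real.norm_of_nonneg (by linarith : 0 ≤ t)] at h1
  exact (le_abs_self _).trans h1

theorem exists_norm_mul_log_le (b : ℂ) {η : ℝ} (hη : 0 < η) :
    ∃ R : ℝ, 1 ≤ R ∧ ∀ a : ℂ, R ≤ ‖a‖ → ‖b * Complex.log a‖ ≤ η * ‖a‖ := by
  obtain ⟨R, hR1, hR⟩ := exists_mul_log_le ‖b‖ hη
  refine ⟨R, hR1, fun a ha => le_trans ?_ (hR _ ha)⟩
  rw [norm_mul]
  gcongr
  refine (norm_log_le a).trans ?_
  rw [abs_of_nonneg (Real.log_nonneg (hR1.trans ha))]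
  linarith [Real.pi_le_four]

/-! ### One step of the map in the coordinate `-1 / z` -/

theorem half_le_norm_one_add_mul {z v : ℂ} (hz : ‖z‖ ≤ 1 / 4) (hv : ‖v‖ ≤ 2) :
    1 / 2 ≤ ‖1 + z * v‖ := by
  have h := norm_sub_norm_le (1 : ℂ) (-(z * v))
  rw [sub_neg_eq_add, norm_neg, norm_mul, norm_one] at h
  nlinarith [norm_nonneg z, norm_nonneg v]

theorem one_add_mul_ne_zero {z v : ℂ} (hz : ‖z‖ ≤ 1 / 4) (hv : ‖v‖ ≤ 2) : 1 + z * v ≠ 0 := by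
  intro h
  have := half_le_norm_one_add_mul hz hv
  rw [h, norm_zero] at this
  norm_num at this

theorem step_ne_zero {z v : ℂ} (hz0 : z ≠ 0) (hz : ‖z‖ ≤ 1 / 4) (hv : ‖v‖ ≤ 2) :
    z + z ^ 2 * v ≠ 0 := by
  have : z + z ^ 2 * v = z * (1 + z * v) := by ring
  rw [this]
  exact mul_ne_zero hz0 (one_add_mul_ne_zero hz hv)

theorem neg_one_div_step {z v : ℂ} (hz0 : z ≠ 0) (hz : ‖z‖ ≤ 1 / 4) (hv : ‖v‖ ≤ 2) :
    -1 / (z + z ^ 2 * v) = -1 / z + v / (1 + z * v) := by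
  have h1 := one_add_mul_ne_zero hz hv
  have h2 : z + z ^ 2 * v = z * (1 + z * v) := by ring
  rw [h2]
  field_simp
  ring

/-- The quantity v / (1 + z v) is the increment of -1/z under z ↦ z + z² v. This Lipschitz bound
serves to compare two orbits. -/
theorem norm_increment_sub_le {z z' v v' : ℂ} (hz : ‖z‖ ≤ 1 / 4) (hv : ‖v‖ ≤ 2)
    (hz' : ‖z'‖ ≤ 1 / 4) (hv' : ‖v'‖ ≤ 2) :
    ‖v / (1 + z * v) - v' / (1 + z' * v')‖ ≤ 4 * ‖v - v'‖ + 16 * ‖z - z'‖ := by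
  have h1 := one_add_mul_ne_zero hz hv
  have h1' := one_add_mul_ne_zero hz' hv'
  have e : v / (1 + z * v) - v' / (1 + z' * v') =
      ((v - v') - v * v' * (z - z')) / ((1 + z * v) * (1 + z' * v')) := by
    rw [div_sub_div _ _ h1 h1']
    congr 1
    ring
  have h2 := half_le_norm_one_add_mul hz hv
  have h2' := half_le_norm_one_add_mul hz' hv'
  have h3 : 1 / 4 ≤ ‖(1 + z * v) * (1 + z' * v')‖ := by
    rw [norm_mul]; nlinarith
  have h4 : ‖(v - v') - v * v' * (z - z')‖ ≤ ‖v - v'‖ + 4 * ‖z - z'‖ := by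
    refine (norm_sub_le _ _).trans ?_
    rw [norm_mul, norm_mul]
    gcongr
    nlinarith [norm_nonneg v, norm_nonneg v']
  rw [e, norm_div, div_le_iff₀ (by linarith)]
  nlinarith [norm_nonneg (v - v'), norm_nonneg (z - z')]

section
variable {a₃ z s : ℂ} (hz : 64 * (1 + ‖a₃‖) * ‖z‖ ≤ 1) (hs : 64 * (1 + ‖a₃‖) * ‖s‖ ≤ 1)
include hz hs

theorem step_bounds : ‖z‖ ≤ 1 / 64 ∧ ‖s‖ ≤ 1 / 64 ∧ ‖1 + a₃ * z + s‖ ≤ 2 := by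
  have h0 := norm_nonneg a₃
  have hz1 : ‖z‖ ≤ 1 / 64 := by nlinarith [norm_nonneg z]
  have hs1 : ‖s‖ ≤ 1 / 64 := by nlinarith [norm_nonneg s]
  refine ⟨hz1, hs1, ?_⟩
  refine (norm_add₃_le ..).trans ?_
  rw [norm_one, norm_mul]
  nlinarith [norm_nonneg z]

/-- The increment of -1/z is 1 - (1 - a₃) z up to second order; `s` is the relative remainder of the
map. The linear term is the reason for the logarithm in the Fatou coordinates. -/
theorem increment_expansion :
    ‖(1 + a₃ * z + s) / (1 + z * (1 + a₃ * z + s)) - 1 + (1 - a₃) * z‖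
      ≤ 9 * (1 + ‖a₃‖) * (‖z‖ ^ 2 + ‖s‖) := by
  obtain ⟨hz1, hs1, hv⟩ := step_bounds hz hs
  set v := 1 + a₃ * z + s with hvdef
  have hz4 : ‖z‖ ≤ 1 / 4 := by linarith
  have h1 := one_add_mul_ne_zero hz4 hv
  have h2 := half_le_norm_one_add_mul hz4 hv
  have e : v / (1 + z * v) - 1 + (1 - a₃) * z =
      (s - a₃ * z ^ 2 - z * s + (1 - a₃) * z ^ 2 * v) / (1 + z * v) := by
    rw [eq_div_iff h1]
    have h3 : v / (1 + z * v) * (1 + z * v) = v := div_mul_cancel₀ _ h1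
    rw [hvdef] at h3 ⊢
    linear_combination h3
  have hb : ‖1 - a₃‖ ≤ 1 + ‖a₃‖ := by simpa using norm_sub_le (1 : ℂ) a₃
  have h3 : ‖s - a₃ * z ^ 2 - z * s + (1 - a₃) * z ^ 2 * v‖ ≤
      ‖s‖ + ‖a₃‖ * ‖z‖ ^ 2 + 1 / 64 * ‖s‖ + (1 + ‖a₃‖) * ‖z‖ ^ 2 * 2 := by
    refine (norm_add_le _ _).trans (add_le_add ((norm_sub_le _ _).trans (add_le_add
      ((norm_sub_le _ _).trans (add_le_add le_rfl ?_)) ?_)) ?_)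
    · rw [norm_mul, norm_pow]
    · rw [norm_mul]; gcongr
    · rw [norm_mul, norm_mul, norm_pow]; gcongr
  rw [e, norm_div, div_le_iff₀ (by linarith)]
  refine h3.trans ?_
  have h5 : 9 * (1 + ‖a₃‖) * (‖z‖ ^ 2 + ‖s‖) * (1 / 2) ≤
      9 * (1 + ‖a₃‖) * (‖z‖ ^ 2 + ‖s‖) * ‖1 + z * v‖ := by gcongr
  refine le_trans ?_ h5
  have h6 := mul_nonneg (norm_nonneg a₃) (norm_nonneg s)
  have h7 := mul_nonneg (norm_nonneg a₃) (sq_nonneg ‖z‖)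
  nlinarith [norm_nonneg s, sq_nonneg ‖z‖]

theorem increment_sub_one :
    ‖(1 + a₃ * z + s) / (1 + z * (1 + a₃ * z + s)) - 1‖
      ≤ 9 * (1 + ‖a₃‖) * (‖z‖ ^ 2 + ‖s‖) + (1 + ‖a₃‖) * ‖z‖ := by
  have h := increment_expansion hz hs
  have hb : ‖1 - a₃‖ ≤ 1 + ‖a₃‖ := by simpa using norm_sub_le (1 : ℂ) a₃
  set A := (1 + a₃ * z + s) / (1 + z * (1 + a₃ * z + s))
  have e : A - 1 = (A - 1 + (1 - a₃) * z) - (1 - a₃) * z := by ring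
  rw [e]
  refine (norm_sub_le _ _).trans (add_le_add h ?_)
  rw [norm_mul]
  gcongr

theorem increment_sub_one_le_quarter :
    ‖(1 + a₃ * z + s) / (1 + z * (1 + a₃ * z + s)) - 1‖ ≤ 1 / 4 := by
  refine (increment_sub_one hz hs).trans ?_
  obtain ⟨hz1, hs1, hv⟩ := step_bounds hz hs
  have h2 : (1 + ‖a₃‖) * ‖z‖ ^ 2 ≤ 1 / 64 * (1 / 64) := by
    have : (1 + ‖a₃‖) * ‖z‖ ^ 2 = (1 + ‖a₃‖) * ‖z‖ * ‖z‖ := by ring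
    rw [this]
    exact mul_le_mul (by linarith) hz1 (norm_nonneg _) (by norm_num)
  nlinarith

/-- If -1/z increases by `A`, it is multiplied by 1 - zA, so its logarithm changes by about -z. With
the coefficient 1 - a₃ this cancels the linear term of `A`, and both ω^ι and ω^o advance by 1 up to
O(|z|² + |s|). -/
theorem log_step_expansion {A : ℂ}
    (hA : A = (1 + a₃ * z + s) / (1 + z * (1 + a₃ * z + s))) :
    ‖z * A‖ ≤ 1 / 4 ∧ ‖A - (1 - a₃) * Complex.log (1 - z * A) - 1‖ ≤
      30 * (1 + ‖a₃‖) ^ 2 * (‖z‖ ^ 2 + ‖s‖) := by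
  obtain ⟨hz1, hs1, hv⟩ := step_bounds hz hs
  have h1 := increment_expansion hz hs
  have h2 := increment_sub_one hz hs
  have h3 := increment_sub_one_le_quarter hz hs
  rw [← hA] at h1 h2 h3
  have hb : ‖1 - a₃‖ ≤ 1 + ‖a₃‖ := by simpa using norm_sub_le (1 : ℂ) a₃
  have hA2 : ‖A‖ ≤ 2 := by
    have := norm_add_le (A - 1) 1
    rw [sub_add_cancel, norm_one] at this
    linarith
  have hzA : ‖-(z * A)‖ ≤ 2 * ‖z‖ := by
    rw [norm_neg, norm_mul]; nlinarith [norm_nonneg z]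
  refine ⟨by rw [norm_neg] at hzA; linarith, ?_⟩
  have hlog : ‖Complex.log (1 - z * A) + z * A‖ ≤ 4 * ‖z‖ ^ 2 := by
    have h4 := Complex.norm_log_one_add_sub_self_le (z := -(z * A)) (by linarith)
    rw [← sub_eq_add_neg, sub_neg_eq_add] at h4
    refine h4.trans ?_
    have h5 : (1 - ‖-(z * A)‖)⁻¹ ≤ 2 := by
      rw [inv_le_comm₀ (by linarith) (by norm_num)]
      linarith
    have h7 : 0 ≤ (1 - ‖-(z * A)‖)⁻¹ := inv_nonneg.2 (by linarith)
    have h6 : ‖-(z * A)‖ ^ 2 ≤ (2 * ‖z‖) ^ 2 := pow_le_pow_left₀ (norm_nonneg _) hzA 2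
    calc ‖-(z * A)‖ ^ 2 * (1 - ‖-(z * A)‖)⁻¹ / 2 ≤ (2 * ‖z‖) ^ 2 * 2 / 2 := by gcongr
      _ = 4 * ‖z‖ ^ 2 := by ring
  have e : A - (1 - a₃) * Complex.log (1 - z * A) - 1 =
      (A - 1 + (1 - a₃) * z) + (1 - a₃) * (z * (A - 1)) -
        (1 - a₃) * (Complex.log (1 - z * A) + z * A) := by ring
  set c := 1 + ‖a₃‖ with hc
  have hc1 : 1 ≤ c := by rw [hc]; linarith [norm_nonneg a₃]
  set E := ‖z‖ ^ 2 + ‖s‖ with hE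
  have hE0 : 0 ≤ E := by positivity
  have h7 : ‖(1 - a₃) * (z * (A - 1))‖ ≤ c * (‖z‖ * (9 * c * E + c * ‖z‖)) := by
    rw [norm_mul, norm_mul]
    gcongr
  have h8 : ‖(1 - a₃) * (Complex.log (1 - z * A) + z * A)‖ ≤ c * (4 * ‖z‖ ^ 2) := by
    rw [norm_mul]
    gcongr
  rw [e]
  refine (norm_sub_le _ _).trans ((add_le_add ((norm_add_le _ _).trans
    (add_le_add h1 h7)) h8).trans ?_)
  have hzE : ‖z‖ ^ 2 ≤ E := by rw [hE]; linarith [norm_nonneg s]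
  have h9 : c * (‖z‖ * (9 * c * E + c * ‖z‖)) ≤ 2 * c ^ 2 * E := by
    have : c * (‖z‖ * (9 * c * E + c * ‖z‖)) = c ^ 2 * (9 * (‖z‖ * E) + ‖z‖ ^ 2) := by ring
    rw [this]
    have : ‖z‖ * E ≤ 1 / 64 * E := by gcongr
    nlinarith [sq_nonneg c]
  have h10 : c * E ≤ c ^ 2 * E := by
    gcongr; nlinarith
  nlinarith

theorem neg_one_div_next (hz0 : z ≠ 0) {A : ℂ}
    (hA : A = (1 + a₃ * z + s) / (1 + z * (1 + a₃ * z + s))) :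
    z + z ^ 2 * (1 + a₃ * z + s) ≠ 0 ∧ -1 / (z + z ^ 2 * (1 + a₃ * z + s)) = -1 / z + A := by
  obtain ⟨hz1, hs1, hv⟩ := step_bounds hz hs
  exact ⟨step_ne_zero hz0 (by linarith) hv, hA ▸ neg_one_div_step hz0 (by linarith) hv⟩

theorem omegaOut_step (hz0 : z ≠ 0) (hre : -(‖1 / z‖ / 2) ≤ (1 / z).re) :
    ‖omegaOut (1 - a₃) (z + z ^ 2 * (1 + a₃ * z + s)) - omegaOut (1 - a₃) z - 1‖ ≤
      30 * (1 + ‖a₃‖) ^ 2 * (‖z‖ ^ 2 + ‖s‖) := by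
  obtain ⟨h0, h1⟩ := neg_one_div_next hz hs hz0 rfl
  obtain ⟨h2, h3⟩ := log_step_expansion hz hs rfl
  set A := (1 + a₃ * z + s) / (1 + z * (1 + a₃ * z + s)) with hA
  have e1 : 1 / (z + z ^ 2 * (1 + a₃ * z + s)) = 1 / z * (1 - z * A) := by
    have h4 : 1 / (z + z ^ 2 * (1 + a₃ * z + s)) = -(-1 / (z + z ^ 2 * (1 + a₃ * z + s))) := by ring
    rw [h4, h1]
    field_simp
    ring
  have e2 := log_mul_of_near_one (a := 1 / z) (b := 1 - z * A) (one_div_ne_zero hz0) hre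
    (by rw [sub_sub_cancel_left, norm_neg]; exact h2)
  rw [omegaOut, omegaOut, e1, e2, h1]
  convert h3 using 2
  ring

theorem omegaIn_step (hz0 : z ≠ 0) (hre : -(‖-1 / z‖ / 2) ≤ (-1 / z).re) :
    ‖omegaIn (1 - a₃) (z + z ^ 2 * (1 + a₃ * z + s)) - omegaIn (1 - a₃) z - 1‖ ≤
      30 * (1 + ‖a₃‖) ^ 2 * (‖z‖ ^ 2 + ‖s‖) := by
  obtain ⟨h0, h1⟩ := neg_one_div_next hz hs hz0 rfl
  obtain ⟨h2, h3⟩ := log_step_expansion hz hs rfl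
  set A := (1 + a₃ * z + s) / (1 + z * (1 + a₃ * z + s)) with hA
  have e1 : -1 / z + A = -1 / z * (1 - z * A) := by
    field_simp
    ring
  have e2 := log_mul_of_near_one (a := -1 / z) (b := 1 - z * A)
    (div_ne_zero (neg_ne_zero.2 one_ne_zero) hz0) hre
    (by rw [sub_sub_cancel_left, norm_neg]; exact h2)
  have e3 : Complex.log (-1 / z + A) = Complex.log (-1 / z) + Complex.log (1 - z * A) := by
    rw [e1, e2]
  rw [omegaIn, omegaIn, h1, e3]
  convert h3 using 2
  ring

end

/-- The relative remainder of a map of the form `z + z² + a₃ z³ + O(z⁴)`. -/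
theorem LocalForm.exists_step {T : ℂ × ℂ → ℂ × ℂ} {a₃ : ℂ} {ρ K : ℝ} (hT : LocalForm T a₃ ρ K)
    {z x : ℂ} (hz0 : z ≠ 0) (hz : ‖z‖ ≤ ρ) (hx : ‖x‖ ≤ ρ) :
    ∃ s : ℂ, (T (z, x)).1 = z + z ^ 2 * (1 + a₃ * z + s) ∧ ‖s‖ ≤ K * ‖z‖ ^ 2 := by
  refine ⟨((T (z, x)).1 - (z + z ^ 2 + a₃ * z ^ 3)) / z ^ 2, by field_simp; ring, ?_⟩
  rw [norm_div, norm_pow, div_le_iff₀ (by positivity)]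
  refine (hT.fst z x hz hx).trans_eq (by ring)

/-! ### The attracting Fatou coordinate -/

/-- The real part of -1/z grows by at least 1/2 per step, so the errors in ω^ι ↦ ω^ι + 1 are
dominated by a summable sequence that does not depend on the point. The same majorant yields
convergence of the limit and the uniform bound. -/
theorem LocalForm.exists_attFatou_sub_le {T : ℂ × ℂ → ℂ × ℂ} {a₃ : ℂ} {ρ K : ℝ}
    (hT : LocalForm T a₃ ρ K) :
    ∃ R C : ℝ, ∀ p : ℂ × ℂ, R ≤ (-1 / p.1).re → ‖p.2‖ ≤ ρ →
      ‖attFatou a₃ T p - omegaIn (1 - a₃) p.1‖ ≤ C := by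
  have hρ := hT.pos
  have hK := hT.one_le
  set c := 1 + ‖a₃‖ with hc
  have hc1 : 1 ≤ c := by rw [hc]; linarith [norm_nonneg a₃]
  set R : ℝ := 64 * c * (1 + K) / ρ with hR
  have hRρ : R * ρ = 64 * c * (1 + K) := by rw [hR]; field_simp
  have hRc : 64 * c * (1 + K) ≤ R := by
    rw [hR, le_div_iff₀ hρ]
    have : 0 ≤ 64 * c * (1 + K) := by positivity
    nlinarith [hT.le_one]
  have hcK : c * 2 ≤ c * (1 + K) := by gcongr; linarith
  have hR1 : 1 ≤ R := by nlinarith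
  set κ := 30 * c ^ 2 * (1 + K) with hκ
  have step : ∀ (y : ℝ) (z x : ℂ), R ≤ y → y ≤ (-1 / z).re → ‖x‖ ≤ ρ →
      y + 1 / 2 ≤ (-1 / (T (z, x)).1).re ∧ ‖(T (z, x)).2‖ ≤ ρ ∧
        ‖omegaIn (1 - a₃) (T (z, x)).1 - omegaIn (1 - a₃) z - 1‖ ≤ κ / y ^ 2 := by
    intro y z x hRy hy hx
    have hy0 : 0 < y := by linarith
    have hz0 : z ≠ 0 := by
      rintro rfl
      simp at hy
      linarith
    have hyz : y * ‖z‖ ≤ 1 := by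
      have h1 := hy.trans (Complex.re_le_norm _)
      rwa [norm_div, norm_neg, norm_one, le_div_iff₀ (norm_pos_iff.2 hz0)] at h1
    have hRz : R * ‖z‖ ≤ 1 := le_trans (by gcongr) hyz
    have hz : 64 * c * ‖z‖ ≤ 1 := by
      refine le_trans ?_ hRz
      gcongr
      nlinarith
    have hzρ : ‖z‖ ≤ ρ / 64 := by
      have h2 : R * ‖z‖ ≤ R * (ρ / 64) := by
        have : 1 ≤ c * (1 + K) := by nlinarith
        nlinarith
      exact le_of_mul_le_mul_left h2 (by linarith)
    have hKz : 64 * c * (K * ‖z‖) ≤ 1 := by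
      refine le_trans ?_ hRz
      rw [← mul_assoc]
      gcongr
      nlinarith
    have hz64 : ‖z‖ ≤ 1 / 64 := by nlinarith [norm_nonneg z]
    have hKz2 : K * ‖z‖ ^ 2 ≤ K * ‖z‖ := by nlinarith [norm_nonneg z]
    obtain ⟨s, hs, hsn⟩ := hT.exists_step hz0 (by linarith : ‖z‖ ≤ ρ) hx
    have hs' : 64 * c * ‖s‖ ≤ 1 := by
      refine le_trans ?_ hKz
      gcongr
      exact hsn.trans hKz2
    obtain ⟨h0, h1⟩ := neg_one_div_next hz hs' hz0 rfl
    have h2 := increment_sub_one_le_quarter hz hs'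
    set A := (1 + a₃ * z + s) / (1 + z * (1 + a₃ * z + s))
    refine ⟨?_, ?_, ?_⟩
    · rw [hs, h1, Complex.add_re]
      have := (abs_le.1 ((Complex.abs_re_le_norm (A - 1)).trans h2)).1
      rw [Complex.sub_re, Complex.one_re] at this
      linarith
    · refine (hT.snd z x (by linarith) hx).trans ?_
      have : K * ‖z‖ ≤ 1 := by nlinarith [norm_nonneg z]
      nlinarith [norm_nonneg z]
    · rw [hs]
      have hre : -(‖-1 / z‖ / 2) ≤ (-1 / z).re := by linarith [norm_nonneg (-1 / z)]
      refine (omegaIn_step hz hs' hz0 hre).trans ?_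
      have h3 : ‖z‖ ^ 2 ≤ 1 / y ^ 2 := by
        rw [le_div_iff₀ (by positivity), ← mul_pow]
        exact pow_le_one₀ (by positivity) (by linarith)
      calc 30 * c ^ 2 * (‖z‖ ^ 2 + ‖s‖) ≤ 30 * c ^ 2 * (1 / y ^ 2 + K * (1 / y ^ 2)) := by
            gcongr
            exact hsn.trans (by gcongr)
        _ = κ / y ^ 2 := by rw [hκ]; ring
  set d : ℕ → ℝ := fun j => 4 * κ * (1 / ((j + 1 : ℕ) : ℝ) ^ 2) with hd
  have hsum : Summable d :=
    ((summable_nat_add_iff 1).2 (Real.summable_one_div_nat_pow.2 one_lt_two)).mul_left _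
  refine ⟨R, ∑' j, d j, fun p hp hx => ?_⟩
  have hκ0 : 0 ≤ κ := by positivity
  have inv : ∀ j : ℕ, R + j / 2 ≤ (-1 / (T^[j] p).1).re ∧ ‖(T^[j] p).2‖ ≤ ρ := by
    intro j
    induction j with
    | zero => simpa using ⟨hp, hx⟩
    | succ j ih =>
      obtain ⟨h1, h2, -⟩ := step (R + j / 2) _ _ (by linarith [Nat.cast_nonneg (α := ℝ) j]) ih.1 ih.2
      rw [Function.iterate_succ_apply']
      refine ⟨?_, h2⟩
      push_cast
      linarith
  set u : ℕ → ℂ := fun j => omegaIn (1 - a₃) (T^[j] p).1 - (j : ℂ) with hu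
  have hdist : ∀ j, dist (u j) (u (j + 1)) ≤ d j := by
    intro j
    have hj := Nat.cast_nonneg (α := ℝ) j
    obtain ⟨-, -, h3⟩ := step (R + j / 2) _ _ (by linarith) (inv j).1 (inv j).2
    rw [dist_comm, dist_eq_norm]
    have e : u (j + 1) - u j = omegaIn (1 - a₃) (T ((T^[j] p).1, (T^[j] p).2)).1 -
        omegaIn (1 - a₃) (T^[j] p).1 - 1 := by
      simp only [hu, Function.iterate_succ_apply', Prod.mk.eta]
      push_cast
      ring
    rw [e]
    refine h3.trans ?_
    have h4 : ((j + 1 : ℕ) : ℝ) / 2 ≤ R + j / 2 := by push_cast; linarith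
    calc κ / (R + j / 2) ^ 2 ≤ κ / (((j + 1 : ℕ) : ℝ) / 2) ^ 2 := by
          gcongr
      _ = d j := by
          rw [hd]
          field_simp
          ring
  obtain ⟨L, hL⟩ := cauchySeq_tendsto_of_complete (cauchySeq_of_dist_le_of_summable d hdist hsum)
  have h5 := dist_le_tsum_of_dist_le_of_tendsto₀ d hdist hsum hL
  have h6 : attFatou a₃ T p = L := hL.limUnder_eq
  rw [h6, ← dist_eq_norm, dist_comm]
  simpa [hu] using h5

/-! ### Orbits on the repelling side -/

/-- Scales on which the repelling coordinate of a local form is under control. -/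
structure RepellingScale (a₃ : ℂ) (ρ K Ra R κ : ℝ) : Prop where
  one_le : 1 ≤ Ra
  rho : 64 * (1 + ‖a₃‖) * (1 + K) ≤ Ra * ρ
  log_le : ∀ a : ℂ, Ra ≤ ‖a‖ → ‖(1 - a₃) * Complex.log a‖ ≤ 1 / 8 * ‖a‖
  kappa : κ = 40000 * (1 + ‖a₃‖) ^ 2 * (1 + K)
  le : 2 * Ra + 8 ≤ R
  kappa_le : 64 * κ ≤ R

theorem exists_repellingScale (a₃ : ℂ) {ρ K : ℝ} (hρ : 0 < ρ) :
    ∃ Ra R κ : ℝ, RepellingScale a₃ ρ K Ra R κ := by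
  obtain ⟨R₁, h1, h2⟩ := exists_norm_mul_log_le (1 - a₃) (η := 1 / 8) (by norm_num)
  refine ⟨max R₁ (64 * (1 + ‖a₃‖) * (1 + K) / ρ), _, _, h1.trans (le_max_left _ _), ?_,
    fun a ha => h2 a ((le_max_left _ _).trans ha), rfl, le_max_left _ _, le_max_right _ _⟩
  rw [← div_le_iff₀ hρ]
  exact le_max_right _ _

section
variable {T : ℂ × ℂ → ℂ × ℂ} {a₃ : ℂ} {ρ K Ra R κ : ℝ} (hT : LocalForm T a₃ ρ K)
  (hR : RepellingScale a₃ ρ K Ra R κ)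
include hT hR

theorem RepellingScale.small {z : ℂ} (hz0 : z ≠ 0) (hz : Ra ≤ ‖1 / z‖) :
    64 * (1 + ‖a₃‖) * (1 + K) * ‖z‖ ≤ ρ := by
  have h1 : Ra * ‖z‖ ≤ 1 := by
    rwa [norm_div, norm_one, le_div_iff₀ (norm_pos_iff.2 hz0)] at hz
  have h2 := mul_le_mul_of_nonneg_right hR.rho (norm_nonneg z)
  nlinarith [hT.pos]

theorem RepellingScale.small' {z : ℂ} (hz0 : z ≠ 0) (hz : Ra ≤ ‖1 / z‖) {σ : ℝ}
    (hσ : 128 * (1 + ‖a₃‖) * σ ≤ 1) :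
    ‖z‖ ≤ ρ / 64 ∧ 64 * (1 + ‖a₃‖) * ‖z‖ ≤ 1 ∧ K * ‖z‖ ^ 2 ≤ ρ / 2 ∧
      64 * (1 + ‖a₃‖) * (K * ‖z‖ ^ 2 + σ) ≤ 1 := by
  have h := hR.small hT hz0 hz
  have hK := hT.one_le
  have hρ := hT.pos
  have hρ1 := hT.le_one
  have hc := norm_nonneg a₃
  have hz := norm_nonneg z
  have h1 : 0 ≤ ‖a₃‖ * ‖z‖ := mul_nonneg hc hz
  have h2 : 0 ≤ K * ‖z‖ := by positivity
  have h3 : 0 ≤ ‖a₃‖ * (K * ‖z‖) := by positivity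
  have e : 64 * (1 + ‖a₃‖) * (1 + K) * ‖z‖ =
    64 * ‖z‖ + 64 * (‖a₃‖ * ‖z‖) + 64 * (K * ‖z‖) + 64 * (‖a₃‖ * (K * ‖z‖)) := by ring
  have hz1 : ‖z‖ ≤ ρ / 64 := by linarith
  have hKz : K * ‖z‖ ^ 2 ≤ K * ‖z‖ * (1 / 64) := by
    rw [sq, ← mul_assoc]
    gcongr
    linarith
  refine ⟨hz1, by nlinarith, by linarith, ?_⟩
  have h5 : (1 + ‖a₃‖) * (K * ‖z‖ ^ 2) ≤ (1 + ‖a₃‖) * (K * ‖z‖ * (1 / 64)) := by gcongr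
  nlinarith

omit hT in
-- On this scale the logarithmic term is at most |1/z|/8, so 1/|z| and |W| are comparable within a
-- factor 2.
theorem RepellingScale.location {z W : ℂ} (hz : Ra ≤ ‖1 / z‖)
    (hW : 8 ≤ ‖W‖) (h : ‖omegaOut (1 - a₃) z - W‖ ≤ 1) :
    ‖W‖ / 2 ≤ ‖1 / z‖ ∧ ‖1 / z‖ ≤ 2 * ‖W‖ ∧ ‖-1 / z - W‖ ≤ ‖1 / z‖ / 8 + 1 := by
  have h1 := hR.log_le _ hz
  have e : -1 / z - W = (omegaOut (1 - a₃) z - W) + (1 - a₃) * Complex.log (1 / z) := by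
    rw [omegaOut]; ring
  have h2 : ‖-1 / z - W‖ ≤ ‖1 / z‖ / 8 + 1 := by
    rw [e]
    refine (norm_add_le _ _).trans ?_
    linarith
  have e2 : ‖-1 / z‖ = ‖1 / z‖ := by simp
  have h3 := norm_sub_norm_le (-1 / z) W
  have h4 := norm_sub_norm_le W (-1 / z)
  rw [norm_sub_rev] at h4
  rw [e2] at h3 h4
  exact ⟨by linarith, by linarith, h2⟩

set_option maxHeartbeats 800000 in
-- Bootstrap: as long as ω^o stays within 1 of W + j, |z_j| is O(1/(R + N - j)). Then the errors
-- O(|z_j|²) have a small sum, and the extra relative perturbation `σ` contributes at most a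
-- constant times Nσ. So ω^o never drifts by more than 1.
theorem RepellingScale.control {N : ℕ} {W : ℂ} {σ : ℝ} {p : ℕ → ℂ × ℂ} (hσ0 : 0 ≤ σ)
    (hσ : 128 * (1 + ‖a₃‖) * σ ≤ 1) (hNσ : N * (120 * (1 + ‖a₃‖) ^ 2 * σ) ≤ 1)
    (hW : W.re ≤ -(R + N)) (hz0 : (p 0).1 ≠ 0) (hz : Ra ≤ ‖1 / (p 0).1‖) (hx : ‖(p 0).2‖ ≤ ρ)
    (hω : ‖omegaOut (1 - a₃) (p 0).1 - W‖ ≤ 1 / 2)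
    (hstep : ∀ j < N, (p j).1 ≠ 0 → ‖(p j).1‖ ≤ ρ → ‖(p j).2‖ ≤ ρ →
      ‖W + j‖ / 2 ≤ ‖1 / (p j).1‖ → ‖1 / (p j).1‖ ≤ 2 * ‖W + j‖ →
      ∃ s : ℂ, (p (j + 1)).1 = (p j).1 + (p j).1 ^ 2 * (1 + a₃ * (p j).1 + s) ∧
        ‖s‖ ≤ K * ‖(p j).1‖ ^ 2 + σ ∧ ‖(p (j + 1)).2‖ ≤ ‖(p j).2‖ / 2 + K * ‖(p j).1‖ ^ 2) :
    ∀ j ≤ N, (p j).1 ≠ 0 ∧ Ra ≤ ‖1 / (p j).1‖ ∧ ‖(p j).2‖ ≤ ρ ∧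
      ‖omegaOut (1 - a₃) (p j).1 - (W + j)‖ ≤ 1 ∧ R + (N - j) ≤ ‖W + j‖ ∧
      ‖W + j‖ / 2 ≤ ‖1 / (p j).1‖ ∧ ‖1 / (p j).1‖ ≤ 2 * ‖W + j‖ := by
  have hK := hT.one_le
  have hκ := hR.kappa
  set c := 1 + ‖a₃‖ with hc
  have hc1 : 1 ≤ c := by rw [hc]; linarith [norm_nonneg a₃]
  have hκ0 : 0 < κ := by rw [hκ]; positivity
  have hRκ := hR.kappa_le
  have hRa := hR.one_le
  have hRR := hR.le
  have hWj : ∀ j : ℕ, R + (N - j) ≤ ‖W + j‖ := by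
    intro j
    have h1 : -(W + j).re ≤ ‖W + j‖ := (neg_le_abs _).trans (Complex.abs_re_le_norm _)
    rw [Complex.add_re, Complex.natCast_re] at h1
    linarith
  -- The term `κ / (R + (N - j))` is a telescoping majorant of the sum of κ/y² over the steps made
  -- so far, by κ/y² + κ/y ≤ κ/(y - 1).
  have main : ∀ j ≤ N, (p j).1 ≠ 0 ∧ Ra ≤ ‖1 / (p j).1‖ ∧ ‖(p j).2‖ ≤ ρ ∧
      ‖omegaOut (1 - a₃) (p j).1 - (W + j)‖ ≤ 1 / 2 + κ / (R + (N - j)) + j * (30 * c ^ 2 * σ) := by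
    intro j
    induction j with
    | zero =>
      intro _
      refine ⟨hz0, hz, hx, ?_⟩
      have : 0 ≤ κ / (R + (N - (0 : ℕ))) := by
        apply div_nonneg hκ0.le
        push_cast
        have := Nat.cast_nonneg (α := ℝ) N
        linarith
      simp only [Nat.cast_zero, add_zero, zero_mul] at this ⊢
      linarith
    | succ j ih =>
      intro hj
      obtain ⟨i1, i2, i3, i4⟩ := ih (by omega)
      have hjN : ((j : ℝ) + 1) ≤ N := by exact_mod_cast hj
      set y : ℝ := R + (N - j) with hy
      have hy1 : R + 1 ≤ y := by rw [hy]; linarith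
      have hy0 : 0 < y := by linarith
      have hω1 : ‖omegaOut (1 - a₃) (p j).1 - (W + j)‖ ≤ 1 := by
        refine i4.trans ?_
        have h1 : κ / y ≤ 1 / 64 := by
          rw [div_le_iff₀ hy0]; linarith
        have h2 : (j : ℝ) * (30 * c ^ 2 * σ) ≤ N * (30 * c ^ 2 * σ) := by
          gcongr
          linarith
        linarith
      have hWjj := hWj j
      obtain ⟨l1, l2, l3⟩ := hR.location i2 (by linarith) hω1
      obtain ⟨m1, m2, m3, m4⟩ := hR.small' hT i1 i2 hσ
      obtain ⟨s, e, hs, hx'⟩ := hstep j (by omega) i1 (by linarith [hT.pos]) i3 l1 l2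
      have hs' : 64 * c * ‖s‖ ≤ 1 := le_trans (by gcongr) m4
      obtain ⟨n1, n2⟩ := neg_one_div_next m2 hs' i1 rfl
      have n3 := increment_sub_one_le_quarter m2 hs'
      set A := (1 + a₃ * (p j).1 + s) / (1 + (p j).1 * (1 + a₃ * (p j).1 + s))
      have hre : -(‖1 / (p j).1‖ / 2) ≤ (1 / (p j).1).re := by
        have h1 : (-1 / (p j).1 - (W + j)).re ≤ ‖1 / (p j).1‖ / 8 + 1 :=
          (Complex.re_le_norm _).trans l3
        have h2 : (-1 / (p j).1).re = -(1 / (p j).1).re := by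
          rw [neg_div, Complex.neg_re]
        rw [Complex.sub_re, h2, Complex.add_re, Complex.natCast_re] at h1
        linarith
      have h1 := omegaOut_step m2 hs' i1 hre
      rw [← e] at n1 n2 h1
      have hzy : ‖(p j).1‖ ^ 2 ≤ 4 / y ^ 2 := by
        have h2 : y / 2 ≤ ‖1 / (p j).1‖ := by linarith
        rw [norm_div, norm_one, le_div_iff₀ (norm_pos_iff.2 i1)] at h2
        rw [le_div_iff₀ (by positivity)]
        have h3 : ‖(p j).1‖ * y ≤ 2 := by linarith
        calc ‖(p j).1‖ ^ 2 * y ^ 2 = (‖(p j).1‖ * y) ^ 2 := by ring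
          _ ≤ 2 ^ 2 := by gcongr
          _ = 4 := by norm_num
      refine ⟨n1, ?_, ?_, ?_⟩
      · have e3 : ‖1 / (p (j + 1)).1‖ = ‖-1 / (p j).1 + A‖ := by
          rw [← n2]; simp
        have h3 : ‖A‖ ≤ 2 := by
          have := norm_add_le (A - 1) 1
          rw [sub_add_cancel, norm_one] at this
          linarith
        have h4 := norm_sub_norm_le (-1 / (p j).1) (-A)
        rw [sub_neg_eq_add, norm_neg] at h4
        have e4 : ‖-1 / (p j).1‖ = ‖1 / (p j).1‖ := by simp
        rw [e3]
        linarith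
      · linarith
      · have e5 : omegaOut (1 - a₃) (p (j + 1)).1 - (W + ((j + 1 : ℕ) : ℂ)) =
            (omegaOut (1 - a₃) (p (j + 1)).1 - omegaOut (1 - a₃) (p j).1 - 1) +
              (omegaOut (1 - a₃) (p j).1 - (W + j)) := by
          push_cast; ring
        rw [e5]
        refine (norm_add_le _ _).trans ((add_le_add h1 i4).trans ?_)
        have h6 : 30 * c ^ 2 * (‖(p j).1‖ ^ 2 + ‖s‖) ≤ κ / y ^ 2 + 30 * c ^ 2 * σ := by
          have h7 : 30 * c ^ 2 * (‖(p j).1‖ ^ 2 + ‖s‖) ≤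
              30 * c ^ 2 * (4 / y ^ 2 + (K * (4 / y ^ 2) + σ)) := by
            gcongr
            exact hs.trans (by gcongr)
          refine h7.trans ?_
          have h8 : 120 * c ^ 2 * (1 + K) ≤ κ := by
            rw [hκ]; gcongr; norm_num
          have h9 : 120 * c ^ 2 * (1 + K) / y ^ 2 ≤ κ / y ^ 2 := by gcongr
          have e6 : 30 * c ^ 2 * (4 / y ^ 2 + (K * (4 / y ^ 2) + σ)) =
            120 * c ^ 2 * (1 + K) / y ^ 2 + 30 * c ^ 2 * σ := by ring
          linarith
        have h10 : κ / y ^ 2 + κ / y ≤ κ / (y - 1) := by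
          have hy1' : 0 < y - 1 := by linarith
          have : κ / (y - 1) - κ / y - κ / y ^ 2 = κ / (y ^ 2 * (y - 1)) := by
            field_simp; ring
          have h11 : 0 ≤ κ / (y ^ 2 * (y - 1)) := by positivity
          linarith
        have e7 : R + ((N : ℝ) - ((j + 1 : ℕ) : ℝ)) = y - 1 := by rw [hy]; push_cast; ring
        rw [e7]
        push_cast
        linarith
  intro j hj
  obtain ⟨i1, i2, i3, i4⟩ := main j hj
  have hjN : (j : ℝ) ≤ N := by exact_mod_cast hj
  have hω1 : ‖omegaOut (1 - a₃) (p j).1 - (W + j)‖ ≤ 1 := by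
    refine i4.trans ?_
    have h1 : κ / (R + (N - j)) ≤ 1 / 64 := by
      rw [div_le_iff₀ (by linarith)]; linarith
    have h2 : (j : ℝ) * (30 * c ^ 2 * σ) ≤ N * (30 * c ^ 2 * σ) := by
      gcongr
    linarith
  obtain ⟨l1, l2, l3⟩ := hR.location i2 (by linarith [hWj j]) hω1
  exact ⟨i1, i2, i3, hω1, hWj j, l1, l2⟩

end

/-! ### Comparison of two orbits on the repelling side -/

section
variable {T : ℂ × ℂ → ℂ × ℂ} {a₃ : ℂ} {ρ K : ℝ} (hT : LocalForm T a₃ ρ K)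
include hT

/-- The Lipschitz bound for the remainder z²s is divided by z². The comparability `M ≤ 16 * ‖z‖`
makes this division cost only a constant. -/
theorem LocalForm.remainder_sub_le {z z' x x' s s' : ℂ} {M : ℝ} (hz0 : z ≠ 0) (hz0' : z' ≠ 0)
    (hz : ‖z‖ ≤ M) (hz' : ‖z'‖ ≤ M) (hMz : M ≤ 16 * ‖z‖) (hM : 64 * M ≤ 1) (hMρ : M ≤ ρ)
    (hx : ‖x‖ ≤ ρ) (hx' : ‖x'‖ ≤ ρ)
    (hs : (T (z, x)).1 = z + z ^ 2 * (1 + a₃ * z + s))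
    (hs' : (T (z', x')).1 = z' + z' ^ 2 * (1 + a₃ * z' + s')) (hsn' : ‖s'‖ ≤ K * ‖z'‖ ^ 2) :
    ‖s - s'‖ ≤ 12 * K * ‖z - z'‖ + 256 * K * M ^ 2 * ‖x - x'‖ := by
  have hK := hT.one_le
  have hM0 : 0 < M := (norm_pos_iff.2 hz0).trans_le hz
  have h1 := hT.fst_lip M z z' x x' hMρ hz hz' hx hx'
  have e1 : ((T (z, x)).1 - (z + z ^ 2 + a₃ * z ^ 3)) - ((T (z', x')).1 - (z' + z' ^ 2 + a₃ * z' ^ 3))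
      = z ^ 2 * (s - s') + (z - z') * ((z + z') * s') := by
    rw [hs, hs']; ring
  rw [e1] at h1
  have h2 : ‖z ^ 2 * (s - s')‖ ≤ K * (M ^ 3 * ‖z - z'‖ + M ^ 4 * ‖x - x'‖) +
      ‖(z - z') * ((z + z') * s')‖ := by
    have := norm_sub_le (z ^ 2 * (s - s') + (z - z') * ((z + z') * s')) ((z - z') * ((z + z') * s'))
    rw [add_sub_cancel_right] at this
    linarith
  have h3 : ‖(z - z') * ((z + z') * s')‖ ≤ ‖z - z'‖ * ((2 * M) * (K * M ^ 2)) := by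
    rw [norm_mul, norm_mul]
    gcongr
    · linarith [norm_add_le z z']
    · exact hsn'.trans (by gcongr)
  rw [norm_mul, norm_pow] at h2
  have h4 : (M / 16) ^ 2 ≤ ‖z‖ ^ 2 := pow_le_pow_left₀ (by positivity) (by linarith) 2
  have h5 : (M / 16) ^ 2 * ‖s - s'‖ ≤ ‖z‖ ^ 2 * ‖s - s'‖ := by gcongr
  have h6 : (M / 16) ^ 2 * ‖s - s'‖ ≤
      (M / 16) ^ 2 * (12 * K * ‖z - z'‖ + 256 * K * M ^ 2 * ‖x - x'‖) := by
    refine h5.trans (h2.trans ((add_le_add_right h3 _).trans ?_))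
    have h7 : K * M ^ 3 * ‖z - z'‖ * 64 ≤ K * M ^ 2 * ‖z - z'‖ := by
      calc K * M ^ 3 * ‖z - z'‖ * 64 = K * M ^ 2 * ‖z - z'‖ * (64 * M) := by ring
        _ ≤ K * M ^ 2 * ‖z - z'‖ * 1 := by gcongr
        _ = K * M ^ 2 * ‖z - z'‖ := mul_one _
    linarith
  exact le_of_mul_le_mul_left h6 (by positivity)

/-- Since |z - z'| ≤ M² |1/z - 1/z'|, a bounded Lipschitz constant in z becomes a factor O(M²) in
the coordinate -1/z. A perturbation `e` of the first coordinate is divided by z² and so costs O(ε).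
-/
theorem LocalForm.compare_step {z z' x x' e : ℂ} {M ε : ℝ} (hz0 : z ≠ 0) (hz0' : z' ≠ 0)
    (hz : ‖z‖ ≤ M) (hz' : ‖z'‖ ≤ M) (hMz : M ≤ 16 * ‖z‖)
    (hM : 64 * (1 + ‖a₃‖) * (1 + K) * M ≤ ρ) (hx : ‖x‖ ≤ ρ) (hx' : ‖x'‖ ≤ ρ)
    (he : ‖e‖ ≤ ε * ‖z‖ ^ 2) (hε : 128 * (1 + ‖a₃‖) * ε ≤ 1) :
    ‖(-1 / ((T (z, x)).1 + e) - -1 / (T (z', x')).1) - (-1 / z - -1 / z')‖ ≤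
      1024 * (1 + ‖a₃‖) * (1 + K) * M ^ 2 * (‖-1 / z - -1 / z'‖ + ‖x - x'‖) + 4 * ε := by
  have hK := hT.one_le
  have hρ1 := hT.le_one
  set c := 1 + ‖a₃‖ with hc
  have hc1 : 1 ≤ c := by rw [hc]; linarith [norm_nonneg a₃]
  have hM0 : 0 < M := (norm_pos_iff.2 hz0).trans_le hz
  have hcM : M ≤ c * M := le_mul_of_one_le_left hM0.le hc1
  have hKM : M ≤ K * M := le_mul_of_one_le_left hM0.le hK
  have hcKM : K * M ≤ c * (K * M) := le_mul_of_one_le_left (by positivity) hc1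
  have hM' : 64 * (c * M) + 64 * (c * (K * M)) ≤ ρ := le_of_eq_of_le (by ring) hM
  have hMρ : 64 * M ≤ ρ := by linarith
  have hzc : ∀ y : ℂ, ‖y‖ ≤ M → 64 * c * ‖y‖ ≤ 1 := by
    intro y hy
    have : 64 * c * ‖y‖ ≤ 64 * c * M := by gcongr
    linarith
  have hKy : ∀ y : ℂ, ‖y‖ ≤ M → 64 * c * (K * ‖y‖ ^ 2) ≤ 1 / 64 := by
    intro y hy
    have h1 : 64 * c * (K * ‖y‖ ^ 2) ≤ 64 * c * (K * M ^ 2) := by gcongr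
    have h2 : 64 * c * (K * M ^ 2) = 64 * (c * (K * M)) * M := by ring
    have h3 : 64 * (c * (K * M)) * M ≤ 1 * (1 / 64) := by gcongr <;> linarith
    linarith
  obtain ⟨s, hs, hsn⟩ := hT.exists_step hz0 (by linarith : ‖z‖ ≤ ρ) hx
  obtain ⟨s', hs', hsn'⟩ := hT.exists_step hz0' (by linarith : ‖z'‖ ≤ ρ) hx'
  have hss := hT.remainder_sub_le hz0 hz0' hz hz' hMz (by linarith) (by linarith) hx hx' hs hs' hsn'
  have hη : ‖e / z ^ 2‖ ≤ ε := by
    rw [norm_div, norm_pow, div_le_iff₀ (by positivity)]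
    exact he
  have e1 : (T (z, x)).1 + e = z + z ^ 2 * (1 + a₃ * z + (s + e / z ^ 2)) := by
    rw [hs]; field_simp; ring
  have b1 : 64 * c * ‖s + e / z ^ 2‖ ≤ 1 := by
    have h1 : 64 * c * ‖s + e / z ^ 2‖ ≤ 64 * c * (K * ‖z‖ ^ 2 + ε) := by
      gcongr
      exact (norm_add_le _ _).trans (add_le_add hsn hη)
    have h2 := hKy z hz
    linarith
  have b1' : 64 * c * ‖s'‖ ≤ 1 := by
    have h1 : 64 * c * ‖s'‖ ≤ 64 * c * (K * ‖z'‖ ^ 2) := by gcongr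
    linarith [hKy z' hz']
  obtain ⟨-, n1⟩ := neg_one_div_next (hzc z hz) b1 hz0 rfl
  obtain ⟨-, n1'⟩ := neg_one_div_next (hzc z' hz') b1' hz0' rfl
  obtain ⟨d1, -, d2⟩ := step_bounds (hzc z hz) b1
  obtain ⟨d1', -, d2'⟩ := step_bounds (hzc z' hz') b1'
  have h1 := norm_increment_sub_le (by linarith : ‖z‖ ≤ 1 / 4) d2 (by linarith : ‖z'‖ ≤ 1 / 4) d2'
  rw [e1, hs', n1, n1']
  set A := (1 + a₃ * z + (s + e / z ^ 2)) / (1 + z * (1 + a₃ * z + (s + e / z ^ 2)))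
  set A' := (1 + a₃ * z' + s') / (1 + z' * (1 + a₃ * z' + s'))
  have e2 : (-1 / z + A - (-1 / z' + A')) - (-1 / z - -1 / z') = A - A' := by ring
  rw [e2]
  refine h1.trans ?_
  have h2 : ‖(1 + a₃ * z + (s + e / z ^ 2)) - (1 + a₃ * z' + s')‖ ≤
      c * ‖z - z'‖ + (12 * K * ‖z - z'‖ + 256 * K * M ^ 2 * ‖x - x'‖) + ε := by
    have e3 : (1 + a₃ * z + (s + e / z ^ 2)) - (1 + a₃ * z' + s') =
        a₃ * (z - z') + (s - s') + e / z ^ 2 := by ring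
    rw [e3]
    refine (norm_add₃_le ..).trans (add_le_add (add_le_add ?_ hss) hη)
    rw [norm_mul]
    gcongr
    rw [hc]; linarith
  have h3 : ‖z - z'‖ ≤ M ^ 2 * ‖-1 / z - -1 / z'‖ := by
    have e4 : z - z' = z * z' * (-1 / z - -1 / z') := by field_simp; ring
    conv_lhs => rw [e4]
    rw [norm_mul, norm_mul, sq]
    gcongr
  set Δ := ‖-1 / z - -1 / z'‖
  have hΔ : 0 ≤ Δ := norm_nonneg _
  have h4 : 4 * (c * ‖z - z'‖ + (12 * K * ‖z - z'‖ + 256 * K * M ^ 2 * ‖x - x'‖) + ε) +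
      16 * ‖z - z'‖ = (4 * c + 48 * K + 16) * ‖z - z'‖ + 1024 * K * M ^ 2 * ‖x - x'‖ + 4 * ε := by
    ring
  have hcK : K ≤ c * K := le_mul_of_one_le_left (by linarith) hc1
  have h5 : 4 * c + 48 * K + 16 ≤ 1024 * c * (1 + K) := by linarith
  have h6 : 1024 * K ≤ 1024 * c * (1 + K) := by linarith
  have h7 : (4 * c + 48 * K + 16) * ‖z - z'‖ ≤ 1024 * c * (1 + K) * (M ^ 2 * Δ) := by gcongr
  have h8 : 1024 * K * M ^ 2 * ‖x - x'‖ ≤ 1024 * c * (1 + K) * M ^ 2 * ‖x - x'‖ := by gcongr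
  linarith

set_option maxHeartbeats 1600000 in
/-- Two orbits that stay on the repelling side and have comparable first coordinates remain close
in the coordinate `-1 / z`. -/
theorem RepellingScale.compare {Ra R κ : ℝ} (hR : RepellingScale a₃ ρ K Ra R κ) {N : ℕ} {ε : ℝ}
    {p q : ℕ → ℂ × ℂ} (hε0 : 0 ≤ ε) (hε : 128 * (1 + ‖a₃‖) * ε ≤ 1)
    (hp : ∀ j ≤ N, (p j).1 ≠ 0 ∧ Ra ≤ ‖1 / (p j).1‖ ∧ ‖(p j).2‖ ≤ ρ ∧
      (R + (N - j)) / 2 ≤ ‖1 / (p j).1‖)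
    (hq : ∀ j ≤ N, (q j).1 ≠ 0 ∧ Ra ≤ ‖1 / (q j).1‖ ∧ ‖(q j).2‖ ≤ ρ ∧
      (R + (N - j)) / 2 ≤ ‖1 / (q j).1‖)
    (hpq : ∀ j ≤ N, ‖(q j).1‖ ≤ 16 * ‖(p j).1‖)
    (hps : ∀ j < N, ‖(p (j + 1)).1 - (T (p j)).1‖ ≤ ε * ‖(p j).1‖ ^ 2 ∧
      (p (j + 1)).2 = (T (p j)).2)
    (hqs : ∀ j < N, q (j + 1) = T (q j)) {B : ℝ}
    (hB : ‖-1 / (p 0).1 - -1 / (q 0).1‖ + ‖(p 0).2 - (q 0).2‖ + 4 * N * ε ≤ B) :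
    ∀ j ≤ N, ‖-1 / (p j).1 - -1 / (q j).1‖ + ‖(p j).2 - (q j).2‖ ≤ 2 * B ∧
      ‖(-1 / (p j).1 - -1 / (q j).1) - (-1 / (p 0).1 - -1 / (q 0).1)‖ ≤ B / 64 + 4 * N * ε := by
  have hK := hT.one_le
  have hκ := hR.kappa
  set c := 1 + ‖a₃‖ with hc
  have hc1 : 1 ≤ c := by rw [hc]; linarith [norm_nonneg a₃]
  have hc0 : 0 < c := by linarith
  have hK0 : 0 ≤ K := by linarith
  have hκ0 : 0 < κ := by rw [hκ]; positivity
  have hRκ := hR.kappa_le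
  have hRa := hR.one_le
  have hRR := hR.le
  set D : ℕ → ℝ := fun j => ‖-1 / (p j).1 - -1 / (q j).1‖ + ‖(p j).2 - (q j).2‖ with hD
  have hD0 : ∀ j, 0 ≤ D j := fun j => by positivity
  have hB0 : 0 ≤ B := le_trans (by positivity) hB
  have step : ∀ j < N, ‖(-1 / (p (j + 1)).1 - -1 / (q (j + 1)).1) - (-1 / (p j).1 - -1 / (q j).1)‖ ≤
        κ / (8 * (R + (N - j)) ^ 2) * D j + 4 * ε ∧
      D (j + 1) ≤ (1 + κ / (4 * (R + (N - j)) ^ 2)) * D j + 4 * ε := by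
    intro j hj
    obtain ⟨p1, p2, p3, p4⟩ := hp j hj.le
    obtain ⟨q1, q2, q3, q4⟩ := hq j hj.le
    obtain ⟨s1, s2⟩ := hps j hj
    have hjN : (j : ℝ) + 1 ≤ N := by exact_mod_cast hj
    set y : ℝ := R + (N - j) with hy
    have hy1 : 1 ≤ y := by rw [hy]; linarith
    set M := max ‖(p j).1‖ ‖(q j).1‖ with hM
    have sm : ∀ z : ℂ, z ≠ 0 → y / 2 ≤ ‖1 / z‖ → ‖z‖ ≤ 2 / y := by
      intro z hz h
      rw [norm_div, norm_one, le_div_iff₀ (norm_pos_iff.2 hz)] at h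
      rw [le_div_iff₀ (by linarith)]
      linarith
    have hMy : M ≤ 2 / y := max_le (sm _ p1 p4) (sm _ q1 q4)
    have hM0 : 0 ≤ M := (norm_nonneg _).trans (le_max_left _ _)
    have hMρ : 64 * c * (1 + K) * M ≤ ρ := by
      rcases max_choice ‖(p j).1‖ ‖(q j).1‖ with h | h
      · rw [hM, h]; exact hR.small hT p1 p2
      · rw [hM, h]; exact hR.small hT q1 q2
    have hM16 : M ≤ 16 * ‖(p j).1‖ := max_le (by linarith [norm_nonneg (p j).1]) (hpq j hj.le)
    have h1 := hT.compare_step (e := (p (j + 1)).1 - (T (p j)).1) p1 q1 (le_max_left _ _)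
      (le_max_right _ _) hM16 hMρ p3 q3 s1 hε
    rw [Prod.mk.eta, Prod.mk.eta, add_sub_cancel, ← hqs j hj] at h1
    have hM2 : M ^ 2 ≤ 4 / y ^ 2 := by
      calc M ^ 2 ≤ (2 / y) ^ 2 := by gcongr
        _ = 4 / y ^ 2 := by rw [div_pow]; norm_num
    have hκ1 : 8 * 4096 * (c * (1 + K)) ≤ κ := by
      rw [hκ]
      have h5 : c * (1 + K) * 1 ≤ c * (1 + K) * c := by gcongr
      linarith [mul_pos (by linarith : 0 < c) (by linarith : 0 < 1 + K)]
    have h2 : ‖(-1 / (p (j + 1)).1 - -1 / (q (j + 1)).1) - (-1 / (p j).1 - -1 / (q j).1)‖ ≤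
        κ / (8 * y ^ 2) * D j + 4 * ε := by
      refine h1.trans ?_
      gcongr ?_ * D j + _
      calc 1024 * c * (1 + K) * M ^ 2 ≤ 1024 * c * (1 + K) * (4 / y ^ 2) := by gcongr
        _ = (8 * 4096 * (c * (1 + K))) / (8 * y ^ 2) := by field_simp; norm_num
        _ ≤ κ / (8 * y ^ 2) := by gcongr
    refine ⟨h2, ?_⟩
    have hpρ : ∀ z : ℂ, ‖z‖ ≤ M → ‖z‖ ≤ ρ := by
      intro z hz
      refine hz.trans (le_trans ?_ hMρ)
      have h5 : 1 ≤ 64 * (c * (1 + K)) := by linarith [mul_le_mul hc1 hK zero_le_one hc0.le]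
      calc M ≤ 64 * (c * (1 + K)) * M := le_mul_of_one_le_left hM0 h5
        _ = 64 * c * (1 + K) * M := by ring
    have h3 := hT.snd_lip (p j).1 (q j).1 (p j).2 (q j).2 (hpρ _ (le_max_left _ _))
      (hpρ _ (le_max_right _ _)) p3 q3
    rw [Prod.mk.eta, Prod.mk.eta, ← hqs j hj, ← s2] at h3
    have h4 : K * ‖(p j).1 - (q j).1‖ ≤ κ / (8 * y ^ 2) * D j := by
      have e4 : (p j).1 - (q j).1 = (p j).1 * (q j).1 * (-1 / (p j).1 - -1 / (q j).1) := by
        field_simp; ring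
      rw [e4, norm_mul, norm_mul]
      have h5 : ‖(p j).1‖ * ‖(q j).1‖ ≤ M ^ 2 := by
        rw [sq]
        gcongr
        · exact le_max_left _ _
        · exact le_max_right _ _
      calc K * (‖(p j).1‖ * ‖(q j).1‖ * ‖-1 / (p j).1 - -1 / (q j).1‖) ≤
            K * (4 / y ^ 2 * D j) := by
              gcongr
              · exact h5.trans hM2
              · exact le_add_of_nonneg_right (norm_nonneg _)
        _ = (32 * K) / (8 * y ^ 2) * D j := by field_simp; ring
        _ ≤ κ / (8 * y ^ 2) * D j := by
              gcongr
              linarith [mul_le_mul hc1 hK zero_le_one hc0.le, le_mul_of_one_le_left hK0 hc1]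
    have h6 : ‖-1 / (p (j + 1)).1 - -1 / (q (j + 1)).1‖ ≤ ‖-1 / (p j).1 - -1 / (q j).1‖ +
        (κ / (8 * y ^ 2) * D j + 4 * ε) := by
      have := norm_add_le ((-1 / (p (j + 1)).1 - -1 / (q (j + 1)).1) - (-1 / (p j).1 - -1 / (q j).1))
        (-1 / (p j).1 - -1 / (q j).1)
      rw [sub_add_cancel] at this
      linarith
    have e5 : κ / (4 * y ^ 2) = κ / (8 * y ^ 2) + κ / (8 * y ^ 2) := by field_simp; norm_num
    have h7 : D (j + 1) ≤ D j + (κ / (8 * y ^ 2) * D j + κ / (8 * y ^ 2) * D j) + 4 * ε := by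
      simp only [hD] at h4 h6 ⊢
      linarith [norm_nonneg ((p j).2 - (q j).2)]
    rw [e5]
    linarith
  -- The growth factors 1 + κ/(4y²) are absorbed by the weight 1 + κ/(R + N - j), which increases
  -- with j and stays below 2.
  have main : ∀ j ≤ N, D j ≤ (D 0 + 4 * j * ε) * (1 + κ / (R + (N - j))) := by
    intro j
    induction j with
    | zero =>
      intro _
      have h0 : 0 ≤ κ / (R + (N - (0 : ℕ))) := by
        push_cast
        have := Nat.cast_nonneg (α := ℝ) N
        apply div_nonneg hκ0.le
        linarith
      have := mul_nonneg (hD0 0) h0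
      push_cast at this ⊢
      linarith
    | succ j ih =>
      intro hj
      have hjN : (j : ℝ) + 1 ≤ N := by exact_mod_cast hj
      have h1 := ih (by omega)
      obtain ⟨-, h2⟩ := step j (by omega)
      set y : ℝ := R + (N - j) with hy
      have hyκ : 64 * κ ≤ y := by rw [hy]; linarith
      have hy2 : 2 ≤ y := by rw [hy]; linarith
      have e7 : R + ((N : ℝ) - ((j + 1 : ℕ) : ℝ)) = y - 1 := by rw [hy]; push_cast; ring
      rw [e7]
      have hy0 : 0 < y := by linarith
      have hy1 : 0 < y - 1 := by linarith
      have h3 : (1 + κ / (4 * y ^ 2)) * (1 + κ / y) ≤ 1 + κ / (y - 1) := by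
        have h4 : κ / y ≤ 1 := by rw [div_le_one hy0]; linarith
        have h5 : κ / (4 * y ^ 2) * (κ / y) ≤ κ / (4 * y ^ 2) * 1 := by gcongr
        have h6 : κ / (y - 1) - κ / y = κ / (y * (y - 1)) := by field_simp; ring
        have h7 : κ / (4 * y ^ 2) + κ / (4 * y ^ 2) ≤ κ / (y * (y - 1)) := by
          have : κ / (4 * y ^ 2) + κ / (4 * y ^ 2) = κ / (2 * y ^ 2) := by field_simp; norm_num
          rw [this]
          exact div_le_div_of_nonneg_left hκ0.le (by positivity) (by nlinarith)
        linarith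
      have hE : 0 ≤ D 0 + 4 * j * ε := by have := hD0 0; positivity
      have h8 : (1 + κ / (4 * y ^ 2)) * D j ≤ (D 0 + 4 * j * ε) * (1 + κ / (y - 1)) := by
        calc (1 + κ / (4 * y ^ 2)) * D j ≤
              (1 + κ / (4 * y ^ 2)) * ((D 0 + 4 * j * ε) * (1 + κ / y)) := by gcongr
          _ = (D 0 + 4 * j * ε) * ((1 + κ / (4 * y ^ 2)) * (1 + κ / y)) := by ring
          _ ≤ _ := by gcongr
      have h9 : 0 ≤ ε * (κ / (y - 1)) := by positivity
      push_cast
      linarith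
  have hD2 : ∀ j ≤ N, D j ≤ 2 * B := by
    intro j hj
    have hjN : (j : ℝ) ≤ N := by exact_mod_cast hj
    have h1 : κ / (R + (N - j)) ≤ 1 := by
      rw [div_le_one (by linarith)]; linarith
    have h2 : D 0 + 4 * j * ε ≤ B := by
      refine le_trans ?_ hB
      gcongr
    have hE : 0 ≤ D 0 + 4 * j * ε := by have := hD0 0; positivity
    have h3 := main j hj
    calc D j ≤ (D 0 + 4 * j * ε) * (1 + κ / (R + (N - j))) := h3
      _ ≤ (D 0 + 4 * j * ε) * 2 := by gcongr; linarith
      _ ≤ 2 * B := by linarith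
  -- With D bounded, the change of the separation itself is summed. The result is a small fraction
  -- of `B`, which is what makes -1/Ψ₁ close to a translation.
  have main2 : ∀ j ≤ N, ‖(-1 / (p j).1 - -1 / (q j).1) - (-1 / (p 0).1 - -1 / (q 0).1)‖ ≤
      κ * B / (4 * (R + (N - j))) + 4 * j * ε := by
    intro j
    induction j with
    | zero =>
      intro _
      have hN := Nat.cast_nonneg (α := ℝ) N
      have h0 : 0 ≤ κ * B / (4 * (R + (N - (0 : ℕ)))) := by
        push_cast
        apply div_nonneg (by positivity)
        linarith
      rw [sub_self, norm_zero]
      push_cast at h0 ⊢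
      linarith
    | succ j ih =>
      intro hj
      have hjN : (j : ℝ) + 1 ≤ N := by exact_mod_cast hj
      have h1 := ih (by omega)
      obtain ⟨h2, -⟩ := step j (by omega)
      have hDj := hD2 j (by omega)
      set y : ℝ := R + (N - j) with hy
      have hy2 : 2 ≤ y := by rw [hy]; linarith
      have e7 : R + ((N : ℝ) - ((j + 1 : ℕ) : ℝ)) = y - 1 := by rw [hy]; push_cast; ring
      rw [e7]
      have hy0 : 0 < y := by linarith
      have hy1 : 0 < y - 1 := by linarith
      have h3 : κ / (8 * y ^ 2) * D j ≤ κ * B / (4 * y ^ 2) := by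
        calc κ / (8 * y ^ 2) * D j ≤ κ / (8 * y ^ 2) * (2 * B) := by gcongr
          _ = κ * B / (4 * y ^ 2) := by field_simp; ring
      have h4 : κ * B / (4 * y ^ 2) + κ * B / (4 * y) ≤ κ * B / (4 * (y - 1)) := by
        have h6 : κ * B / (4 * (y - 1)) - κ * B / (4 * y) = κ * B / (4 * (y * (y - 1))) := by
          field_simp; ring
        have h7 : κ * B / (4 * y ^ 2) ≤ κ * B / (4 * (y * (y - 1))) := by
          gcongr
          nlinarith
        linarith
      have h5 := norm_add_le ((-1 / (p (j + 1)).1 - -1 / (q (j + 1)).1) -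
        (-1 / (p j).1 - -1 / (q j).1)) ((-1 / (p j).1 - -1 / (q j).1) - (-1 / (p 0).1 - -1 / (q 0).1))
      rw [sub_add_sub_cancel] at h5
      push_cast
      linarith
  intro j hj
  refine ⟨hD2 j hj, (main2 j hj).trans ?_⟩
  have hjN : (j : ℝ) ≤ N := by exact_mod_cast hj
  gcongr ?_ + ?_
  · rw [div_le_div_iff₀ (by linarith) (by norm_num)]
    have h1 : κ * 64 ≤ 4 * (R + (N - j)) := by linarith
    calc κ * B * 64 = B * (κ * 64) := by ring
      _ ≤ B * (4 * (R + (N - j))) := by gcongr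
  · gcongr

end

/-! ### The repelling Fatou coordinate -/

/-- The quantitative inverse function theorem for a map that differs from the identity by a
1/2-Lipschitz map: the image covers a ball of half the radius. -/
theorem exists_eq_of_norm_sub_sub_le {f : ℂ → ℂ} {c w : ℂ} {r : ℝ} (hr : 0 ≤ r)
    (hf : ∀ x ∈ Metric.closedBall c r, ∀ y ∈ Metric.closedBall c r,
      ‖(f x - f y) - (x - y)‖ ≤ 1 / 2 * ‖x - y‖)
    (hw : ‖w - f c‖ ≤ r / 2) : ∃ x ∈ Metric.closedBall c r, f x = w := by
  have h1 : ApproximatesLinearOn f (ContinuousLinearEquiv.refl ℂ ℂ : ℂ →L[ℂ] ℂ)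
      (Metric.closedBall c r) (1 / 2 : NNReal) := by
    intro x hx y hy
    simpa using hf x hx y hy
  have h2 := h1.surjOn_closedBall_of_nonlinearRightInverse
    (ContinuousLinearEquiv.refl ℂ ℂ).toNonlinearRightInverse hr subset_rfl
  have h3 : w ∈ Metric.closedBall (f c)
      ((((ContinuousLinearEquiv.refl ℂ ℂ).toNonlinearRightInverse.nnnorm : ℝ)⁻¹ -
        ((1 / 2 : NNReal) : ℝ)) * r) := by
    have h4 : ((ContinuousLinearEquiv.refl ℂ ℂ).toNonlinearRightInverse.nnnorm : ℝ) = 1 := by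
      simp [ContinuousLinearEquiv.toNonlinearRightInverse]
    rw [h4, mem_closedBall_iff_norm]
    refine hw.trans (le_of_eq ?_)
    push_cast
    ring
  exact h2 h3

/-- In t = 1/z the equation reads t + b log t = -W. It is solved near t = -W, where the logarithm
has small derivative and the correction b log t is small against |W|. -/
theorem exists_omegaOut_eq (b : ℂ) : ∃ L : ℝ, ∀ W : ℂ, L ≤ ‖W‖ → W.re ≤ -(‖W‖ / 2) →
    ∃ z : ℂ, ‖b‖ + 1 < (1 / z).re ∧ omegaOut b z = W := by
  obtain ⟨R, hR1, hR⟩ := exists_norm_mul_log_le b (η := 1 / 8) (by norm_num)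
  refine ⟨max R (8 * (‖b‖ + 1)), fun W hW hre => ?_⟩
  have hWR := (le_max_left _ _).trans hW
  have hWb := (le_max_right _ _).trans hW
  have hb := norm_nonneg b
  have hball : ∀ t ∈ Metric.closedBall (-W) (‖W‖ / 4), ‖W‖ / 4 ≤ t.re := by
    intro t ht
    rw [mem_closedBall_iff_norm] at ht
    have := (abs_le.1 ((Complex.abs_re_le_norm _).trans ht)).1
    rw [Complex.sub_re, Complex.neg_re] at this
    linarith
  have hf : ∀ x ∈ Metric.closedBall (-W) (‖W‖ / 4), ∀ y ∈ Metric.closedBall (-W) (‖W‖ / 4),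
      ‖((x + b * Complex.log x) - (y + b * Complex.log y)) - (x - y)‖ ≤ 1 / 2 * ‖x - y‖ := by
    intro x hx y hy
    have e : (x + b * Complex.log x) - (y + b * Complex.log y) - (x - y) =
        b * (Complex.log x - Complex.log y) := by ring
    have hW0 : 0 < ‖W‖ / 4 := by linarith
    have h1 := norm_log_sub_log_le hW0 (hball x hx) (hball y hy)
    rw [e, norm_mul]
    calc ‖b‖ * ‖Complex.log x - Complex.log y‖ ≤ ‖b‖ * ((‖W‖ / 4)⁻¹ * ‖x - y‖) := by gcongr
      _ = (‖b‖ * (‖W‖ / 4)⁻¹) * ‖x - y‖ := by ring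
      _ ≤ 1 / 2 * ‖x - y‖ := by
        gcongr
        rw [← div_eq_mul_inv, div_le_iff₀ hW0]
        linarith
  have hw : ‖-W - (-W + b * Complex.log (-W))‖ ≤ ‖W‖ / 4 / 2 := by
    have h1 := hR (-W) (by rwa [norm_neg])
    rw [norm_neg] at h1
    have e : -W - (-W + b * Complex.log (-W)) = -(b * Complex.log (-W)) := by ring
    rw [e, norm_neg]
    linarith
  obtain ⟨t, ht, he⟩ := exists_eq_of_norm_sub_sub_le (f := fun t => t + b * Complex.log t)
    (by positivity) hf hw
  have htre := hball t ht
  refine ⟨1 / t, by rw [one_div_one_div]; linarith, ?_⟩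
  have e : -1 / (1 / t) = -t := by rw [neg_div, one_div_one_div]
  rw [omegaOut, one_div_one_div, e]
  linear_combination -he

/-- The logarithm is 1/r-Lipschitz on the half plane Re ≥ r, so ω^o differs little from -1/z there.
-/
theorem omegaOut_lipschitz {b z z' : ℂ} {r : ℝ} (hr : 0 < r) (hb : 16 * ‖b‖ ≤ r)
    (hz : r ≤ (1 / z).re) (hz' : r ≤ (1 / z').re) :
    ‖(-1 / z - -1 / z') - (omegaOut b z - omegaOut b z')‖ ≤ 1 / 16 * ‖-1 / z - -1 / z'‖ := by
  have e : (-1 / z - -1 / z') - (omegaOut b z - omegaOut b z') =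
      b * (Complex.log (1 / z) - Complex.log (1 / z')) := by
    rw [omegaOut, omegaOut]; ring
  have e2 : ‖-1 / z - -1 / z'‖ = ‖1 / z - 1 / z'‖ := by
    rw [← norm_neg]
    congr 1
    ring
  have h1 := norm_log_sub_log_le hr hz hz'
  rw [e, norm_mul, e2]
  calc ‖b‖ * ‖Complex.log (1 / z) - Complex.log (1 / z')‖ ≤ ‖b‖ * (r⁻¹ * ‖1 / z - 1 / z'‖) := by
        gcongr
    _ = (‖b‖ * r⁻¹) * ‖1 / z - 1 / z'‖ := by ring
    _ ≤ 1 / 16 * ‖1 / z - 1 / z'‖ := by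
      gcongr
      rw [← div_eq_mul_inv, div_le_iff₀ hr]
      linarith

section
variable {T : ℂ × ℂ → ℂ × ℂ} {a₃ : ℂ} {ρ K Ra R κ : ℝ} (hT : LocalForm T a₃ ρ K)
  (hR : RepellingScale a₃ ρ K Ra R κ)

include hR in
theorem RepellingScale.re_ge {z W : ℂ} (hz : Ra ≤ ‖1 / z‖) (hW : 8 ≤ ‖W‖)
    (h : ‖omegaOut (1 - a₃) z - W‖ ≤ 1) (hre : W.re ≤ -(‖W‖ / 2)) : ‖W‖ / 8 ≤ (1 / z).re := by
  obtain ⟨-, h2, h3⟩ := hR.location hz hW h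
  have h4 := (Complex.re_le_norm _).trans h3
  have h5 : (-1 / z).re = -(1 / z).re := by rw [neg_div, Complex.neg_re]
  rw [Complex.sub_re, h5] at h4
  linarith

/-- `Function.invFunOn` only promises some preimage with Re(1/z) > ‖1 - a₃‖ + 1. Its 1/z must be
large, because bounded values of 1/z in that region have bounded image under ω^o. -/
theorem exists_omegaOutInv (a₃ : ℂ) (Ra : ℝ) : ∃ L : ℝ, ∀ W : ℂ, L ≤ ‖W‖ → W.re ≤ -(‖W‖ / 2) →
    omegaOutInv (1 - a₃) W ≠ 0 ∧ Ra ≤ ‖1 / omegaOutInv (1 - a₃) W‖ ∧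
      omegaOut (1 - a₃) (omegaOutInv (1 - a₃) W) = W := by
  obtain ⟨L, hL⟩ := exists_omegaOut_eq (1 - a₃)
  refine ⟨max L (Ra + ‖1 - a₃‖ * (Real.log Ra + Real.pi) + 1), fun W hW hre => ?_⟩
  have hWL := (le_max_left _ _).trans hW
  have hWR := (le_max_right _ _).trans hW
  obtain ⟨z, hz, hzW⟩ := hL W hWL hre
  have hex : ∃ z ∈ {z : ℂ | ‖1 - a₃‖ + 1 < (1 / z).re}, omegaOut (1 - a₃) z = W := ⟨z, hz, hzW⟩
  have h1 : ‖1 - a₃‖ + 1 < (1 / omegaOutInv (1 - a₃) W).re := Function.invFunOn_mem hex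
  have h2 : omegaOut (1 - a₃) (omegaOutInv (1 - a₃) W) = W := Function.invFunOn_eq hex
  set y := omegaOutInv (1 - a₃) W
  have hb := norm_nonneg (1 - a₃)
  refine ⟨?_, ?_, h2⟩
  · intro h0
    rw [h0] at h1
    simp at h1
    linarith
  · by_contra! hlt
    have h3 : 1 ≤ ‖1 / y‖ := by linarith [Complex.re_le_norm (1 / y)]
    have h4 : ‖W‖ ≤ Ra + ‖1 - a₃‖ * (Real.log Ra + Real.pi) := by
      rw [← h2, omegaOut]
      refine (norm_sub_le _ _).trans ?_
      rw [norm_mul]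
      have e : ‖-1 / y‖ = ‖1 / y‖ := by simp
      rw [e]
      gcongr
      refine (norm_log_le _).trans ?_
      rw [abs_of_nonneg (Real.log_nonneg h3)]
      gcongr
    linarith

include hT hR in
theorem RepellingScale.control_iterate {N : ℕ} {W : ℂ} {p : ℂ × ℂ}
    (hW : W.re ≤ -(R + N)) (hz0 : p.1 ≠ 0) (hz : Ra ≤ ‖1 / p.1‖) (hx : ‖p.2‖ ≤ ρ)
    (hω : ‖omegaOut (1 - a₃) p.1 - W‖ ≤ 1 / 2) :
    ∀ j ≤ N, (T^[j] p).1 ≠ 0 ∧ Ra ≤ ‖1 / (T^[j] p).1‖ ∧ ‖(T^[j] p).2‖ ≤ ρ ∧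
      ‖omegaOut (1 - a₃) (T^[j] p).1 - (W + j)‖ ≤ 1 ∧ R + (N - j) ≤ ‖W + j‖ ∧
      ‖W + j‖ / 2 ≤ ‖1 / (T^[j] p).1‖ ∧ ‖1 / (T^[j] p).1‖ ≤ 2 * ‖W + j‖ := by
  refine hR.control hT (σ := 0) le_rfl (by norm_num) (by norm_num) hW hz0 hz hx hω ?_
  intro j _ h1 h2 h3 _ _
  obtain ⟨s, hs, hsn⟩ := hT.exists_step h1 h2 h3
  refine ⟨s, ?_, by linarith, ?_⟩
  · rw [Function.iterate_succ_apply']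
    exact hs
  · rw [Function.iterate_succ_apply']
    exact hT.snd _ _ h2 h3

include hT hR in
-- Invariance of the region |x| ≤ 4K|z|²: contraction leaves at most 3K|z|², while |z| shrinks by no
-- more than the factor 31/32, and 3 ≤ 4 (31/32)².
theorem RepellingScale.snd_le_step {z x : ℂ} (hz0 : z ≠ 0) (hz : Ra ≤ ‖1 / z‖) (hx : ‖x‖ ≤ ρ)
    (h : ‖x‖ ≤ 4 * K * ‖z‖ ^ 2) : ‖(T (z, x)).2‖ ≤ 4 * K * ‖(T (z, x)).1‖ ^ 2 := by
  obtain ⟨m1, m2, m3, m4⟩ := hR.small' hT hz0 hz (σ := 0) (by norm_num)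
  have hρ := hT.le_one
  have hρ0 := hT.pos
  have hK := hT.one_le
  obtain ⟨s, hs, hsn⟩ := hT.exists_step hz0 (by linarith : ‖z‖ ≤ ρ) hx
  have hs' : 64 * (1 + ‖a₃‖) * ‖s‖ ≤ 1 := le_trans (by gcongr; linarith) m4
  obtain ⟨d1, -, d2⟩ := step_bounds m2 hs'
  have h1 := hT.snd z x (by linarith) hx
  have h2 : 31 / 32 * ‖z‖ ≤ ‖(T (z, x)).1‖ := by
    have e : z + z ^ 2 * (1 + a₃ * z + s) = z * (1 + z * (1 + a₃ * z + s)) := by ring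
    rw [hs, e, norm_mul, mul_comm]
    gcongr
    have h3 := norm_sub_norm_le (1 : ℂ) (-(z * (1 + a₃ * z + s)))
    rw [sub_neg_eq_add, norm_neg, norm_mul, norm_one] at h3
    nlinarith [norm_nonneg z, norm_nonneg (1 + a₃ * z + s)]
  have h3 : (31 / 32 * ‖z‖) ^ 2 ≤ ‖(T (z, x)).1‖ ^ 2 := by gcongr
  have h4 : K * (31 / 32 * ‖z‖) ^ 2 ≤ K * ‖(T (z, x)).1‖ ^ 2 := by gcongr
  have h5 : 0 ≤ K * ‖z‖ ^ 2 := by positivity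
  nlinarith

end

theorem shift_good {Z : ℂ} {n : ℕ} {L : ℝ} (hL : 0 ≤ L) (h : 3 * ‖Z‖ + L ≤ n) :
    L ≤ ‖Z - n‖ ∧ (Z - n).re ≤ -(‖Z - n‖ / 2) ∧ (n : ℝ) / 2 ≤ ‖Z - n‖ := by
  have h1 : ‖Z - n‖ ≤ ‖Z‖ + n := by simpa using norm_sub_le Z (n : ℂ)
  have h2 : (n : ℝ) - ‖Z‖ ≤ ‖Z - n‖ := by
    have := norm_sub_norm_le (n : ℂ) Z
    rw [norm_sub_rev] at this
    simpa using this
  have h3 := Complex.re_le_norm Z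
  have h4 := norm_nonneg Z
  refine ⟨by linarith, ?_, by linarith⟩
  rw [Complex.sub_re, Complex.natCast_re]
  linarith

/-- For `n` beyond `3 ‖Z‖ + L` the starting points `(ω°)⁻¹ (Z - n)` lie on the repelling side. -/
def IsStartScale (a₃ : ℂ) (Ra L : ℝ) : Prop :=
  8 ≤ L ∧ ∀ (Z : ℂ) (n : ℕ), 3 * ‖Z‖ + L ≤ n →
    omegaOutInv (1 - a₃) (Z - n) ≠ 0 ∧ Ra ≤ ‖1 / omegaOutInv (1 - a₃) (Z - n)‖ ∧
      omegaOut (1 - a₃) (omegaOutInv (1 - a₃) (Z - n)) = Z - n ∧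
      ‖Z - n‖ / 2 ≤ ‖1 / omegaOutInv (1 - a₃) (Z - n)‖ ∧
      16 * ‖1 - a₃‖ + 3 ≤ (1 / omegaOutInv (1 - a₃) (Z - n)).re

section
variable {T : ℂ × ℂ → ℂ × ℂ} {a₃ : ℂ} {ρ K Ra R κ : ℝ} (hT : LocalForm T a₃ ρ K)
  (hR : RepellingScale a₃ ρ K Ra R κ)

include hR in
theorem RepellingScale.exists_start : ∃ L : ℝ, IsStartScale a₃ Ra L := by
  obtain ⟨L, hL⟩ := exists_omegaOutInv a₃ Ra
  have hb := norm_nonneg (1 - a₃)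
  refine ⟨|L| + 8 + 8 * (16 * ‖1 - a₃‖ + 3), by linarith [abs_nonneg L], fun Z n hn => ?_⟩
  obtain ⟨h1, h2, h3⟩ := shift_good (by positivity) hn
  obtain ⟨h4, h5, h6⟩ := hL (Z - n) (by linarith [le_abs_self L]) h2
  have h7 : ‖omegaOut (1 - a₃) (omegaOutInv (1 - a₃) (Z - n)) - (Z - n)‖ ≤ 1 := by
    rw [h6, sub_self, norm_zero]; norm_num
  have h8 : 8 ≤ ‖Z - n‖ := by linarith [abs_nonneg L]
  refine ⟨h4, h5, h6, (hR.location h5 h8 h7).1, ?_⟩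
  have := hR.re_ge h5 h8 h7 h2
  linarith [abs_nonneg L]

include hT hR in
/-- The approximations of the repelling Fatou coordinate: bounds on the partial orbits. -/
theorem RepellingScale.approx_bounds {L : ℝ} (hL : IsStartScale a₃ Ra L)
    {Z : ℂ} {n : ℕ} (hn : 3 * ‖Z‖ + L ≤ n) (hZ : Z.re ≤ -R) {p : ℂ × ℂ}
    (hp : p = (omegaOutInv (1 - a₃) (Z - n), 0)) :
    ∀ j ≤ n, (T^[j] p).1 ≠ 0 ∧ Ra ≤ ‖1 / (T^[j] p).1‖ ∧ ‖(T^[j] p).2‖ ≤ ρ ∧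
      ‖omegaOut (1 - a₃) (T^[j] p).1 - (Z - n + j)‖ ≤ 1 ∧ R + (n - j) ≤ ‖Z - n + j‖ ∧
      ‖Z - n + j‖ / 2 ≤ ‖1 / (T^[j] p).1‖ ∧ ‖1 / (T^[j] p).1‖ ≤ 2 * ‖Z - n + j‖ ∧
      ‖(T^[j] p).2‖ ≤ 4 * K * ‖(T^[j] p).1‖ ^ 2 := by
  obtain ⟨h1, h2, h3, h4, h5⟩ := hL.2 Z n hn
  have hρ := hT.pos
  have hK := hT.one_le
  have hc : ∀ j ≤ n, _ := hR.control_iterate hT (N := n) (W := Z - n) (p := p)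
    (by rw [Complex.sub_re, Complex.natCast_re]; linarith) (by rw [hp]; exact h1)
    (by rw [hp]; exact h2) (by rw [hp, norm_zero]; exact hρ.le)
    (by rw [hp, h3, sub_self, norm_zero]; norm_num)
  have hx : ∀ j ≤ n, ‖(T^[j] p).2‖ ≤ 4 * K * ‖(T^[j] p).1‖ ^ 2 := by
    intro j
    induction j with
    | zero =>
      intro _
      rw [Function.iterate_zero_apply, hp, norm_zero]
      positivity
    | succ j ih =>
      intro hj
      obtain ⟨c1, c2, c3, -⟩ := hc j (by omega)
      have := hR.snd_le_step hT c1 c2 c3 (ih (by omega))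
      rw [Function.iterate_succ_apply']
      exact this
  intro j hj
  obtain ⟨c1, c2, c3, c4, c5, c6, c7⟩ := hc j hj
  exact ⟨c1, c2, c3, c4, c5, c6, c7, hx j hj⟩

include hT hR in
set_option maxHeartbeats 800000 in
-- Both approximants are time-n images, of q and of T q', and these two starting points have almost
-- the same outgoing coordinate Z - n: they differ by O(|y|²) = O(1/n²). `RepellingScale.compare`
-- carries the difference to time n with bounded loss, so the distances are summable.
theorem RepellingScale.approx_dist_le {L : ℝ} (hL : IsStartScale a₃ Ra L)
    {Z : ℂ} {n : ℕ} (hn : 3 * ‖Z‖ + L ≤ n) (hZ : Z.re ≤ -R) :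
    dist (T^[n] (omegaOutInv (1 - a₃) (Z - n), 0))
      (T^[n + 1] (omegaOutInv (1 - a₃) (Z - (n + 1 : ℕ)), 0)) ≤
        2 * (60 * (1 + ‖a₃‖) ^ 2 * (1 + K) + K) * (16 * (1 / (n : ℝ) ^ 2)) := by
  have hn' : 3 * ‖Z‖ + L ≤ (n + 1 : ℕ) := by push_cast; linarith
  have hK := hT.one_le
  have hL0 := hL.1
  set q : ℂ × ℂ := (omegaOutInv (1 - a₃) (Z - n), 0) with hq
  set q' : ℂ × ℂ := (omegaOutInv (1 - a₃) (Z - (n + 1 : ℕ)), 0) with hq'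
  have cq := hR.approx_bounds hT hL hn hZ hq
  have cp := hR.approx_bounds hT hL hn' hZ hq'
  obtain ⟨g1, g2, g3, g4, g5⟩ := hL.2 Z n hn
  obtain ⟨k1, k2, k3, k4, k5⟩ := hL.2 Z (n + 1) hn'
  have hW : ∀ j : ℕ, Z - ((n + 1 : ℕ) : ℂ) + ((j + 1 : ℕ) : ℂ) = Z - n + j := by
    intro j; push_cast; ring
  -- the first point of the longer orbit
  set y := omegaOutInv (1 - a₃) (Z - (n + 1 : ℕ)) with hy
  obtain ⟨m1, m2, m3, m4⟩ := hR.small' hT k1 k2 (σ := 0) (by norm_num)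
  have hρ0 := hT.pos
  obtain ⟨s, hs, hsn⟩ := hT.exists_step (x := 0) k1 (by linarith : ‖y‖ ≤ ρ) (by simpa using hρ0.le)
  have hs' : 64 * (1 + ‖a₃‖) * ‖s‖ ≤ 1 := le_trans (by gcongr; linarith) m4
  have hr0 : 0 < 16 * ‖1 - a₃‖ + 1 := by positivity
  have st := omegaOut_step m2 hs' k1 (by linarith [norm_nonneg (1 / y)])
  obtain ⟨o1, o2⟩ := neg_one_div_next m2 hs' k1 rfl
  have o3 := increment_sub_one_le_quarter m2 hs'
  rw [← hs] at st o1 o2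
  set A := (1 + a₃ * y + s) / (1 + y * (1 + a₃ * y + s))
  have hn1 : (1 : ℝ) ≤ n := by linarith [norm_nonneg Z]
  have hy2 : ‖y‖ ^ 2 ≤ 16 * (1 / (n : ℝ) ^ 2) := by
    have h1 := (shift_good (by linarith) hn').2.2
    push_cast at h1 k4
    have h2 : (n : ℝ) / 4 ≤ ‖1 / y‖ := by linarith
    rw [norm_div, norm_one, le_div_iff₀ (norm_pos_iff.2 k1)] at h2
    have h3 : ‖y‖ * n ≤ 4 := by linarith
    rw [mul_one_div, le_div_iff₀ (by positivity), ← mul_pow]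
    calc (‖y‖ * n) ^ 2 ≤ 4 ^ 2 := by gcongr
      _ = 16 := by norm_num
  have hωd : ‖omegaOut (1 - a₃) (T q').1 - omegaOut (1 - a₃) q.1‖ ≤
      30 * (1 + ‖a₃‖) ^ 2 * (1 + K) * ‖y‖ ^ 2 := by
    have e : omegaOut (1 - a₃) (T q').1 - omegaOut (1 - a₃) q.1 =
        omegaOut (1 - a₃) (T (y, 0)).1 - omegaOut (1 - a₃) y - 1 := by
      rw [k3, hq, g3, hq']
      push_cast
      ring
    rw [e]
    refine st.trans ?_
    calc 30 * (1 + ‖a₃‖) ^ 2 * (‖y‖ ^ 2 + ‖s‖) ≤ 30 * (1 + ‖a₃‖) ^ 2 * (‖y‖ ^ 2 + K * ‖y‖ ^ 2) := by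
          gcongr
      _ = _ := by ring
  have hre' : 16 * ‖1 - a₃‖ + 1 ≤ (1 / (T q').1).re := by
    have e : (1 / (T q').1) = -(-1 / (T (y, 0)).1) := by rw [hq']; ring
    have h1 := (abs_le.1 ((Complex.abs_re_le_norm _).trans o3)).2
    rw [e, o2, neg_add, neg_div, neg_neg, Complex.add_re, Complex.neg_re]
    rw [Complex.sub_re, Complex.one_re] at h1
    linarith
  have hζ : ‖-1 / (T q').1 - -1 / q.1‖ ≤ 60 * (1 + ‖a₃‖) ^ 2 * (1 + K) * ‖y‖ ^ 2 := by
    have h1 := omegaOut_lipschitz (b := 1 - a₃) hr0 (by linarith) hre' (by linarith : _ ≤ (1 / q.1).re)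
    have h2 := norm_add_le ((-1 / (T q').1 - -1 / q.1) -
      (omegaOut (1 - a₃) (T q').1 - omegaOut (1 - a₃) q.1))
      (omegaOut (1 - a₃) (T q').1 - omegaOut (1 - a₃) q.1)
    rw [sub_add_cancel] at h2
    have h3 : 0 ≤ (1 + ‖a₃‖) ^ 2 * (1 + K) * ‖y‖ ^ 2 := by positivity
    linarith
  have hx : ‖(T q').2 - q.2‖ ≤ K * ‖y‖ ^ 2 := by
    have h1 := hT.snd y 0 (by linarith) (by simpa using hρ0.le)
    rw [norm_zero, zero_div, zero_add] at h1
    simpa [hq] using h1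
  have key := hR.compare hT (N := n) (ε := 0) (p := fun j => T^[j + 1] q') (q := fun j => T^[j] q)
    (B := (60 * (1 + ‖a₃‖) ^ 2 * (1 + K) + K) * ‖y‖ ^ 2) le_rfl (by norm_num) ?_ ?_ ?_ ?_ ?_ ?_
    n le_rfl
  · have h1 := key.1
    have P := cp (n + 1) le_rfl
    have Q := cq n le_rfl
    have small : ∀ z : ℂ, z ≠ 0 → Ra ≤ ‖1 / z‖ → ‖z‖ ≤ 1 := by
      intro z hz hz'
      have := (hR.small' hT hz hz' (σ := 0) (by norm_num)).1
      linarith [hT.le_one]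
    rw [dist_comm, dist_eq_norm, Prod.norm_def]
    have h2 : ‖(T^[n + 1] q' - T^[n] q).1‖ ≤ ‖-1 / (T^[n + 1] q').1 - -1 / (T^[n] q).1‖ := by
      have P1 := P.1
      have Q1 := Q.1
      have e : (T^[n + 1] q' - T^[n] q).1 = (T^[n + 1] q').1 * (T^[n] q).1 *
          (-1 / (T^[n + 1] q').1 - -1 / (T^[n] q).1) := by
        rw [Prod.fst_sub]
        field_simp
        ring
      rw [e, norm_mul, norm_mul]
      have h3 := mul_le_one₀ (small _ P.1 P.2.1) (norm_nonneg _) (small _ Q.1 Q.2.1)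
      have h4 := mul_le_of_le_one_left
        (norm_nonneg (-1 / (T^[n + 1] q').1 - -1 / (T^[n] q).1)) h3
      linarith
    have h4 : ‖(T^[n + 1] q' - T^[n] q).2‖ = ‖(T^[n + 1] q').2 - (T^[n] q).2‖ := by
      rw [Prod.snd_sub]
    refine (max_le (h2.trans (le_add_of_nonneg_right (norm_nonneg _)))
      (h4.le.trans (le_add_of_nonneg_left (norm_nonneg _)))).trans (h1.trans ?_)
    rw [← mul_assoc]
    gcongr
  · intro j hj
    obtain ⟨c1, c2, c3, c4, c5, c6, c7, -⟩ := cp (j + 1) (by omega)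
    refine ⟨c1, c2, c3, ?_⟩
    push_cast at c5 c6
    have e : R + ((n : ℝ) + 1 - (j + 1)) = R + (n - j) := by ring
    rw [e] at c5
    linarith
  · intro j hj
    obtain ⟨c1, c2, c3, c4, c5, c6, c7, -⟩ := cq j hj
    exact ⟨c1, c2, c3, by linarith⟩
  · intro j hj
    obtain ⟨c1, -, -, -, -, -, c7, -⟩ := cp (j + 1) (by omega)
    obtain ⟨d1, -, -, -, d5, d6, -⟩ := cq j hj
    rw [hW] at c7
    have h1 : ‖1 / (T^[j + 1] q').1‖ ≤ 4 * ‖1 / (T^[j] q).1‖ := by linarith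
    rw [norm_div, norm_div, norm_one, ← mul_div_assoc, div_le_div_iff₀ (norm_pos_iff.2 c1)
      (norm_pos_iff.2 d1)] at h1
    linarith [norm_nonneg (T^[j + 1] q').1]
  · intro j hj
    simp [Function.iterate_succ_apply']
  · intro j hj
    simp [Function.iterate_succ_apply']
  · simp only [Function.iterate_succ_apply', Function.iterate_zero_apply]
    linarith

end

section
variable {T : ℂ × ℂ → ℂ × ℂ} {a₃ : ℂ} {ρ K Ra R κ : ℝ} (hT : LocalForm T a₃ ρ K)
  (hR : RepellingScale a₃ ρ K Ra R κ)

theorem eventually_start_le (Z : ℂ) (L : ℝ) : ∀ᶠ n : ℕ in atTop, 3 * ‖Z‖ + L ≤ n :=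
  tendsto_natCast_atTop_atTop.eventually_ge_atTop _

include hT hR

theorem RepellingScale.tendsto_repFatou {Z : ℂ} (hZ : Z.re ≤ -R) :
    Tendsto (fun n : ℕ => T^[n] (omegaOutInv (1 - a₃) (Z - (n : ℂ)), 0)) atTop
      (𝓝 (repFatou a₃ T Z)) := by
  obtain ⟨L, hL⟩ := hR.exists_start
  obtain ⟨m, hm⟩ := eventually_atTop.1 (eventually_start_le Z L)
  set u : ℕ → ℂ × ℂ := fun n => T^[n] (omegaOutInv (1 - a₃) (Z - (n : ℂ)), 0) with hu
  have hd : ∀ n, dist (u (n + m)) (u (n + 1 + m)) ≤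
      2 * (60 * (1 + ‖a₃‖) ^ 2 * (1 + K) + K) * (16 * (1 / ((n + m : ℕ) : ℝ) ^ 2)) := by
    intro n
    have := hR.approx_dist_le hT hL (hm (n + m) (by omega)) hZ
    rw [show n + 1 + m = n + m + 1 by ring]
    exact this
  have hs : Summable fun n : ℕ =>
      2 * (60 * (1 + ‖a₃‖) ^ 2 * (1 + K) + K) * (16 * (1 / ((n + m : ℕ) : ℝ) ^ 2)) :=
    (((summable_nat_add_iff m).2 (Real.summable_one_div_nat_pow.2 one_lt_two)).mul_left _).mul_left _
  obtain ⟨l, hl⟩ := cauchySeq_tendsto_of_complete (cauchySeq_of_dist_le_of_summable _ hd hs)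
  have hl' : Tendsto u atTop (𝓝 l) := (tendsto_add_atTop_iff_nat m).1 hl
  have : repFatou a₃ T Z = l := hl'.limUnder_eq
  rw [this]
  exact hl'

/-- The orbit bounds at time n pass to the limit. The last one controls every u with (z, u) in the
repelling petal. -/
theorem RepellingScale.repFatou_bounds {Z : ℂ} (hZ : Z.re ≤ -R) :
    1 ≤ 2 * ‖Z‖ * ‖(repFatou a₃ T Z).1‖ ∧ ‖Z‖ * ‖(repFatou a₃ T Z).1‖ ≤ 2 ∧
      ‖(repFatou a₃ T Z).2‖ ≤ 4 * K * ‖(repFatou a₃ T Z).1‖ ^ 2 := by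
  obtain ⟨L, hL⟩ := hR.exists_start
  have ht := hR.tendsto_repFatou hT hZ
  have h1 := ((continuous_fst.tendsto _).comp ht).norm
  have h2 := ((continuous_snd.tendsto _).comp ht).norm
  have hev : ∀ᶠ n : ℕ in atTop, _ := (eventually_start_le Z L).mono fun n hn =>
    hR.approx_bounds hT hL hn hZ rfl n le_rfl
  refine ⟨ge_of_tendsto (h1.const_mul _) ?_, le_of_tendsto (h1.const_mul _) ?_,
    le_of_tendsto_of_tendsto h2 ((h1.pow 2).const_mul _) ?_⟩
  · filter_upwards [hev] with n ⟨c1, c2, c3, c4, c5, c6, c7, c8⟩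
    rw [sub_add_cancel, norm_div, norm_one, div_le_iff₀ (norm_pos_iff.2 c1)] at c7
    exact c7
  · filter_upwards [hev] with n ⟨c1, c2, c3, c4, c5, c6, c7, c8⟩
    rw [sub_add_cancel, norm_div, norm_one, le_div_iff₀ (norm_pos_iff.2 c1)] at c6
    simp only [Function.comp_apply]
    linarith
  · filter_upwards [hev] with n ⟨c1, c2, c3, c4, c5, c6, c7, c8⟩
    exact c8

theorem RepellingScale.repFatou_fst_ne_zero {Z : ℂ} (hZ : Z.re ≤ -R) :
    (repFatou a₃ T Z).1 ≠ 0 := by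
  intro h
  have := (hR.repFatou_bounds hT hZ).1
  rw [h, norm_zero] at this
  norm_num at this

theorem RepellingScale.omegaOut_repFatou {Z : ℂ} (hZ : Z.re ≤ -R) (hZ' : Z.re ≤ -(‖Z‖ / 2)) :
    ‖Z‖ / 8 ≤ (1 / (repFatou a₃ T Z).1).re ∧ ‖omegaOut (1 - a₃) (repFatou a₃ T Z).1 - Z‖ ≤ 1 := by
  obtain ⟨L, hL⟩ := hR.exists_start
  have ht := hR.tendsto_repFatou hT hZ
  have h1 := (continuous_fst.tendsto _).comp ht
  have hne := hR.repFatou_fst_ne_zero hT hZ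
  have h2 := h1.inv₀ hne
  have hev : ∀ᶠ n : ℕ in atTop, _ := (eventually_start_le Z L).mono fun n hn =>
    hR.approx_bounds hT hL hn hZ rfl n le_rfl
  have hZn : R ≤ ‖Z‖ := by
    have := (abs_le.1 (Complex.abs_re_le_norm Z)).1
    linarith
  have hRa := hR.one_le
  have hRR := hR.le
  have hre : ‖Z‖ / 8 ≤ (1 / (repFatou a₃ T Z).1).re := by
    rw [one_div]
    refine ge_of_tendsto ((Complex.continuous_re.tendsto _).comp h2) ?_
    filter_upwards [hev] with n ⟨c1, c2, c3, c4, c5, c6, c7, c8⟩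
    rw [sub_add_cancel] at c4
    have := hR.re_ge c2 (by linarith) c4 hZ'
    rwa [one_div] at this
  refine ⟨hre, ?_⟩
  -- A positive real part keeps the limit off the cut, so ω^o is continuous there and its bound
  -- passes to the limit.
  have hsl : (repFatou a₃ T Z).1⁻¹ ∈ Complex.slitPlane := by
    left
    rw [← one_div]
    linarith
  have h3 : Tendsto (fun n : ℕ => omegaOut (1 - a₃)
      (T^[n] (omegaOutInv (1 - a₃) (Z - (n : ℂ)), 0)).1) atTop
      (𝓝 (omegaOut (1 - a₃) (repFatou a₃ T Z).1)) := by
    have h4 := (h2.const_mul (-1)).sub ((h2.clog hsl).const_mul (1 - a₃))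
    simpa only [omegaOut, one_div, div_eq_mul_inv (-1 : ℂ), Function.comp_apply] using h4
  refine le_of_tendsto (h3.sub_const Z).norm ?_
  filter_upwards [hev] with n ⟨c1, c2, c3, c4, c5, c6, c7, c8⟩
  rwa [sub_add_cancel] at c4

/-- The starting points have outgoing coordinates Z - n and Z' - n, so their separation in -1/z is Z
- Z' up to a relative error of order 1/16. Along the orbits it changes by at most a further 1/64 of
itself. The bound 16 on ‖Z - Z'‖ keeps the two orbits comparable in size. -/
theorem RepellingScale.repFatou_lipschitz {Z Z' : ℂ} (hZ : Z.re ≤ -R) (hZ' : Z'.re ≤ -R)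
    (hZZ : ‖Z - Z'‖ ≤ 16) :
    ‖(-1 / (repFatou a₃ T Z).1 - -1 / (repFatou a₃ T Z').1) - (Z - Z')‖ ≤ 1 / 2 * ‖Z - Z'‖ := by
  obtain ⟨L, hL⟩ := hR.exists_start
  have lim : ∀ Y : ℂ, Y.re ≤ -R → Tendsto (fun n : ℕ => -1 /
      (T^[n] (omegaOutInv (1 - a₃) (Y - (n : ℂ)), 0)).1) atTop
      (𝓝 (-1 / (repFatou a₃ T Y).1)) := fun Y hY =>
    tendsto_const_nhds.div ((continuous_fst.tendsto _).comp (hR.tendsto_repFatou hT hY))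
      (hR.repFatou_fst_ne_zero hT hY)
  refine le_of_tendsto (((lim Z hZ).sub (lim Z' hZ')).sub_const (Z - Z')).norm ?_
  filter_upwards [eventually_start_le Z L, eventually_start_le Z' L] with n hn hn'
  obtain ⟨g1, g2, g3, g4, g5⟩ := hL.2 Z n hn
  obtain ⟨k1, k2, k3, k4, k5⟩ := hL.2 Z' n hn'
  have hRa := hR.one_le
  have hRR := hR.le
  have cp := hR.approx_bounds hT hL hn hZ rfl
  have cq := hR.approx_bounds hT hL hn' hZ' rfl
  set p : ℂ × ℂ := (omegaOutInv (1 - a₃) (Z - n), 0) with hp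
  set q : ℂ × ℂ := (omegaOutInv (1 - a₃) (Z' - n), 0) with hq
  have h0 := omegaOut_lipschitz (b := 1 - a₃) (z := p.1) (z' := q.1)
    (r := 16 * ‖1 - a₃‖ + 3) (by positivity) (by linarith) g5 k5
  have e0 : omegaOut (1 - a₃) p.1 - omegaOut (1 - a₃) q.1 = Z - Z' := by
    rw [hp, hq, g3, k3]; ring
  rw [e0] at h0
  have key := hR.compare hT (N := n) (ε := 0) (p := fun j => T^[j] p) (q := fun j => T^[j] q)
    (B := ‖-1 / p.1 - -1 / q.1‖) le_rfl (by norm_num) ?_ ?_ ?_ ?_ ?_ ?_ n le_rfl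
  · have h1 := key.2
    simp only [Function.iterate_zero_apply, mul_zero, add_zero] at h1
    have h2 := norm_add_le ((-1 / p.1 - -1 / q.1) - (Z - Z')) (Z - Z')
    rw [sub_add_cancel] at h2
    have h3 := norm_add_le ((-1 / (T^[n] p).1 - -1 / (T^[n] q).1) - (-1 / p.1 - -1 / q.1))
      ((-1 / p.1 - -1 / q.1) - (Z - Z'))
    rw [sub_add_sub_cancel] at h3
    refine h3.trans ?_
    linarith [norm_nonneg (Z - Z')]
  · intro j hj
    obtain ⟨c1, c2, c3, c4, c5, c6, c7, -⟩ := cp j hj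
    exact ⟨c1, c2, c3, by linarith⟩
  · intro j hj
    obtain ⟨c1, c2, c3, c4, c5, c6, c7, -⟩ := cq j hj
    exact ⟨c1, c2, c3, by linarith⟩
  · intro j hj
    obtain ⟨c1, -, -, -, -, -, c7, -⟩ := cp j hj
    obtain ⟨d1, -, -, -, d5, d6, -⟩ := cq j hj
    have hjn : (j : ℝ) ≤ n := by exact_mod_cast hj
    have h2 : ‖Z - n + j‖ ≤ ‖Z' - n + j‖ + 16 := by
      have e : Z - n + j = (Z' - n + j) + (Z - Z') := by ring
      rw [e]
      exact (norm_add_le _ _).trans (by linarith)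
    have h1 : ‖1 / (T^[j] p).1‖ ≤ 16 * ‖1 / (T^[j] q).1‖ := by linarith
    rw [norm_div, norm_div, norm_one, ← mul_div_assoc, div_le_div_iff₀ (norm_pos_iff.2 c1)
      (norm_pos_iff.2 d1)] at h1
    linarith
  · intro j hj
    simp [Function.iterate_succ_apply']
  · intro j hj
    simp [Function.iterate_succ_apply']
  · simp [hp, hq]

/-- The first coordinate of the repelling parametrization covers the deep part of the repelling
side. -/
theorem RepellingScale.exists_repFatou_fst_eq {z W : ℂ} (hz0 : z ≠ 0) (hz : Ra ≤ ‖1 / z‖)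
    (hW : omegaOut (1 - a₃) z = W) (hre : W.re ≤ -(R + 8)) (hre' : W.re ≤ -(‖W‖ / 2)) :
    ∃ Z : ℂ, ‖Z - W‖ ≤ 8 ∧ (repFatou a₃ T Z).1 = z := by
  have hball : ∀ Z ∈ Metric.closedBall W 8, Z.re ≤ -R := by
    intro Z hZ
    rw [mem_closedBall_iff_norm] at hZ
    have := (abs_le.1 ((Complex.abs_re_le_norm _).trans hZ)).2
    rw [Complex.sub_re] at this
    linarith
  have hWR : R + 8 ≤ ‖W‖ := by
    have := (abs_le.1 (Complex.abs_re_le_norm W)).1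
    linarith
  have hRa := hR.one_le
  have hRR := hR.le
  have h1 := hR.omegaOut_repFatou hT (Z := W) (by linarith) hre'
  have h2 := hR.re_ge hz (by linarith) (by rw [hW, sub_self, norm_zero]; norm_num) hre'
  have hκ := hR.kappa_le
  have hbW : 16 * ‖1 - a₃‖ ≤ ‖W‖ / 8 := by
    have h3 : ‖1 - a₃‖ ≤ 1 + ‖a₃‖ := by simpa using norm_sub_le (1 : ℂ) a₃
    have h4 := hR.kappa
    have hK := hT.one_le
    have h5 : (1 + ‖a₃‖) * 1 * 1 ≤ (1 + ‖a₃‖) ^ 2 * (1 + K) := by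
      rw [sq]
      gcongr
      · linarith [norm_nonneg a₃]
      · linarith
    nlinarith [norm_nonneg a₃]
  have h3 := omegaOut_lipschitz (b := 1 - a₃) (by linarith : 0 < ‖W‖ / 8) hbW h2 h1.1
  have h4 : ‖-1 / z - -1 / (repFatou a₃ T W).1‖ ≤ 8 / 2 := by
    have h5 := norm_add_le ((-1 / z - -1 / (repFatou a₃ T W).1) -
      (omegaOut (1 - a₃) z - omegaOut (1 - a₃) (repFatou a₃ T W).1))
      (omegaOut (1 - a₃) z - omegaOut (1 - a₃) (repFatou a₃ T W).1)
    rw [sub_add_cancel] at h5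
    have h6 := h1.2
    rw [norm_sub_rev, ← hW] at h6
    rw [hW] at h6 h5 h3
    linarith
  -- At the centre `W` the value differs from -1/z by at most 4, since both points have outgoing
  -- coordinate within 1 of `W`. The radius 8 covers exactly that distance, and its diameter is the
  -- 16 allowed in the Lipschitz bound.
  obtain ⟨Z, hZ, he⟩ := exists_eq_of_norm_sub_sub_le (f := fun Z => -1 / (repFatou a₃ T Z).1)
    (c := W) (by norm_num) (fun x hx y hy => hR.repFatou_lipschitz hT (hball x hx) (hball y hy) (by
      rw [← dist_eq_norm]
      rw [Metric.mem_closedBall] at hx hy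
      have := dist_triangle_right x y W
      linarith)) h4
  refine ⟨Z, by rwa [mem_closedBall_iff_norm] at hZ, ?_⟩
  have hne := hR.repFatou_fst_ne_zero hT (hball Z hZ)
  field_simp at he
  linear_combination he

end

/-! ### The orbits of `G` in the parabolic basin -/

section
variable {q₂ : Polynomial ℂ} {δ : ℂ}

theorem exists_eval_expansion (hq0 : q₂.coeff 0 = 0) (hq1 : q₂.coeff 1 = 0)
    (hq2 : q₂.coeff 2 = -1) : ∃ K : ℝ, 1 ≤ K ∧ ∀ t : ℂ, ‖t‖ ≤ 1 →
      (∃ r : ℂ, q₂.eval t = -t ^ 2 + t ^ 3 * r ∧ ‖r‖ ≤ K) ∧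
        ‖q₂.derivative.eval t‖ ≤ K * ‖t‖ := by
  have hd : (Polynomial.X : Polynomial ℂ) ^ 3 ∣ q₂ + Polynomial.X ^ 2 := by
    rw [Polynomial.X_pow_dvd_iff]
    intro d hd
    interval_cases d <;> simp [hq0, hq1, hq2, Polynomial.coeff_X_pow]
  obtain ⟨r, hr⟩ := hd
  have hq : q₂ = -Polynomial.X ^ 2 + Polynomial.X ^ 3 * r := by rw [← hr]; ring
  have bd : ∀ p : Polynomial ℂ, ∃ c : ℝ, ∀ t : ℂ, ‖t‖ ≤ 1 → ‖p.eval t‖ ≤ c := by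
    intro p
    obtain ⟨c, hc⟩ := (isCompact_closedBall (0 : ℂ) 1).exists_bound_of_continuousOn
      p.continuous.continuousOn
    exact ⟨c, fun t ht => hc t (by simpa using ht)⟩
  obtain ⟨c1, hc1⟩ := bd r
  obtain ⟨c2, hc2⟩ := bd r.derivative
  have h1 : 0 ≤ c1 := (norm_nonneg _).trans (hc1 0 (by simp))
  have h2 : 0 ≤ c2 := (norm_nonneg _).trans (hc2 0 (by simp))
  refine ⟨2 + 3 * c1 + c2, by linarith, fun t ht => ⟨⟨r.eval t, ?_, ?_⟩, ?_⟩⟩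
  · conv_lhs => rw [hq]
    simp
  · linarith [hc1 t ht]
  · have e : q₂.derivative.eval t = t * (-2 + 3 * t * r.eval t + t ^ 2 * r.derivative.eval t) := by
      conv_lhs => rw [hq]
      simp
      ring
    rw [e, norm_mul, mul_comm]
    gcongr
    refine (norm_add₃_le ..).trans ?_
    rw [norm_neg, norm_mul, norm_mul, norm_mul, norm_pow, Complex.norm_ofNat, Complex.norm_ofNat]
    have h3 : 3 * ‖t‖ * ‖r.eval t‖ ≤ 3 * 1 * c1 := by
      gcongr
      exact hc1 t ht
    have h4 : ‖t‖ ^ 2 * ‖r.derivative.eval t‖ ≤ 1 ^ 2 * c2 := by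
      gcongr
      exact hc2 t ht
    linarith

theorem differentiable_mapG (q₂ : Polynomial ℂ) (δ : ℂ) : Differentiable ℂ (mapG q₂ δ) := by
  unfold mapG henonMap
  have := q₂.differentiable
  fun_prop

theorem continuous_mapG_iterate (q₂ : Polynomial ℂ) (δ : ℂ) (m : ℕ) :
    Continuous (mapG q₂ δ)^[m] := (differentiable_mapG q₂ δ).continuous.iterate m

/-- The inverse of the Hénon map `G`. -/
noncomputable def mapGInv (q₂ : Polynomial ℂ) (δ : ℂ) (p : ℂ × ℂ) : ℂ × ℂ :=
  (p.1 - q₂.eval (p.1 + p.2), (p.2 + q₂.eval (p.1 + p.2)) / δ)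

theorem continuous_mapGInv (q₂ : Polynomial ℂ) (δ : ℂ) : Continuous (mapGInv q₂ δ) := by
  unfold mapGInv
  have := q₂.continuous
  fun_prop

theorem mapGInv_mapG (hδ : δ ≠ 0) : Function.LeftInverse (mapGInv q₂ δ) (mapG q₂ δ) := by
  intro p
  have e : (mapG q₂ δ p).1 + (mapG q₂ δ p).2 = p.1 + δ * p.2 := by
    simp [mapG, henonMap]
  rw [mapGInv, e]
  ext
  · simp [mapG, henonMap]
  · simp [mapG, henonMap, hδ]

theorem mapG_mapGInv (hδ : δ ≠ 0) : Function.LeftInverse (mapG q₂ δ) (mapGInv q₂ δ) := by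
  intro p
  have e : (mapGInv q₂ δ p).1 + δ * (mapGInv q₂ δ p).2 = p.1 + p.2 := by
    simp only [mapGInv]
    field_simp
    ring
  rw [mapG, henonMap, e]
  ext
  · simp [mapGInv]
  · simp only [mapGInv]
    field_simp
    ring

variable {K ρ : ℝ} (hδ : ‖δ‖ ≤ 1 / 64) (hK : 1 ≤ K) (hρ : 64 * K * ρ ≤ 1)
  (hq : ∀ t : ℂ, ‖t‖ ≤ 1 → (∃ r : ℂ, q₂.eval t = -t ^ 2 + t ^ 3 * r ∧ ‖r‖ ≤ K) ∧
        ‖q₂.derivative.eval t‖ ≤ K * ‖t‖)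
include hδ hK hρ hq

omit hδ in
theorem norm_eval_le {t : ℂ} {m : ℝ} (ht : ‖t‖ ≤ 2 * m) (hm : m ≤ ρ) :
    ‖q₂.eval t‖ ≤ 8 * m ^ 2 := by
  have hKρ : 64 * ρ ≤ 1 := by
    by_cases h : 0 ≤ ρ
    · nlinarith
    · linarith
  obtain ⟨⟨r, hr, hrn⟩, -⟩ := hq t (by linarith)
  have e : -t ^ 2 + t ^ 3 * r = t ^ 2 * (-1 + t * r) := by ring
  rw [hr, e, norm_mul, norm_pow]
  have hm0 : 0 ≤ m := by linarith [norm_nonneg t]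
  have h1 : ‖-1 + t * r‖ ≤ 2 := by
    refine (norm_add_le _ _).trans ?_
    rw [norm_neg, norm_one, norm_mul]
    have : ‖t‖ * ‖r‖ ≤ 2 * ρ * K :=
      mul_le_mul (by linarith) hrn (norm_nonneg _) (by linarith)
    linarith
  calc ‖t‖ ^ 2 * ‖-1 + t * r‖ ≤ (2 * m) ^ 2 * 2 := by gcongr
    _ = 8 * m ^ 2 := by ring

/-- Off the cone `‖y‖ < ‖w‖` the norm is halved at each step. -/
theorem mapG_norm_le_half {w y : ℂ} (hw : ‖w‖ ≤ ‖y‖) (hy : ‖y‖ ≤ ρ) :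
    ‖(mapG q₂ δ (w, y)).2‖ ≤ ‖y‖ / 2 := by
  have hKρ : 64 * ρ ≤ 1 := by nlinarith [norm_nonneg y]
  have ht : ‖w + δ * y‖ ≤ 2 * ‖y‖ := by
    refine (norm_add_le _ _).trans ?_
    rw [norm_mul]
    nlinarith [norm_nonneg y]
  have h1 := norm_eval_le hK hρ hq ht hy
  simp only [mapG, henonMap]
  refine (norm_sub_le _ _).trans ?_
  rw [norm_mul]
  nlinarith [norm_nonneg y]

/-- A point of the basin enters the cone `‖y‖ < ‖w‖`. -/
theorem exists_mem_cone (hδ0 : δ ≠ 0) (hρ0 : 0 < ρ) {p : ℂ × ℂ} (hp : p ∈ basin (mapG q₂ δ))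
    (M : ℕ) : ∃ m ≥ M, ‖((mapG q₂ δ)^[m] p).2‖ < ‖((mapG q₂ δ)^[m] p).1‖ := by
  -- An orbit that stays off the cone decays like 2^(-k), so along it the differential of `G` is
  -- diag(1, δ) up to summable errors and the horizontal derivative at the orbit does not decay.
  -- Uniform convergence to 0 on a neighbourhood would force it to, by Cauchy's estimate.
  by_contra! hcon
  obtain ⟨V, hV, hunif⟩ := hp
  set G := mapG q₂ δ with hG
  rw [Metric.tendstoUniformlyOn_iff] at hunif
  obtain ⟨M', hM'⟩ := eventually_atTop.1 (hunif ρ hρ0)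
  set m₀ := max M M' with hm₀
  set o := G^[m₀] p with ho
  have hKρ : 64 * ρ ≤ 1 := by nlinarith
  -- the neighbourhood of the image point
  have hinv : ∀ v, G^[m₀] ((mapGInv q₂ δ)^[m₀] v) = v :=
    (mapG_mapGInv hδ0).iterate m₀
  have hinv' : (mapGInv q₂ δ)^[m₀] o = p := (mapGInv_mapG hδ0).iterate m₀ p
  have hcont : ContinuousAt (fun t : ℂ => (mapGInv q₂ δ)^[m₀] (o + (t, 0))) 0 := by
    have := (continuous_mapGInv q₂ δ).iterate m₀
    have h2 : Continuous (fun t : ℂ => (mapGInv q₂ δ)^[m₀] (o + (t, 0))) := by fun_prop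
    exact h2.continuousAt
  have hmem : ∀ᶠ t : ℂ in 𝓝 0, (mapGInv q₂ δ)^[m₀] (o + (t, 0)) ∈ V := by
    apply hcont
    have e : o + ((0 : ℂ), (0 : ℂ)) = o := by simp
    show V ∈ 𝓝 ((mapGInv q₂ δ)^[m₀] (o + ((0 : ℂ), (0 : ℂ))))
    rw [e, hinv']
    exact hV
  obtain ⟨r, hr, hball⟩ := Metric.eventually_nhds_iff_ball.1 hmem
  have hr2 : 0 < r / 2 := by positivity
  have hsmall : ∀ ε > 0, ∀ᶠ k : ℕ in atTop, ∀ t ∈ Metric.ball (0 : ℂ) r,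
      ‖G^[k] (o + (t, 0))‖ < ε := by
    intro ε hε
    have h1 := (tendsto_add_atTop_nat m₀).eventually (hunif ε hε)
    filter_upwards [h1] with k hk t ht
    have h2 := hk _ (hball t ht)
    rwa [dist_zero_left, Function.iterate_add_apply, hinv] at h2
  -- along the orbit of `p` the coordinates decay exponentially
  have hdec : ∀ k : ℕ, ‖(G^[k] o).1‖ ≤ ‖(G^[k] o).2‖ ∧ ‖(G^[k] o).2‖ ≤ ρ * (1 / 2) ^ k := by
    intro k
    have e : ∀ k, G^[k] o = G^[k + m₀] p := fun k => (Function.iterate_add_apply G k m₀ p).symm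
    have h1 : ∀ k, ‖(G^[k] o).1‖ ≤ ‖(G^[k] o).2‖ := by
      intro k
      rw [e]
      exact hcon _ (by omega)
    refine ⟨h1 k, ?_⟩
    induction k with
    | zero =>
      have h2 := hM' m₀ (le_max_right _ _) p (mem_of_mem_nhds hV)
      rw [dist_zero_left] at h2
      simpa using (norm_snd_le o).trans h2.le
    | succ k ih =>
      have h3 : ρ * (1 / 2) ^ k ≤ ρ :=
        mul_le_of_le_one_right hρ0.le (pow_le_one₀ (by norm_num) (by norm_num))
      have h2 := mapG_norm_le_half hδ hK hρ hq (h1 k) (ih.trans h3)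
      rw [Function.iterate_succ_apply', pow_succ]
      rw [Prod.mk.eta] at h2
      refine h2.trans ?_
      linarith
  -- the derivative in the horizontal direction does not decay
  have hder : ∀ k : ℕ, ∃ f g : ℂ, HasDerivAt (fun t : ℂ => (G^[k] (o + (t, 0))).1) f 0 ∧
      HasDerivAt (fun t : ℂ => (G^[k] (o + (t, 0))).2) g 0 ∧ ‖g‖ ≤ ‖f‖ ∧
        1 / 2 * (1 + (1 / 2) ^ k) ≤ ‖f‖ := by
    intro k
    induction k with
    | zero =>
      refine ⟨1, 0, ?_, ?_, by simp, by norm_num⟩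
      · simpa using (hasDerivAt_id (0 : ℂ)).const_add o.1
      · simpa using hasDerivAt_const (0 : ℂ) o.2
    | succ k ih =>
      obtain ⟨f, g, hf, hg, hgf, hfn⟩ := ih
      obtain ⟨d1, d2⟩ := hdec k
      set t := (G^[k] o).1 + δ * (G^[k] o).2 with ht
      have e0 : o + ((0 : ℂ), (0 : ℂ)) = o := by simp
      have hht : HasDerivAt (fun t : ℂ => (G^[k] (o + (t, 0))).1 + δ * (G^[k] (o + (t, 0))).2)
          (f + δ * g) 0 := hf.add (hg.const_mul δ)
      have hqq : HasDerivAt (fun t : ℂ =>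
          q₂.eval ((G^[k] (o + (t, 0))).1 + δ * (G^[k] (o + (t, 0))).2))
          (q₂.derivative.eval t * (f + δ * g)) 0 := by
        have h1 := q₂.hasDerivAt t
        have h2 : HasDerivAt (fun x => q₂.eval x) (q₂.derivative.eval t)
          ((G^[k] (o + ((0 : ℂ), 0))).1 + δ * (G^[k] (o + (0, 0))).2) := by
          rw [e0]; exact h1
        exact h2.comp 0 hht
      set η := ‖q₂.derivative.eval t‖ with hη
      have hp0 : (0 : ℝ) < (1 / 2) ^ k := by positivity
      have hp1 : ((1 : ℝ) / 2) ^ k ≤ 1 := pow_le_one₀ (by norm_num) (by norm_num)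
      have htn : ‖t‖ ≤ 2 * (ρ * (1 / 2) ^ k) := by
        refine (norm_add_le _ _).trans ?_
        rw [norm_mul]
        nlinarith [norm_nonneg (G^[k] o).2]
      have hηn : η ≤ 1 / 32 * (1 / 2) ^ k := by
        have h1 := (hq t (by nlinarith)).2
        refine h1.trans ?_
        have h2 : K * ‖t‖ ≤ K * (2 * (ρ * (1 / 2) ^ k)) := by gcongr
        nlinarith
      have hη0 : 0 ≤ η := norm_nonneg _
      have hfg : ‖f + δ * g‖ ≤ 2 * ‖f‖ := by
        refine (norm_add_le _ _).trans ?_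
        rw [norm_mul]
        nlinarith [norm_nonneg g]
      have hX : ‖q₂.derivative.eval t * (f + δ * g)‖ ≤ 2 * η * ‖f‖ := by
        rw [norm_mul]
        nlinarith
      have hf' : (1 - 2 * η) * ‖f‖ ≤ ‖f + q₂.derivative.eval t * (f + δ * g)‖ := by
        have h1 := norm_sub_norm_le f (-(q₂.derivative.eval t * (f + δ * g)))
        rw [sub_neg_eq_add, norm_neg] at h1
        linarith
      refine ⟨f + q₂.derivative.eval t * (f + δ * g), δ * g - q₂.derivative.eval t * (f + δ * g),
        ?_, ?_, ?_, ?_⟩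
      · simp only [Function.iterate_succ_apply']
        exact hf.add hqq
      · simp only [Function.iterate_succ_apply']
        exact (hg.const_mul δ).sub hqq
      · have h1 : ‖δ * g - q₂.derivative.eval t * (f + δ * g)‖ ≤ 1 / 64 * ‖f‖ + 2 * η * ‖f‖ := by
          refine (norm_sub_le _ _).trans (add_le_add ?_ hX)
          rw [norm_mul]
          gcongr
        have h2 : 1 / 64 * ‖f‖ + 2 * η * ‖f‖ ≤ (1 - 2 * η) * ‖f‖ := by
          nlinarith [norm_nonneg f]
        linarith
      · refine le_trans ?_ hf'
        rw [pow_succ]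
        -- The lower bound (1 + 2^(-k))/2 falls by 2^(-k)/4 at this step, which exceeds the loss
        -- caused by the factor 1 - 2η ≥ 1 - 2^(-k)/16.
        have h1 : (1 - 1 / 16 * (1 / 2) ^ k) * (1 / 2 * (1 + (1 / 2) ^ k)) ≤ (1 - 2 * η) * ‖f‖ :=
          mul_le_mul (by linarith) hfn (by positivity) (by linarith)
        nlinarith
  -- The bound r/8 on a circle of radius r/2 gives a derivative of at most 1/4, against the lower
  -- bound 1/2.
  obtain ⟨k, hk⟩ := (hsmall (r / 8) (by positivity)).exists
  obtain ⟨f, g, hf, -, -, hfn⟩ := hder k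
  have hdiff : Differentiable ℂ (fun t : ℂ => (G^[k] (o + (t, 0))).1) := by
    have := (differentiable_mapG q₂ δ).iterate k
    fun_prop
  have hC : ‖deriv (fun t : ℂ => (G^[k] (o + (t, 0))).1) 0‖ ≤ r / 8 / (r / 2) := by
    refine Complex.norm_deriv_le_of_forall_mem_sphere_norm_le hr2 hdiff.diffContOnCl ?_
    intro t ht
    refine (norm_fst_le _).trans (hk t ?_).le
    rw [mem_ball_zero_iff]
    rw [mem_sphere_zero_iff_norm] at ht
    linarith
  rw [hf.deriv] at hC
  have e : r / 8 / (r / 2) = 1 / 4 := by field_simp; norm_num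
  have : (0 : ℝ) < (1 / 2) ^ k := by positivity
  linarith

end

section
variable {q₂ : Polynomial ℂ} {δ : ℂ} {K ρ : ℝ} (hδ : ‖δ‖ ≤ 1 / 64) (hK : 1 ≤ K)
  (hρ : 64 * K * ρ ≤ 1)
  (hq : ∀ t : ℂ, ‖t‖ ≤ 1 → (∃ r : ℂ, q₂.eval t = -t ^ 2 + t ^ 3 * r ∧ ‖r‖ ≤ K) ∧
        ‖q₂.derivative.eval t‖ ≤ K * ‖t‖)
include hδ hK hρ hq

/-- One step of `G` inside the cone `‖y‖ ≤ ‖w‖`. -/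
theorem mapG_cone_step {w y : ℂ} (hw0 : w ≠ 0) (hy : ‖y‖ ≤ ‖w‖) (hw : ‖w‖ ≤ ρ) :
    (mapG q₂ δ (w, y)).1 ≠ 0 ∧
      ‖(mapG q₂ δ (w, y)).2‖ / ‖(mapG q₂ δ (w, y)).1‖ ≤ ‖y‖ / ‖w‖ / 2 + 16 * ‖w‖ ∧
      ‖1 / (mapG q₂ δ (w, y)).1 - 1 / w - 1‖ ≤ ‖y‖ / ‖w‖ / 8 + 12 * K * ‖w‖ := by
  have hwp := norm_pos_iff.2 hw0
  have hKw : 64 * (K * ‖w‖) ≤ 1 := by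
    have : K * ‖w‖ ≤ K * ρ := by gcongr
    linarith
  have hw64 : 64 * ‖w‖ ≤ 1 := by nlinarith
  set s := y / w with hs
  have hsn : ‖s‖ = ‖y‖ / ‖w‖ := norm_div _ _
  have hs1 : ‖s‖ ≤ 1 := by rw [hsn]; exact div_le_one_of_le₀ hy hwp.le
  have hys : y = s * w := by rw [hs]; field_simp
  have ht : ‖w + δ * y‖ ≤ 2 * ‖w‖ := by
    refine (norm_add_le _ _).trans ?_
    rw [norm_mul]
    nlinarith [norm_nonneg y]
  obtain ⟨⟨r, hr, hrn⟩, -⟩ := hq (w + δ * y) (by linarith)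
  have hqn := norm_eval_le hK hρ hq ht hw
  set v := -(1 + δ * s) ^ 2 + (1 + δ * s) ^ 3 * (w * r) with hv
  have e1 : (mapG q₂ δ (w, y)).1 = w + w ^ 2 * v := by
    simp only [mapG, henonMap]
    rw [hr, hys, hv]
    ring
  have hδs : ‖δ * s‖ ≤ 1 / 64 * ‖s‖ := by
    rw [norm_mul]; gcongr
  have hd1 : ‖1 + δ * s‖ ≤ 65 / 64 := by
    refine (norm_add_le _ _).trans ?_
    rw [norm_one]
    linarith
  have hv1 : ‖v + 1‖ ≤ 1 / 16 * ‖s‖ + 2 * K * ‖w‖ := by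
    have e : v + 1 = -(δ * s * (2 + δ * s)) + (1 + δ * s) ^ 3 * (w * r) := by rw [hv]; ring
    rw [e]
    refine (norm_add_le _ _).trans (add_le_add ?_ ?_)
    · rw [norm_neg, norm_mul]
      have : ‖2 + δ * s‖ ≤ 3 := by
        refine (norm_add_le _ _).trans ?_
        rw [Complex.norm_ofNat]
        linarith
      calc ‖δ * s‖ * ‖2 + δ * s‖ ≤ (1 / 64 * ‖s‖) * 3 := by gcongr
        _ ≤ _ := by linarith [norm_nonneg s]
    · rw [norm_mul, norm_mul, norm_pow]
      calc ‖1 + δ * s‖ ^ 3 * (‖w‖ * ‖r‖) ≤ (65 / 64) ^ 3 * (‖w‖ * K) := by gcongr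
        _ ≤ 2 * K * ‖w‖ := by nlinarith
  have hv2 : ‖v‖ ≤ 2 := by
    have := norm_sub_le (v + 1) 1
    rw [add_sub_cancel_right, norm_one] at this
    linarith
  have hw4 : ‖w‖ ≤ 1 / 4 := by linarith
  have hne := step_ne_zero hw0 hw4 hv2
  have hinv := neg_one_div_step hw0 hw4 hv2
  have hhalf := half_le_norm_one_add_mul hw4 hv2
  have h1v := one_add_mul_ne_zero hw4 hv2
  rw [← e1] at hne hinv
  refine ⟨hne, ?_, ?_⟩
  · have hlow : 15 / 16 * ‖w‖ ≤ ‖(mapG q₂ δ (w, y)).1‖ := by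
      have e : w + w ^ 2 * v = w * (1 + w * v) := by ring
      rw [e1, e, norm_mul, mul_comm]
      gcongr
      have h := norm_sub_norm_le (1 : ℂ) (-(w * v))
      rw [sub_neg_eq_add, norm_neg, norm_mul, norm_one] at h
      nlinarith [norm_nonneg v]
    have hq3 : ‖q₂.eval (w + δ * y)‖ ≤ 8 * ‖w‖ ^ 2 := by
      rw [hr]
      have e : -(w + δ * y) ^ 2 + (w + δ * y) ^ 3 * r = (w + δ * y) ^ 2 * (-1 + (w + δ * y) * r) := by
        ring
      rw [e, norm_mul, norm_pow]
      have h1 : ‖-1 + (w + δ * y) * r‖ ≤ 2 := by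
        refine (norm_add_le _ _).trans ?_
        rw [norm_neg, norm_one, norm_mul]
        have : ‖w + δ * y‖ * ‖r‖ ≤ 2 * ‖w‖ * K := by gcongr
        linarith
      calc ‖w + δ * y‖ ^ 2 * ‖-1 + (w + δ * y) * r‖ ≤ (2 * ‖w‖) ^ 2 * 2 := by gcongr
        _ = 8 * ‖w‖ ^ 2 := by ring
    have hup : ‖(mapG q₂ δ (w, y)).2‖ ≤ 1 / 64 * ‖y‖ + 8 * ‖w‖ ^ 2 := by
      simp only [mapG, henonMap]
      refine (norm_sub_le _ _).trans (add_le_add ?_ hq3)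
      rw [norm_mul]; gcongr
    rw [div_le_iff₀ (norm_pos_iff.2 hne)]
    have h2 : (‖y‖ / ‖w‖ / 2 + 16 * ‖w‖) * (15 / 16 * ‖w‖) ≤
        (‖y‖ / ‖w‖ / 2 + 16 * ‖w‖) * ‖(mapG q₂ δ (w, y)).1‖ := by gcongr
    refine hup.trans (le_trans ?_ h2)
    have e : (‖y‖ / ‖w‖ / 2 + 16 * ‖w‖) * (15 / 16 * ‖w‖) = 15 / 32 * ‖y‖ + 15 * ‖w‖ ^ 2 := by
      field_simp
      ring
    rw [e]
    nlinarith [norm_nonneg y, sq_nonneg ‖w‖]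
  · have e2 : 1 / (mapG q₂ δ (w, y)).1 = -(-1 / (mapG q₂ δ (w, y)).1) := by ring
    have e3 : 1 / (mapG q₂ δ (w, y)).1 - 1 / w - 1 = -(((v + 1) + w * v) / (1 + w * v)) := by
      rw [e2, hinv]
      field_simp
      ring
    rw [e3, norm_neg, norm_div, div_le_iff₀ (by linarith), ← hsn]
    have h3 : ‖(v + 1) + w * v‖ ≤ 1 / 16 * ‖s‖ + 2 * K * ‖w‖ + ‖w‖ * 2 := by
      refine (norm_add_le _ _).trans (add_le_add hv1 ?_)
      rw [norm_mul]; gcongr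
    have h4 : (‖s‖ / 8 + 12 * K * ‖w‖) * (1 / 2) ≤ (‖s‖ / 8 + 12 * K * ‖w‖) * ‖1 + w * v‖ := by
      gcongr
    nlinarith

/-- Along an orbit in the cone, `1 / w_j = 1 / w_0 + j + O(√j)`. -/
theorem mapG_cone_orbit {p : ℂ × ℂ} {A : ℝ} (hp0 : p.1 ≠ 0) (hp : ‖p.2‖ ≤ ‖p.1‖)
    (hsmall : ∀ j : ℕ, ‖((mapG q₂ δ)^[j] p).1‖ ≤ ρ) (hA : ‖1 / p.1‖ ≤ A) :
    ∀ j : ℕ, ((mapG q₂ δ)^[j] p).1 ≠ 0 ∧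
      ‖1 / ((mapG q₂ δ)^[j] p).1 - 1 / p.1 - j‖ ≤ 4 + 2 * (76 * K * (4 * A + 4)) * √j := by
  set G := mapG q₂ δ with hG
  have hρ0 : 0 < ρ := (norm_pos_iff.2 hp0).trans_le (by simpa using hsmall 0)
  have hKρ : 64 * ρ ≤ 1 := by nlinarith
  have hA0 : 0 ≤ A := (norm_nonneg _).trans hA
  have hcone : ∀ j : ℕ, (G^[j] p).1 ≠ 0 ∧ ‖(G^[j] p).2‖ ≤ ‖(G^[j] p).1‖ ∧
      -A + j / 2 ≤ (1 / (G^[j] p).1).re := by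
    intro j
    induction j with
    | zero =>
      refine ⟨hp0, hp, ?_⟩
      have := (abs_le.1 (Complex.abs_re_le_norm (1 / p.1))).1
      simp only [Function.iterate_zero_apply, Nat.cast_zero, zero_div, add_zero]
      linarith
    | succ j ih =>
      obtain ⟨i1, i2, i3⟩ := ih
      have hw := hsmall j
      obtain ⟨h1, h2, h3⟩ := mapG_cone_step hδ hK hρ hq i1 i2 hw
      rw [Prod.mk.eta, ← hG, ← Function.iterate_succ_apply' G] at h1 h2 h3
      have hs1 : ‖(G^[j] p).2‖ / ‖(G^[j] p).1‖ ≤ 1 := div_le_one_of_le₀ i2 (norm_nonneg _)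
      have hKw : 64 * (K * ‖(G^[j] p).1‖) ≤ 1 := by
        have : K * ‖(G^[j] p).1‖ ≤ K * ρ := by gcongr
        linarith
      refine ⟨h1, ?_, ?_⟩
      · rw [← div_le_one (norm_pos_iff.2 h1)]
        linarith
      · have h4 := (abs_le.1 ((Complex.abs_re_le_norm _).trans h3)).1
        rw [Complex.sub_re, Complex.sub_re, Complex.one_re] at h4
        push_cast
        linarith
  have hdecay : ∀ j : ℕ, ‖(G^[j] p).1‖ ≤ (4 * A + 4) / (j + 1) := by
    intro j
    obtain ⟨i1, -, i3⟩ := hcone j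
    have hX := i3.trans (Complex.re_le_norm _)
    have hX1 : 1 ≤ ‖1 / (G^[j] p).1‖ := by
      rw [norm_div, norm_one, le_div_iff₀ (norm_pos_iff.2 i1)]
      linarith [hsmall j]
    set X := ‖1 / (G^[j] p).1‖ with hXdef
    have h1 : (j : ℝ) + 1 ≤ (4 * A + 4) * X := by nlinarith
    have h2 : ‖(G^[j] p).1‖ * X = 1 := by
      rw [hXdef, norm_div, norm_one]
      have := norm_pos_iff.2 i1
      field_simp
    rw [le_div_iff₀ (by positivity)]
    calc ‖(G^[j] p).1‖ * (j + 1) ≤ ‖(G^[j] p).1‖ * ((4 * A + 4) * X) := by gcongr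
      _ = (4 * A + 4) * (‖(G^[j] p).1‖ * X) := by ring
      _ = 4 * A + 4 := by rw [h2, mul_one]
  set B := 76 * K * (4 * A + 4) with hB
  have hB0 : 0 ≤ B := by positivity
  -- The added 4|y|/|w| is a potential: the ratio is halved at each step, up to 16|w|, and its loss
  -- pays for the error |y|/(8|w|). What remains is 76K|w_j| ≤ B/(j + 1), and √j majorizes the
  -- harmonic sum well enough.
  have main : ∀ j : ℕ, ‖1 / (G^[j] p).1 - 1 / p.1 - j‖ + 4 * (‖(G^[j] p).2‖ / ‖(G^[j] p).1‖) ≤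
      4 + 2 * B * √j := by
    intro j
    induction j with
    | zero =>
      have hs1 : ‖p.2‖ / ‖p.1‖ ≤ 1 := div_le_one_of_le₀ hp (norm_nonneg _)
      simp
      linarith
    | succ j ih =>
      obtain ⟨i1, i2, -⟩ := hcone j
      obtain ⟨h1, h2, h3⟩ := mapG_cone_step hδ hK hρ hq i1 i2 (hsmall j)
      rw [Prod.mk.eta, ← hG, ← Function.iterate_succ_apply' G] at h1 h2 h3
      have h4 : ‖1 / (G^[j + 1] p).1 - 1 / p.1 - ((j + 1 : ℕ) : ℂ)‖ ≤
          ‖1 / (G^[j + 1] p).1 - 1 / (G^[j] p).1 - 1‖ + ‖1 / (G^[j] p).1 - 1 / p.1 - j‖ := by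
        refine le_trans (le_of_eq ?_) (norm_add_le _ _)
        congr 1
        push_cast
        ring
      have hwB : 76 * K * ‖(G^[j] p).1‖ ≤ B * (1 / ((j : ℝ) + 1)) := by
        rw [hB, mul_assoc (76 * K), mul_one_div]
        gcongr
        exact hdecay j
      have hsq : √(j : ℝ) + 1 / 2 * (1 / ((j : ℝ) + 1)) ≤ √((j + 1 : ℕ) : ℝ) := by
        have hj := Nat.cast_nonneg (α := ℝ) j
        apply Real.le_sqrt_of_sq_le
        have h5 := Real.sq_sqrt hj
        have h6 : √(j : ℝ) ≤ j + 1 / 4 := by nlinarith [sq_nonneg (√(j : ℝ) - 1 / 2)]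
        have h7 : 0 < 1 / ((j : ℝ) + 1) := by positivity
        have h8 : ((j : ℝ) + 1) * (1 / ((j : ℝ) + 1)) = 1 := by field_simp
        have h9 : 1 / ((j : ℝ) + 1) ≤ 1 := by
          rw [div_le_one (by positivity)]; linarith
        push_cast
        nlinarith
      have hKw : 0 ≤ ‖(G^[j] p).1‖ := norm_nonneg _
      have hs0 : 0 ≤ ‖(G^[j] p).2‖ / ‖(G^[j] p).1‖ := by positivity
      have h10 : 64 * ‖(G^[j] p).1‖ ≤ 64 * K * ‖(G^[j] p).1‖ := by gcongr; linarith
      have h11 : 2 * B * (√(j : ℝ) + 1 / 2 * (1 / ((j : ℝ) + 1))) ≤ 2 * B * √((j + 1 : ℕ) : ℝ) := by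
        gcongr
      linarith
  intro j
  refine ⟨(hcone j).1, ?_⟩
  have := main j
  have h0 : 0 ≤ ‖(G^[j] p).2‖ / ‖(G^[j] p).1‖ := by positivity
  linarith

end

/-- On compact subsets of the parabolic basin, `1 / w_m = m + O(√m)` uniformly. -/
theorem exists_wSeq_bound {q₂ : Polynomial ℂ} {δ : ℂ} (hq0 : q₂.coeff 0 = 0)
    (hq1 : q₂.coeff 1 = 0) (hq2 : q₂.coeff 2 = -1) (hδ0 : δ ≠ 0) (hδ : ‖δ‖ ≤ 1 / 64)
    {S : Set (ℂ × ℂ)} (hS : IsCompact S) (hSb : S ⊆ basin (mapG q₂ δ)) :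
    ∃ C : ℝ, ∃ M : ℕ, ∀ g ∈ S, ∀ m ≥ M, wSeq q₂ δ g m ≠ 0 ∧
      ‖1 / wSeq q₂ δ g m - m‖ ≤ C * √m := by
  obtain ⟨K, hK, hq⟩ := exists_eval_expansion hq0 hq1 hq2
  set ρ : ℝ := 1 / (64 * K) with hρdef
  have hρ0 : 0 < ρ := by positivity
  have hρ : 64 * K * ρ ≤ 1 := by rw [hρdef]; field_simp; rfl
  set G := mapG q₂ δ with hG
  have loc : ∀ p ∈ S, ∃ V ∈ 𝓝 p, ∃ C : ℝ, ∃ M : ℕ, ∀ g ∈ V, ∀ m ≥ M, (G^[m] g).1 ≠ 0 ∧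
      ‖1 / (G^[m] g).1 - m‖ ≤ C * √m := by
    intro p hp
    obtain ⟨V, hV, hunif⟩ := hSb hp
    rw [Metric.tendstoUniformlyOn_iff] at hunif
    obtain ⟨M, hM⟩ := eventually_atTop.1 (hunif ρ hρ0)
    obtain ⟨m, hm, hcone⟩ := exists_mem_cone hδ hK hρ hq hδ0 hρ0 (hSb hp) M
    have hcont := continuous_mapG_iterate q₂ δ m
    have hp0 : (G^[m] p).1 ≠ 0 := by
      intro h
      rw [← hG, h, norm_zero] at hcone
      exact absurd hcone (not_lt.2 (norm_nonneg _))
    have h1 : ∀ᶠ v in 𝓝 p, ‖(G^[m] v).2‖ < ‖(G^[m] v).1‖ :=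
      (hcont.snd.norm.tendsto p).eventually_lt (hcont.fst.norm.tendsto p) hcone
    have h2 : ∀ᶠ v in 𝓝 p, ‖1 / (G^[m] v).1‖ < ‖1 / (G^[m] p).1‖ + 1 := by
      have h3 : Tendsto (fun v => ‖1 / (G^[m] v).1‖) (𝓝 p) (𝓝 ‖1 / (G^[m] p).1‖) :=
        (tendsto_const_nhds.div (hcont.fst.tendsto p) hp0).norm
      exact h3.eventually_lt_const (by linarith)
    set A := ‖1 / (G^[m] p).1‖ + 1 with hA
    have hA0 : 0 ≤ A := by positivity
    refine ⟨_, inter_mem hV (h1.and h2), A + m + 4 + 2 * (76 * K * (4 * A + 4)), m + 1, ?_⟩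
    rintro g ⟨hgV, hg1, hg2⟩ k hk
    have hg0 : (G^[m] g).1 ≠ 0 := by
      intro h
      rw [h, norm_zero] at hg1
      exact absurd hg1 (not_lt.2 (norm_nonneg _))
    have horb := mapG_cone_orbit hδ hK hρ hq (p := G^[m] g) hg0 hg1.le (A := A) (fun j => by
      rw [← Function.iterate_add_apply]
      have := hM (j + m) (by omega) g hgV
      rw [dist_zero_left] at this
      exact (norm_fst_le _).trans this.le) hg2.le (k - m)
    have hkm : k - m + m = k := by omega
    rw [← hG, ← Function.iterate_add_apply, hkm] at horb
    refine ⟨horb.1, ?_⟩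
    have hcast : ((k - m : ℕ) : ℂ) = (k : ℂ) - m := by
      rw [Nat.cast_sub (by omega)]
    have e : 1 / (G^[k] g).1 - k = (1 / (G^[k] g).1 - 1 / (G^[m] g).1 - ((k - m : ℕ) : ℂ)) +
        (1 / (G^[m] g).1 - m) := by rw [hcast]; ring
    have h4 : ‖1 / (G^[m] g).1 - m‖ ≤ A + m := by
      refine (norm_sub_le _ _).trans ?_
      rw [Complex.norm_natCast]
      linarith
    have hsq : √((k - m : ℕ) : ℝ) ≤ √(k : ℝ) := by
      apply Real.sqrt_le_sqrt
      exact_mod_cast Nat.sub_le k m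
    have hsq1 : 1 ≤ √(k : ℝ) := by
      rw [Real.one_le_sqrt]
      exact_mod_cast (by omega : 1 ≤ k)
    rw [e]
    have h5 : 2 * (76 * K * (4 * A + 4)) * √((k - m : ℕ) : ℝ) ≤
        2 * (76 * K * (4 * A + 4)) * √(k : ℝ) := by gcongr
    have h6 : (A + m + 4) * 1 ≤ (A + m + 4) * √(k : ℝ) := by gcongr
    refine (norm_add_le _ _).trans ?_
    linarith [horb.2]
  choose! V hV C M hCM using loc
  obtain ⟨t, hcov⟩ := hS.elim_nhds_subcover' (fun x _ => V x) (fun x hx => hV x hx)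
  refine ⟨∑ x ∈ t, |C x|, t.sup (fun x => M x), fun g hg m hm => ?_⟩
  have hgc := hcov hg
  simp only [Set.mem_iUnion] at hgc
  obtain ⟨x, hx, hgx⟩ := hgc
  have hmx : M x ≤ m := (Finset.le_sup (f := fun x : S => M x) hx).trans hm
  obtain ⟨h1, h2⟩ := hCM x x.2 g hgx m hmx
  refine ⟨h1, h2.trans ?_⟩
  gcongr
  exact (le_abs_self _).trans (Finset.single_le_sum (f := fun x : S => |C x|)
    (fun _ _ => abs_nonneg _) hx)

/-! ### Trigonometric bounds -/

theorem norm_arctan_le {τ : ℂ} (h : ‖τ‖ ≤ 1 / 8) : ‖Complex.arctan τ‖ ≤ 2 * ‖τ‖ := by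
  have h1 : 7 / 8 ≤ ‖1 - τ * Complex.I‖ := by
    have := norm_sub_norm_le (1 : ℂ) (τ * Complex.I)
    rw [norm_mul, Complex.norm_I, norm_one, mul_one] at this
    linarith
  have h0 : 1 - τ * Complex.I ≠ 0 := by
    intro h0
    rw [h0, norm_zero] at h1
    norm_num at h1
  have e : (1 + τ * Complex.I) / (1 - τ * Complex.I) =
      1 + 2 * τ * Complex.I / (1 - τ * Complex.I) := by
    field_simp
    ring
  have h2 : ‖2 * τ * Complex.I / (1 - τ * Complex.I)‖ ≤ 16 / 7 * ‖τ‖ := by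
    rw [norm_div, norm_mul, norm_mul, Complex.norm_I, Complex.norm_ofNat, div_le_iff₀ (by linarith)]
    nlinarith [norm_nonneg τ]
  have h3 := Complex.norm_log_one_add_half_le_self (h2.trans (by linarith))
  rw [Complex.arctan, e, norm_mul, norm_div, norm_neg, Complex.norm_I, Complex.norm_ofNat]
  linarith [norm_nonneg τ]

theorem tan_arctan_of_norm_le {τ : ℂ} (h : ‖τ‖ ≤ 1 / 8) :
    Complex.tan (Complex.arctan τ) = τ := by
  refine Complex.tan_arctan ?_ ?_
  · rintro rfl
    rw [Complex.norm_I] at h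
    norm_num at h
  · rintro rfl
    rw [norm_neg, Complex.norm_I] at h
    norm_num at h

theorem norm_exp_mul_I_sub_one_le {s : ℂ} (h : ‖s‖ ≤ 1) :
    ‖Complex.exp (s * Complex.I) - 1‖ ≤ 2 * ‖s‖ ∧ ‖Complex.exp (-s * Complex.I) - 1‖ ≤ 2 * ‖s‖ := by
  have h1 := Complex.norm_exp_sub_one_le (x := s * Complex.I) (by simpa using h)
  have h2 := Complex.norm_exp_sub_one_le (x := -s * Complex.I) (by simpa using h)
  simp only [norm_mul, norm_neg, Complex.norm_I, mul_one] at h1 h2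
  exact ⟨h1, h2⟩

theorem norm_cos_sub_one_le {s : ℂ} (h : ‖s‖ ≤ 1) : ‖Complex.cos s - 1‖ ≤ 2 * ‖s‖ := by
  obtain ⟨h1, h2⟩ := norm_exp_mul_I_sub_one_le h
  have e : Complex.cos s - 1 =
      ((Complex.exp (s * Complex.I) - 1) + (Complex.exp (-s * Complex.I) - 1)) / 2 := by
    rw [Complex.cos]; ring
  rw [e, norm_div, Complex.norm_ofNat]
  linarith [norm_add_le (Complex.exp (s * Complex.I) - 1) (Complex.exp (-s * Complex.I) - 1)]

theorem norm_sin_le_two_mul {s : ℂ} (h : ‖s‖ ≤ 1) : ‖Complex.sin s‖ ≤ 2 * ‖s‖ := by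
  obtain ⟨h1, h2⟩ := norm_exp_mul_I_sub_one_le h
  have e : Complex.sin s = ((Complex.exp (-s * Complex.I) - 1) -
      (Complex.exp (s * Complex.I) - 1)) / 2 * Complex.I := by
    rw [Complex.sin]; ring
  rw [e, norm_mul, norm_div, Complex.norm_ofNat, Complex.norm_I]
  linarith [norm_sub_le (Complex.exp (-s * Complex.I) - 1) (Complex.exp (s * Complex.I) - 1)]

theorem half_le_re_cos {s : ℂ} (h : ‖s‖ ≤ 1 / 4) : 1 / 2 ≤ (Complex.cos s).re := by
  have h1 := (Complex.abs_re_le_norm _).trans (norm_cos_sub_one_le (s := s) (by linarith))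
  rw [Complex.sub_re, Complex.one_re] at h1
  linarith [(abs_le.1 h1).1]

theorem cos_ne_zero_of_norm_le {s : ℂ} (h : ‖s‖ ≤ 1 / 4) : Complex.cos s ≠ 0 := by
  intro h0
  have := half_le_re_cos h
  rw [h0] at this
  norm_num at this

theorem norm_tan_sub_le {s : ℂ} (h : ‖s‖ ≤ 1 / 4) :
    ‖Complex.tan s - s‖ ≤ 16 * ‖s‖ ^ 3 := by
  have hmem : ∀ c ∈ Metric.closedBall (0 : ℂ) ‖s‖, ‖c‖ ≤ ‖s‖ ∧ ‖c‖ ≤ 1 / 4 := by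
    intro c hc
    rw [mem_closedBall_zero_iff] at hc
    exact ⟨hc, hc.trans h⟩
  have hd : ∀ c ∈ Metric.closedBall (0 : ℂ) ‖s‖,
      HasDerivAt (fun c => Complex.tan c - c) (1 / Complex.cos c ^ 2 - 1) c := fun c hc =>
    (Complex.hasDerivAt_tan (cos_ne_zero_of_norm_le (hmem c hc).2)).sub (hasDerivAt_id c)
  have h1 := (convex_closedBall (0 : ℂ) ‖s‖).norm_image_sub_le_of_norm_deriv_le
    (f := fun c => Complex.tan c - c) (C := 16 * ‖s‖ ^ 2)
    (fun c hc => (hd c hc).differentiableAt) (fun c hc => ?_)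
    (x := 0) (y := s) (by simp) (by simp)
  · simpa [pow_succ, mul_assoc] using h1
  · rw [(hd c hc).deriv]
    obtain ⟨hc1, hc2⟩ := hmem c hc
    have hne := cos_ne_zero_of_norm_le hc2
    have e : 1 / Complex.cos c ^ 2 - 1 = Complex.sin c ^ 2 / Complex.cos c ^ 2 := by
      rw [eq_div_iff (pow_ne_zero 2 hne), sub_mul, div_mul_cancel₀ _ (pow_ne_zero 2 hne)]
      linear_combination -Complex.sin_sq_add_cos_sq c
    have h3 : 1 / 2 ≤ ‖Complex.cos c‖ := (half_le_re_cos hc2).trans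
      ((le_abs_self _).trans (Complex.abs_re_le_norm _))
    have h4 := norm_sin_le_two_mul (s := c) (by linarith)
    have h5 : ‖Complex.sin c‖ ≤ 2 * ‖s‖ := by linarith
    rw [e, norm_div, norm_pow, norm_pow, div_le_iff₀ (by positivity)]
    have h6 : ‖Complex.sin c‖ ^ 2 ≤ (2 * ‖s‖) ^ 2 := by gcongr
    have h7 : (1 / 2) ^ 2 ≤ ‖Complex.cos c‖ ^ 2 := by gcongr
    nlinarith [sq_nonneg ‖s‖]

theorem norm_sub_arctan_le {τ : ℂ} (h : ‖τ‖ ≤ 1 / 8) :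
    ‖Complex.arctan τ - τ‖ ≤ 128 * ‖τ‖ ^ 3 := by
  have h1 := norm_arctan_le h
  have h2 := norm_tan_sub_le (s := Complex.arctan τ) (by linarith)
  rw [tan_arctan_of_norm_le h, norm_sub_rev] at h2
  have h3 : ‖Complex.arctan τ‖ ^ 3 ≤ (2 * ‖τ‖) ^ 3 := by gcongr
  nlinarith

theorem norm_sin_cos_le_two {φ : ℂ} (h : |φ.im| ≤ 1 / 2) :
    ‖Complex.sin φ‖ ≤ 2 ∧ ‖Complex.cos φ‖ ≤ 2 := by
  have hexp : ∀ x : ℝ, |x| ≤ 1 / 2 → Real.exp x ≤ 2 := fun x hx => by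
    have := (abs_le.1 (Real.abs_exp_sub_one_le (x := x) (by linarith))).2
    linarith
  have h1 : ‖Complex.exp (φ * Complex.I)‖ ≤ 2 := by
    rw [Complex.norm_exp]
    exact hexp _ (by simpa using h)
  have h2 : ‖Complex.exp (-φ * Complex.I)‖ ≤ 2 := by
    rw [Complex.norm_exp]
    exact hexp _ (by simpa using h)
  constructor
  · rw [Complex.sin, norm_div, norm_mul, Complex.norm_I, Complex.norm_ofNat]
    linarith [norm_sub_le (Complex.exp (-φ * Complex.I)) (Complex.exp (φ * Complex.I))]
  · rw [Complex.cos, norm_div, Complex.norm_ofNat]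
    linarith [norm_add_le (Complex.exp (φ * Complex.I)) (Complex.exp (-φ * Complex.I))]

/-- Here Re cos φ = cos(Re φ) cosh(Im φ), with cosh ≥ 1, and Jordan's inequality bounds the sine of
the distance to ±π/2. -/
theorem re_cos_ge {φ : ℂ} {d : ℝ} (hd : 0 ≤ d) (h : |φ.re| ≤ Real.pi / 2 - d) :
    2 / Real.pi * d ≤ (Complex.cos φ).re := by
  have hpi := Real.pi_pos
  have h1 : 2 / Real.pi * d ≤ Real.cos φ.re := by
    have h2 := Real.mul_le_sin hd (by linarith [abs_nonneg φ.re])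
    have h3 : Real.cos (Real.pi / 2 - d) ≤ Real.cos |φ.re| :=
      Real.cos_le_cos_of_nonneg_of_le_pi (abs_nonneg _) (by linarith) h
    rw [Real.cos_pi_div_two_sub, Real.cos_abs] at h3
    exact h2.trans h3
  have h4 : (Complex.cos φ).re = Real.cos φ.re * Real.cosh φ.im := by
    rw [Complex.cos_eq φ]
    simp only [← Complex.ofReal_cos, ← Complex.ofReal_sin, ← Complex.ofReal_cosh,
      ← Complex.ofReal_sinh, Complex.sub_re, Complex.mul_re, Complex.ofReal_re, Complex.ofReal_im,
      Complex.I_re, Complex.I_im, Complex.mul_im]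
    ring
  rw [h4]
  have h5 := Real.one_le_cosh φ.im
  have h6 : 0 ≤ Real.cos φ.re := le_trans (by positivity) h1
  nlinarith

/-! ### One step in the angular coordinate -/

/-- The approximate time coordinate of the perturbed map in terms of `φ`, where `z = ε tan φ`. -/
noncomputable def omegaTransit (ε : ℝ) (b φ : ℂ) : ℂ := φ / ε - b * Complex.log (Complex.cos φ)

section
variable {ε : ℝ} {z ϱ φ : ℂ} (hε0 : 0 < ε) (hε : ε ≤ 1 / 1024) (hz : ‖z‖ ≤ 1 / 64)
  (hϱ : ‖ϱ‖ ≤ 1 / 64)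
include hz hϱ

theorem transit_factor_bounds : ‖1 + ϱ‖ ≤ 65 / 64 ∧ ‖z * (1 + ϱ)‖ ≤ 1 / 60 ∧
    59 / 60 ≤ ‖1 + z * (1 + ϱ)‖ := by
  have h1 : ‖1 + ϱ‖ ≤ 65 / 64 := by
    refine (norm_add_le _ _).trans ?_
    rw [norm_one]; linarith
  have h2 : ‖z * (1 + ϱ)‖ ≤ 1 / 60 := by
    rw [norm_mul]
    nlinarith [norm_nonneg z, norm_nonneg (1 + ϱ)]
  refine ⟨h1, h2, ?_⟩
  have := norm_sub_norm_le (1 : ℂ) (-(z * (1 + ϱ)))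
  rw [norm_neg, norm_one, sub_neg_eq_add] at this
  linarith

theorem transit_quotient_expansion :
    ‖(1 + ϱ) / (1 + z * (1 + ϱ)) - 1 - ϱ + z‖ ≤ 8 * (‖z‖ ^ 2 + ‖z‖ * ‖ϱ‖) := by
  obtain ⟨h1, h2, h3⟩ := transit_factor_bounds hz hϱ
  have hne : 1 + z * (1 + ϱ) ≠ 0 := norm_pos_iff.1 (by linarith)
  have e : (1 + ϱ) / (1 + z * (1 + ϱ)) - 1 - ϱ + z =
      z * (z * (1 + ϱ) - 2 * ϱ - ϱ ^ 2) / (1 + z * (1 + ϱ)) := by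
    rw [eq_div_iff hne]
    linear_combination div_mul_cancel₀ (1 + ϱ) hne
  have h4 : ‖z * (1 + ϱ) - 2 * ϱ - ϱ ^ 2‖ ≤ 2 * ‖z‖ + 3 * ‖ϱ‖ := by
    refine (norm_sub_le _ _).trans ((add_le_add_left (norm_sub_le _ _) _).trans ?_)
    rw [norm_mul, norm_mul, norm_pow, Complex.norm_ofNat]
    nlinarith [norm_nonneg z, norm_nonneg ϱ]
  rw [e, norm_div, norm_mul, div_le_iff₀ (by linarith)]
  have h5 : ‖z‖ * ‖z * (1 + ϱ) - 2 * ϱ - ϱ ^ 2‖ ≤ ‖z‖ * (2 * ‖z‖ + 3 * ‖ϱ‖) := by gcongr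
  have h6 : 0 ≤ ‖z‖ * ‖ϱ‖ := by positivity
  nlinarith [sq_nonneg ‖z‖]

include hε0 hε

/-- Take h = arctan τ with τ = ε(1 + ϱ)/(1 + z(1 + ϱ)). The addition theorem then gives ε tan(φ + h)
= z + (z² + ε²)(1 + ϱ) exactly. The relation z = ε tan φ is kept free of division. -/
theorem exists_transit_step (hcos : Complex.cos φ ≠ 0)
    (hφ : z * Complex.cos φ = ε * Complex.sin φ) :
    ∃ h : ℂ, ‖h‖ ≤ 4 * ε ∧
      ‖h / ε - (1 + ϱ) / (1 + z * (1 + ϱ))‖ ≤ 2 * ε ∧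
      Complex.cos (φ + h) = Complex.cos φ * (Complex.cos h / (1 + z * (1 + ϱ))) ∧
      (z + (z ^ 2 + ε ^ 2) * (1 + ϱ)) * Complex.cos (φ + h) = ε * Complex.sin (φ + h) := by
  obtain ⟨h1, h2, h3⟩ := transit_factor_bounds hz hϱ
  have hne : 1 + z * (1 + ϱ) ≠ 0 := norm_pos_iff.1 (by linarith)
  have hε' : (ε : ℂ) ≠ 0 := by exact_mod_cast hε0.ne'
  set τ : ℂ := ε * ((1 + ϱ) / (1 + z * (1 + ϱ))) with hτ
  have hτn : ‖τ‖ ≤ 21 / 20 * ε := by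
    have hv : ‖1 + ϱ‖ / ‖1 + z * (1 + ϱ)‖ ≤ 21 / 20 := by
      rw [div_le_iff₀ (by linarith)]
      linarith
    rw [hτ, norm_mul, norm_div, Complex.norm_real, Real.norm_of_nonneg hε0.le, mul_comm]
    exact mul_le_mul_of_nonneg_right hv hε0.le
  have hτ8 : ‖τ‖ ≤ 1 / 8 := by linarith
  have hn := norm_arctan_le hτ8
  have ht := tan_arctan_of_norm_le hτ8
  have hs := norm_sub_arctan_le hτ8
  set h := Complex.arctan τ
  have hc : Complex.cos h ≠ 0 := cos_ne_zero_of_norm_le (by linarith)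
  have hsin : Complex.sin h = τ * Complex.cos h := by
    rw [← ht, Complex.tan, div_mul_cancel₀ _ hc]
  have hsφ : Complex.sin φ = z * Complex.cos φ / ε := by
    rw [eq_div_iff hε', hφ]; ring
  have hcos' : Complex.cos (φ + h) = Complex.cos φ * (Complex.cos h / (1 + z * (1 + ϱ))) := by
    rw [Complex.cos_add, hsin, hsφ, hτ]
    field_simp
    ring
  refine ⟨h, by linarith, ?_, hcos', ?_⟩
  · have e : h / ε - (1 + ϱ) / (1 + z * (1 + ϱ)) = (h - τ) / ε := by
      rw [hτ]; field_simp
    rw [e, norm_div, Complex.norm_real, Real.norm_of_nonneg hε0.le, div_le_iff₀ hε0]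
    have h5 : ‖τ‖ ^ 3 ≤ (21 / 20 * ε) ^ 3 := by gcongr
    have h6 : ε ^ 3 ≤ ε ^ 2 * (1 / 1024) := by
      rw [pow_succ]; gcongr
    nlinarith [sq_nonneg ε]
  · rw [hcos', Complex.sin_add, hsin, hsφ, hτ]
    field_simp
    ring

theorem transit_log_expansion {h : ℂ} (hh : ‖h‖ ≤ 4 * ε) :
    ‖Complex.cos h / (1 + z * (1 + ϱ)) - 1‖ ≤ 1 / 4 ∧
    ‖Complex.log (Complex.cos h / (1 + z * (1 + ϱ))) + z‖ ≤ 60 * (‖z‖ ^ 2 + ‖z‖ * ‖ϱ‖ + ε) := by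
  obtain ⟨h1, h2, h3⟩ := transit_factor_bounds hz hϱ
  have hne : 1 + z * (1 + ϱ) ≠ 0 := norm_pos_iff.1 (by linarith)
  set c := Complex.cos h / (1 + z * (1 + ϱ)) with hc
  have hzϱ : 0 ≤ ‖z‖ * ‖ϱ‖ := by positivity
  have hcosh := norm_cos_sub_one_le (s := h) (by linarith)
  have e : c - 1 + z = (Complex.cos h - 1 - z * ϱ + z ^ 2 * (1 + ϱ)) / (1 + z * (1 + ϱ)) := by
    rw [hc]
    field_simp
    ring
  have h4 : ‖c - 1 + z‖ ≤ 10 * ε + 2 * (‖z‖ * ‖ϱ‖) + 2 * ‖z‖ ^ 2 := by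
    rw [e, norm_div, div_le_iff₀ (by linarith)]
    have h5 : ‖Complex.cos h - 1 - z * ϱ + z ^ 2 * (1 + ϱ)‖ ≤
        8 * ε + ‖z‖ * ‖ϱ‖ + ‖z‖ ^ 2 * (65 / 64) := by
      refine (norm_add_le _ _).trans (add_le_add ((norm_sub_le _ _).trans (add_le_add ?_ ?_)) ?_)
      · linarith
      · rw [norm_mul]
      · rw [norm_mul, norm_pow]; gcongr
    nlinarith [sq_nonneg ‖z‖]
  have hz2 : ‖z‖ ^ 2 ≤ ‖z‖ * (1 / 64) := by rw [sq]; gcongr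
  have hzϱ' : ‖z‖ * ‖ϱ‖ ≤ ‖z‖ * (1 / 64) := by gcongr
  have h5 : ‖c - 1‖ ≤ 2 * ‖z‖ + 10 * ε := by
    have : c - 1 = (c - 1 + z) - z := by ring
    rw [this]
    refine (norm_sub_le _ _).trans ?_
    linarith [norm_nonneg z]
  have h6 : ‖c - 1‖ ≤ 1 / 4 := by linarith
  refine ⟨h6, ?_⟩
  have h7 := Complex.norm_log_one_add_sub_self_le (z := c - 1) (by linarith)
  rw [add_sub_cancel] at h7
  have h8 : ‖Complex.log c - (c - 1)‖ ≤ ‖c - 1‖ ^ 2 := by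
    refine h7.trans ?_
    have : (1 - ‖c - 1‖)⁻¹ ≤ 2 := by
      rw [inv_le_comm₀ (by linarith) (by norm_num)]
      linarith
    nlinarith [sq_nonneg ‖c - 1‖]
  have h9 : ‖c - 1‖ ^ 2 ≤ (2 * ‖z‖ + 10 * ε) ^ 2 := by gcongr
  have e2 : Complex.log c + z = (Complex.log c - (c - 1)) + (c - 1 + z) := by ring
  rw [e2]
  refine (norm_add_le _ _).trans ?_
  nlinarith [norm_nonneg z]

/-- The quotient φ/ε advances by about 1 + ϱ - z, and log cos φ changes by about -z. For ϱ ≈ a₃z and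
b = 1 - a₃ the leftover ϱ - (1 - b)z has no linear part. -/
theorem omegaTransit_step {b : ℂ} (hcos0 : Complex.cos φ ≠ 0) (hcos : 0 ≤ (Complex.cos φ).re)
    {h : ℂ} (hh : ‖h‖ ≤ 4 * ε)
    (hhε : ‖h / ε - (1 + ϱ) / (1 + z * (1 + ϱ))‖ ≤ 2 * ε)
    (hc : Complex.cos (φ + h) = Complex.cos φ * (Complex.cos h / (1 + z * (1 + ϱ)))) :
    ‖omegaTransit ε b (φ + h) - omegaTransit ε b φ - 1 - (ϱ - (1 - b) * z)‖ ≤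
      60 * (1 + ‖b‖) * (‖z‖ ^ 2 + ‖z‖ * ‖ϱ‖ + ε) := by
  obtain ⟨h1, h2⟩ := transit_log_expansion hε0 hε hz hϱ hh
  have h3 := transit_quotient_expansion hz hϱ
  have h4 := log_mul_of_near_one hcos0 (by linarith [norm_nonneg (Complex.cos φ)]) h1
  set c := Complex.cos h / (1 + z * (1 + ϱ))
  set A := (1 + ϱ) / (1 + z * (1 + ϱ))
  have e : omegaTransit ε b (φ + h) - omegaTransit ε b φ - 1 - (ϱ - (1 - b) * z) =
      (h / ε - A) + (A - 1 - ϱ + z) - b * (Complex.log c + z) := by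
    rw [omegaTransit, omegaTransit, hc, h4]
    ring
  rw [e]
  have h5 : ‖b * (Complex.log c + z)‖ ≤ ‖b‖ * (60 * (‖z‖ ^ 2 + ‖z‖ * ‖ϱ‖ + ε)) := by
    rw [norm_mul]; gcongr
  refine (norm_sub_le _ _).trans ((add_le_add ((norm_add_le _ _).trans
    (add_le_add hhε h3)) h5).trans ?_)
  have h6 : 0 ≤ ‖z‖ * ‖ϱ‖ := by positivity
  nlinarith [sq_nonneg ‖z‖]

end

/-! ### Passage through the gate: bounds in the angular coordinate -/

section
variable {ε n k D c : ℝ} {z φ : ℂ} (hε0 : 0 < ε) (hεn : ε * n = Real.pi / 2) (hk : 6 ≤ k)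
  (hεk : ε * k ≤ 1) (hD : k ≤ D) (hc : |c| ≤ n + 1 - D)
  (hφ : ‖φ - ((ε * c : ℝ) : ℂ)‖ ≤ ε * k / 2)
include hε0 hεn hk hεk hD hc hφ

/-- `c` is the nominal angle in units of ε and `D` is, up to one, at most the number of steps to the
nearer pole of tan. The deviation εk/2 uses up at most half of εD, so Re φ keeps the distance εD/3
from ±π/2. -/
theorem angular_bounds : ‖Complex.sin φ‖ ≤ 2 ∧ ‖Complex.cos φ‖ ≤ 2 ∧
    ε * D / 5 ≤ (Complex.cos φ).re := by
  have him : |φ.im| ≤ 1 / 2 := by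
    have h := (Complex.abs_im_le_norm _).trans hφ
    rw [Complex.sub_im, Complex.ofReal_im, sub_zero] at h
    linarith
  have hre : |φ.re| ≤ Real.pi / 2 - ε * D / 3 := by
    have h := (Complex.abs_re_le_norm _).trans hφ
    rw [Complex.sub_re, Complex.ofReal_re] at h
    have h1 : |ε * c| ≤ ε * (n + 1 - D) := by
      rw [abs_mul, abs_of_pos hε0]; gcongr
    have h2 : |φ.re| ≤ |φ.re - ε * c| + |ε * c| := by
      have := abs_add_le (φ.re - ε * c) (ε * c)
      rwa [sub_add_cancel] at this
    have h3 : ε * (1 + k / 2 + D / 3) ≤ ε * D := by gcongr; linarith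
    nlinarith
  obtain ⟨h1, h2⟩ := norm_sin_cos_le_two him
  have hD0 : 0 < D := by linarith
  have h3 := re_cos_ge (φ := φ) (d := ε * D / 3) (by positivity) hre
  refine ⟨h1, h2, le_trans ?_ h3⟩
  have h4 : 3 / 5 ≤ 2 / Real.pi := by
    rw [le_div_iff₀ Real.pi_pos]
    linarith [Real.pi_lt_d2]
  have h5 : 3 / 5 * (ε * D / 3) ≤ 2 / Real.pi * (ε * D / 3) := by gcongr
  linarith

theorem angular_norm_le (hz : z * Complex.cos φ = ε * Complex.sin φ) : ‖z‖ * D ≤ 10 := by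
  obtain ⟨h1, h2, h3⟩ := angular_bounds hε0 hεn hk hεk hD hc hφ
  have h4 : ‖z‖ * ‖Complex.cos φ‖ = ε * ‖Complex.sin φ‖ := by
    rw [← norm_mul, hz, norm_mul, Complex.norm_real, Real.norm_of_nonneg hε0.le]
  have h5 := h3.trans ((le_abs_self _).trans (Complex.abs_re_le_norm _))
  have h6 : ‖z‖ * (ε * D / 5) ≤ ε * 2 := by
    calc ‖z‖ * (ε * D / 5) ≤ ‖z‖ * ‖Complex.cos φ‖ := by gcongr
      _ = ε * ‖Complex.sin φ‖ := h4
      _ ≤ ε * 2 := by gcongr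
  have h7 : ε * (‖z‖ * D) ≤ ε * 10 := by linarith
  exact le_of_mul_le_mul_left h7 hε0

theorem norm_log_cos_le (hn : 1 ≤ n) : ‖Complex.log (Complex.cos φ)‖ ≤ Real.log n + 5 := by
  obtain ⟨h1, h2, h3⟩ := angular_bounds hε0 hεn hk hεk hD hc hφ
  have h5 := h3.trans ((le_abs_self _).trans (Complex.abs_re_le_norm _))
  have h6 : 1 / n ≤ ‖Complex.cos φ‖ := by
    refine le_trans ?_ h5
    rw [div_le_iff₀ (by linarith)]
    have : Real.pi / 2 * 6 ≤ ε * n * D := by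
      rw [hεn]
      gcongr
      linarith
    linarith [Real.pi_gt_three]
  have hn0 : (0 : ℝ) < 1 / n := by positivity
  have h7 := Real.log_le_log hn0 h6
  have h8 := Real.log_le_log (hn0.trans_le h6) h2
  have h9 := Real.log_nonneg hn
  rw [one_div, Real.log_inv] at h7
  have h10 : Real.log 2 ≤ 1 := by linarith [Real.log_two_lt_d9]
  refine (norm_log_le _).trans ?_
  have : |Real.log ‖Complex.cos φ‖| ≤ Real.log n + 1 := abs_le.2 ⟨by linarith, by linarith⟩
  linarith [Real.pi_le_four]

end

/-- The constant in the expansion of one step of the perturbed map in the angular coordinate. -/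
noncomputable def transitConst (a₃ : ℂ) (K E : ℝ) : ℝ :=
  60 * (2 + ‖a₃‖) * (3 + ‖a₃‖ + 2 * (4 * K + 4 * E + 8 * ‖a₃‖))

theorem transitConst_ge {a₃ : ℂ} {K E : ℝ} (hK : 1 ≤ K) (hE : 0 ≤ E) :
    60 ≤ transitConst a₃ K E ∧
      ‖a₃‖ + (4 * K + 4 * E + 8 * ‖a₃‖) ≤ transitConst a₃ K E := by
  have h0 := norm_nonneg a₃
  have h1 : 0 ≤ ‖a₃‖ * (3 + ‖a₃‖ + 2 * (4 * K + 4 * E + 8 * ‖a₃‖)) := by positivity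
  rw [transitConst]
  constructor <;> nlinarith

section
variable {T : ℂ × ℂ → ℂ × ℂ} {a₃ : ℂ} {ρ K E ε n : ℝ} (hT : LocalForm T a₃ ρ K) (hE : 0 ≤ E)
  (hε0 : 0 < ε) (hn : 1 ≤ n) (hεn : ε * n = Real.pi / 2) {z x z' φ : ℂ}
  (hz : ‖z‖ ≤ ρ) (hx : ‖x‖ ≤ ρ)
  (hsin : ‖Complex.sin φ‖ ≤ 2) (hcos2 : ‖Complex.cos φ‖ ≤ 2)
  (hφ : z * Complex.cos φ = ε * Complex.sin φ)
  (hstep : ‖z' - (T (z, x)).1 - (ε : ℂ) ^ 2‖ ≤ E * ε ^ 2 * (1 / n + ‖x‖ + ‖z‖ ^ 2))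
include hT hE hε0 hn hεn hz hx hsin hcos2 hφ hstep

/-- Because z² + ε² = ε²/cos²φ, division by it is multiplication by cos²φ/ε². Combined with |z cos
φ| ≤ 2ε this turns the remainder K|z|⁴ into O(|z|²). The cubic term gives a₃z - a₃ε sin φ cos φ, and
ε = O(1/n). -/
theorem LocalForm.exists_transit_ratio :
    ∃ ϱ : ℂ, z' = z + (z ^ 2 + (ε : ℂ) ^ 2) * (1 + ϱ) ∧
      ‖ϱ - a₃ * z‖ ≤ (4 * K + 4 * E + 8 * ‖a₃‖) * (‖z‖ ^ 2 + ‖x‖ + 1 / n) := by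
  have hK := hT.one_le
  have ha := norm_nonneg a₃
  have hε2 : ε ≤ 2 * (1 / n) := by
    rw [mul_one_div, le_div_iff₀ (by linarith), hεn]
    linarith [Real.pi_le_four]
  have hn0 : 0 < 1 / n := by positivity
  generalize 1 / n = ν at *
  have hε' : (ε : ℂ) ≠ 0 := by exact_mod_cast hε0.ne'
  have hq : (z ^ 2 + (ε : ℂ) ^ 2) * Complex.cos φ ^ 2 = (ε : ℂ) ^ 2 := by
    linear_combination (z * Complex.cos φ + ε * Complex.sin φ) * hφ +
      (ε : ℂ) ^ 2 * Complex.sin_sq_add_cos_sq φ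
  have hq0 : z ^ 2 + (ε : ℂ) ^ 2 ≠ 0 := by
    intro h
    rw [h, zero_mul] at hq
    exact pow_ne_zero 2 hε' hq.symm
  set r := z' - (z + z ^ 2 + a₃ * z ^ 3) - (ε : ℂ) ^ 2 with hr
  have hrn : ‖r‖ ≤ K * ‖z‖ ^ 4 + E * ε ^ 2 * (ν + ‖x‖ + ‖z‖ ^ 2) := by
    have e : r = ((T (z, x)).1 - (z + z ^ 2 + a₃ * z ^ 3)) +
      (z' - (T (z, x)).1 - (ε : ℂ) ^ 2) := by rw [hr]; ring
    rw [e]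
    exact (norm_add_le _ _).trans (add_le_add (hT.fst z x hz hx) hstep)
  refine ⟨(z' - z - z ^ 2 - (ε : ℂ) ^ 2) / (z ^ 2 + (ε : ℂ) ^ 2), by field_simp; ring, ?_⟩
  have hdiff : (z' - z - z ^ 2 - (ε : ℂ) ^ 2) / (z ^ 2 + (ε : ℂ) ^ 2) - a₃ * z =
      r * Complex.cos φ ^ 2 / (ε : ℂ) ^ 2 - a₃ * (ε * Complex.sin φ * Complex.cos φ) := by
    have e1 : (z' - z - z ^ 2 - (ε : ℂ) ^ 2) / (z ^ 2 + (ε : ℂ) ^ 2) - a₃ * z =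
        (r - a₃ * z * (ε : ℂ) ^ 2) / (z ^ 2 + (ε : ℂ) ^ 2) := by
      rw [hr]; field_simp; ring
    rw [e1, div_eq_iff hq0, ← hφ, ← mul_right_inj' (pow_ne_zero 2 hε')]
    field_simp
    linear_combination (-(r - a₃ * z * (ε : ℂ) ^ 2)) * hq
  have hzc : ‖z‖ ^ 2 * ‖Complex.cos φ‖ ^ 2 ≤ 4 * ε ^ 2 := by
    have h4 : ‖z‖ * ‖Complex.cos φ‖ = ε * ‖Complex.sin φ‖ := by
      rw [← norm_mul, hφ, norm_mul, Complex.norm_real, Real.norm_of_nonneg hε0.le]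
    calc ‖z‖ ^ 2 * ‖Complex.cos φ‖ ^ 2 = (‖z‖ * ‖Complex.cos φ‖) ^ 2 := by ring
      _ = (ε * ‖Complex.sin φ‖) ^ 2 := by rw [h4]
      _ ≤ (ε * 2) ^ 2 := by gcongr
      _ = 4 * ε ^ 2 := by ring
  have h1 : ‖r * Complex.cos φ ^ 2 / (ε : ℂ) ^ 2‖ ≤
      4 * K * ‖z‖ ^ 2 + 4 * E * (ν + ‖x‖ + ‖z‖ ^ 2) := by
    rw [norm_div, norm_mul, norm_pow, norm_pow, Complex.norm_real, Real.norm_of_nonneg hε0.le,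
      div_le_iff₀ (by positivity)]
    have h2 : ‖Complex.cos φ‖ ^ 2 ≤ 2 ^ 2 := by gcongr
    calc ‖r‖ * ‖Complex.cos φ‖ ^ 2 ≤
        (K * ‖z‖ ^ 4 + E * ε ^ 2 * (ν + ‖x‖ + ‖z‖ ^ 2)) * ‖Complex.cos φ‖ ^ 2 := by gcongr
      _ = K * ‖z‖ ^ 2 * (‖z‖ ^ 2 * ‖Complex.cos φ‖ ^ 2) +
          E * ε ^ 2 * (ν + ‖x‖ + ‖z‖ ^ 2) * ‖Complex.cos φ‖ ^ 2 := by ring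
      _ ≤ K * ‖z‖ ^ 2 * (4 * ε ^ 2) + E * ε ^ 2 * (ν + ‖x‖ + ‖z‖ ^ 2) * 2 ^ 2 := by
          gcongr
      _ = _ := by ring
  have h3 : ‖a₃ * (ε * Complex.sin φ * Complex.cos φ)‖ ≤ ‖a₃‖ * (ε * 2 * 2) := by
    rw [norm_mul, norm_mul, norm_mul, Complex.norm_real, Real.norm_of_nonneg hε0.le]
    gcongr
  rw [hdiff]
  refine (norm_sub_le _ _).trans ((add_le_add h1 h3).trans ?_)
  have h5 : ‖a₃‖ * (ε * 2 * 2) ≤ ‖a₃‖ * (2 * ν * 2 * 2) := by gcongr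
  have h6 : 0 ≤ K * (‖x‖ + ν) := by positivity
  have h7 : 0 ≤ ‖a₃‖ * (‖z‖ ^ 2 + ‖x‖) := by positivity
  linarith

theorem LocalForm.transit_step (hε : ε ≤ 1 / 1024)
    (hsmall : transitConst a₃ K E * (‖z‖ + ‖x‖ + 1 / n) ≤ 1 / 64)
    (hcos : 0 < (Complex.cos φ).re) :
    ∃ h : ℂ, ‖h‖ ≤ 4 * ε ∧ z' * Complex.cos (φ + h) = ε * Complex.sin (φ + h) ∧
      ‖omegaTransit ε (1 - a₃) (φ + h) - omegaTransit ε (1 - a₃) φ - 1‖ ≤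
        transitConst a₃ K E * (‖z‖ ^ 2 + ‖x‖ + 1 / n) := by
  have hK := hT.one_le
  obtain ⟨ϱ, hz', hdn⟩ := hT.exists_transit_ratio hE hε0 hn hεn hz hx hsin hcos2 hφ hstep
  obtain ⟨hA60, hA⟩ := transitConst_ge (a₃ := a₃) hK hE
  have ha := norm_nonneg a₃
  have hn0 : 0 < 1 / n := by positivity
  have hε2 : ε ≤ 2 * (1 / n) := by
    rw [mul_one_div, le_div_iff₀ (by linarith), hεn]
    linarith [Real.pi_le_four]
  clear hstep
  generalize 1 / n = ν at *
  have hz1 : ‖z‖ ≤ 1 / 64 := by nlinarith [norm_nonneg z, norm_nonneg x]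
  have hz2 : ‖z‖ ^ 2 ≤ ‖z‖ := by nlinarith [norm_nonneg z]
  have hc0 : Complex.cos φ ≠ 0 := by
    intro h; rw [h] at hcos; simp at hcos
  have hL0 : 0 ≤ ‖z‖ ^ 2 + ‖x‖ + ν := by positivity
  have hLs : ‖z‖ ^ 2 + ‖x‖ + ν ≤ ‖z‖ + ‖x‖ + ν := by linarith
  have hzL : ‖z‖ ^ 2 ≤ ‖z‖ ^ 2 + ‖x‖ + ν := by linarith [norm_nonneg x]
  have hνL : ‖z‖ ^ 2 + 2 * ν ≤ 2 * (‖z‖ ^ 2 + ‖x‖ + ν) := by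
    linarith [norm_nonneg x, sq_nonneg ‖z‖]
  have hQ0 : 0 ≤ 4 * K + 4 * E + 8 * ‖a₃‖ := by positivity
  have hconst : transitConst a₃ K E =
    60 * (2 + ‖a₃‖) * (3 + ‖a₃‖ + 2 * (4 * K + 4 * E + 8 * ‖a₃‖)) := rfl
  generalize 4 * K + 4 * E + 8 * ‖a₃‖ = Q at *
  generalize transitConst a₃ K E = A at *
  generalize hL : ‖z‖ ^ 2 + ‖x‖ + ν = L at *
  have hϱn : ‖ϱ‖ ≤ ‖a₃‖ * ‖z‖ + Q * L := by
    have e : ϱ = a₃ * z + (ϱ - a₃ * z) := by ring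
    rw [e]
    refine (norm_add_le _ _).trans (add_le_add (norm_mul _ _).le hdn)
  have hϱ1 : ‖ϱ‖ ≤ 1 / 64 := by
    refine hϱn.trans (le_trans ?_ hsmall)
    have h1 : Q * L ≤ Q * (‖z‖ + ‖x‖ + ν) := by gcongr
    have h2 : ‖a₃‖ * ‖z‖ ≤ ‖a₃‖ * (‖z‖ + ‖x‖ + ν) := by
      gcongr
      linarith [norm_nonneg x]
    have h3 : (‖a₃‖ + Q) * (‖z‖ + ‖x‖ + ν) ≤ A * (‖z‖ + ‖x‖ + ν) := by gcongr
    linarith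
  obtain ⟨h, hh, hhε, hc, hnext⟩ := exists_transit_step hε0 hε hz1 hϱ1 hc0 hφ
  rw [← hz'] at hnext
  refine ⟨h, hh, hnext, ?_⟩
  have h1 := omegaTransit_step (b := 1 - a₃) hε0 hε hz1 hϱ1 hc0 hcos.le hh hhε hc
  rw [sub_sub_cancel] at h1
  have hb : ‖1 - a₃‖ ≤ 1 + ‖a₃‖ := by simpa using norm_sub_le (1 : ℂ) a₃
  generalize omegaTransit ε (1 - a₃) (φ + h) - omegaTransit ε (1 - a₃) φ - 1 = Δ at *
  have e : Δ = (Δ - (ϱ - a₃ * z)) + (ϱ - a₃ * z) := by ring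
  have hQL : 0 ≤ Q * L := by positivity
  have h2 : ‖z‖ * ‖ϱ‖ ≤ ‖a₃‖ * L + Q * L := by
    have h3 : ‖z‖ * ‖ϱ‖ ≤ ‖z‖ * (‖a₃‖ * ‖z‖ + Q * L) := by gcongr
    have h4 : ‖z‖ * (Q * L) ≤ 1 * (Q * L) := by gcongr; linarith
    have h6 : ‖a₃‖ * ‖z‖ ^ 2 ≤ ‖a₃‖ * L := by gcongr
    linarith
  have h7 : ‖z‖ ^ 2 + ‖z‖ * ‖ϱ‖ + ε ≤ (2 + ‖a₃‖ + Q) * L := by linarith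
  rw [e]
  refine (norm_add_le _ _).trans ((add_le_add h1 hdn).trans ?_)
  have h8 : 60 * (1 + ‖1 - a₃‖) * (‖z‖ ^ 2 + ‖z‖ * ‖ϱ‖ + ε) ≤
      60 * (1 + (1 + ‖a₃‖)) * ((2 + ‖a₃‖ + Q) * L) := by gcongr
  refine (add_le_add_left h8 _).trans ?_
  have h9 : 0 ≤ ‖a₃‖ * (Q * L) := by positivity
  have h11 : 0 ≤ ‖a₃‖ * L := by positivity
  rw [hconst]
  linarith

end

/-! ### Passage through the gate: orbits -/

/-- A potential that dominates the sum of the squares of the first coordinates along an orbit of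
`N` steps that starts and ends at distance `1 / k` from the origin. -/
noncomputable def transitPotential (k N j : ℝ) : ℝ :=
  1 / (k - 1) - 1 / (k + j - 1) + 1 / (k + N - j)

theorem one_div_sq_le {u : ℝ} (hu : 2 ≤ u) : 1 / u ^ 2 ≤ 1 / (u - 1) - 1 / u := by
  rw [div_sub_div _ _ (by linarith) (by linarith), div_le_div_iff₀ (by positivity)
    (mul_pos (by linarith) (by linarith))]
  nlinarith

/-- Each end of the gate contributes a telescoping sum, by 1/u² ≤ 1/(u - 1) - 1/u. -/
theorem transitPotential_step {k N j : ℝ} (hk : 2 ≤ k) (hj0 : 0 ≤ j) (hj : j + 1 ≤ N) :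
    1 / min (k + j) (k + N - j) ^ 2 + transitPotential k N j ≤ transitPotential k N (j + 1) := by
  have h1 := one_div_sq_le (u := k + j) (by linarith)
  have h2 := one_div_sq_le (u := k + N - j) (by linarith)
  have e1 : k + (j + 1) - 1 = k + j := by ring
  have e2 : k + N - (j + 1) = k + N - j - 1 := by ring
  have h3 : 1 / min (k + j) (k + N - j) ^ 2 ≤ 1 / (k + j) ^ 2 + 1 / (k + N - j) ^ 2 := by
    have p1 : 0 ≤ 1 / (k + j) ^ 2 := by positivity
    have p2 : 0 ≤ 1 / (k + N - j) ^ 2 := by positivity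
    rcases min_choice (k + j) (k + N - j) with h | h <;> rw [h] <;> linarith
  rw [transitPotential, transitPotential, e1, e2]
  linarith

theorem transitPotential_zero_nonneg {k N : ℝ} (hk : 2 ≤ k) (hN : 0 ≤ N) :
    0 ≤ transitPotential k N 0 := by
  rw [transitPotential, add_zero, sub_self, zero_add, sub_zero]
  positivity

theorem transitPotential_le_one {k N j : ℝ} (hk : 4 ≤ k) (hj0 : 0 ≤ j) (hj : j ≤ N) :
    transitPotential k N j ≤ 1 := by
  have h1 : 1 / (k - 1) ≤ 1 / 2 := one_div_le_one_div_of_le (by norm_num) (by linarith)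
  have h2 : 0 ≤ 1 / (k + j - 1) := one_div_nonneg.2 (by linarith)
  have h3 : 1 / (k + N - j) ≤ 1 / 2 := one_div_le_one_div_of_le (by norm_num) (by linarith)
  rw [transitPotential]
  linarith

/-- A bound for the error of the approximate time coordinate along the passage. -/
noncomputable def transitError (a₃ : ℂ) (K E : ℝ) : ℝ :=
  2 * transitConst a₃ K E + 400 * transitConst a₃ K E * (1 + 2 * K)

/-- Scales on which the passage through the gate is under control. -/
structure TransitScale (a₃ : ℂ) (ρ K E M : ℝ) : Prop where
  nonneg : 0 ≤ E
  small : 128 * transitConst a₃ K E * (11 + 200 * K) ≤ M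
  rho : 2 * (11 + 200 * K) ≤ M * ρ
  error : 8 * (transitError a₃ K E + 10 * (1 + ‖a₃‖)) ≤ M

theorem exists_transitScale (a₃ : ℂ) {ρ K E : ℝ} (hρ : 0 < ρ) (hE : 0 ≤ E) :
    ∃ M, TransitScale a₃ ρ K E M := by
  refine ⟨max (max (128 * transitConst a₃ K E * (11 + 200 * K)) (2 * (11 + 200 * K) / ρ))
    (8 * (transitError a₃ K E + 10 * (1 + ‖a₃‖))), hE, ?_, ?_, le_max_right _ _⟩
  · exact (le_max_left _ _).trans (le_max_left _ _)
  · rw [← div_le_iff₀ hρ]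
    exact (le_max_right _ _).trans (le_max_left _ _)

/-- The relation between the number of a cycle `n`, the waiting time `k` at both ends of the gate
and the number `N` of steps of the passage. -/
structure TransitTimes (M ε : ℝ) (n k N : ℕ) : Prop where
  eps : ε = Real.pi / (2 * n)
  steps : N + 2 * k = 2 * n + 1
  log_le : M * (Real.log n + 1) ≤ k
  cube : k ^ 3 ≤ n ^ 2

section
variable {T : ℂ × ℂ → ℂ × ℂ} {a₃ : ℂ} {ρ K E M ε : ℝ} {n k N : ℕ}
  (hT : LocalForm T a₃ ρ K) (hS : TransitScale a₃ ρ K E M) (hN : TransitTimes M ε n k N)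
include hT hS

theorem TransitScale.large : 1000000 ≤ M := by
  have hK := hT.one_le
  obtain ⟨h1, -⟩ := transitConst_ge (a₃ := a₃) hK hS.nonneg
  refine le_trans ?_ hS.small
  have : 128 * 60 * (11 + 200 * 1) ≤ 128 * transitConst a₃ K E * (11 + 200 * K) := by gcongr
  linarith

include hN

theorem TransitTimes.bounds : 1 ≤ n ∧ M ≤ k ∧ 256 * k ≤ n := by
  have hM := hS.large hT
  have hn : 1 ≤ n := by
    by_contra! h
    have hn0 : n = 0 := by omega
    have h1 := hN.log_le
    have h2 := hN.cube
    rw [hn0] at h1 h2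
    have hk : k = 0 := by simpa using h2
    rw [hk] at h1
    simp at h1
    linarith
  have hlog : 0 ≤ Real.log n := Real.log_nonneg (by exact_mod_cast hn)
  have hk : M ≤ k := le_trans (by nlinarith) hN.log_le
  refine ⟨hn, hk, ?_⟩
  have hk' : 1000000 ≤ k := by exact_mod_cast hM.trans hk
  by_contra! h
  have h1 : n ^ 2 < (256 * k) ^ 2 := Nat.pow_lt_pow_left h (by norm_num)
  have h2 := hN.cube
  have h3 : 1000000 * k ^ 2 ≤ k ^ 3 := by
    rw [pow_succ k 2, mul_comm (k ^ 2) k]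
    exact Nat.mul_le_mul_right _ hk'
  nlinarith

theorem TransitTimes.eps_bounds : 0 < ε ∧ ε * n = Real.pi / 2 ∧ ε ≤ 1 / 1024 ∧
    ε * k ≤ 1 / 160 ∧ ε ^ 2 * (k : ℝ) ^ 3 ≤ 5 / 2 := by
  obtain ⟨hn, hk, hkn⟩ := hN.bounds hT hS
  have hM := hS.large hT
  have hn0 : (0 : ℝ) < n := by exact_mod_cast hn
  have hpi := Real.pi_pos
  have hpi' := Real.pi_lt_d2
  have hε0 : 0 < ε := by rw [hN.eps]; positivity
  have hεn : ε * n = Real.pi / 2 := by rw [hN.eps]; field_simp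
  have hkn' : (256 : ℝ) * k ≤ n := by exact_mod_cast hkn
  have h1 : ε * (256 * k) ≤ ε * n := by gcongr
  have h2 : ε * 1000000 ≤ ε * k := by gcongr; linarith
  refine ⟨hε0, hεn, by linarith, by linarith, ?_⟩
  have h3 : (k : ℝ) ^ 3 ≤ (n : ℝ) ^ 2 := by exact_mod_cast hN.cube
  calc ε ^ 2 * (k : ℝ) ^ 3 ≤ ε ^ 2 * (n : ℝ) ^ 2 := by gcongr
    _ = (ε * n) ^ 2 := by ring
    _ ≤ 5 / 2 := by rw [hεn]; nlinarith

omit hT hS in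
/-- The position of the angular coordinate after `j` steps. -/
theorem TransitTimes.center_bound {j : ℕ} (hj : j ≤ N) :
    (k : ℝ) ≤ min ((k : ℝ) + j) (k + N - j) ∧
    |(j : ℝ) + k - n| ≤ n + 1 - min ((k : ℝ) + j) (k + N - j) := by
  have hj' : (j : ℝ) ≤ N := by exact_mod_cast hj
  have hj0 : (0 : ℝ) ≤ j := j.cast_nonneg
  have hs : (N : ℝ) + 2 * k = 2 * n + 1 := by exact_mod_cast hN.steps
  have h1 := min_le_left ((k : ℝ) + j) (k + N - j)
  have h2 := min_le_right ((k : ℝ) + j) (k + N - j)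
  refine ⟨le_min (by linarith) (by linarith), abs_le.2 ⟨by linarith, by linarith⟩⟩

set_option maxHeartbeats 1000000 in
-- Joint induction on the angle, the time coordinate and the sizes of z and x. The sum of |z_j|² is
-- dominated by `transitPotential`; the term 2A|x| pays for the errors A|x|, because x is halved at
-- each step; the errors of size 1/n add up to N/n ≤ 3. Passing from time back to the angle costs ε
-- times O(log n), and `log_le` makes k so large that the angle stays within εk/4 of its nominal
-- value.
theorem LocalForm.transit_orbit {p : ℕ → ℂ × ℂ} {φ₀ : ℂ}
    (hφ₀ : (p 0).1 * Complex.cos φ₀ = ε * Complex.sin φ₀)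
    (hφ₀' : ‖φ₀ - ((ε * (k - n) : ℝ) : ℂ)‖ ≤ ε * k / 8)
    (hx₀ : M * ‖(p 0).2‖ ≤ 1)
    (hstep : ∀ j < N, ‖(p j).1‖ ≤ ρ → ‖(p j).2‖ ≤ ρ → (p (j + 1)).2 = (T (p j)).2 ∧
      ‖(p (j + 1)).1 - (T (p j)).1 - (ε : ℂ) ^ 2‖ ≤
        E * ε ^ 2 * (1 / n + ‖(p j).2‖ + ‖(p j).1‖ ^ 2)) :
    ∀ j ≤ N, ∃ φ : ℂ, (p j).1 * Complex.cos φ = ε * Complex.sin φ ∧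
      ‖φ - ((ε * (j + k - n) : ℝ) : ℂ)‖ ≤ ε * k / 4 ∧
      ‖omegaTransit ε (1 - a₃) φ - omegaTransit ε (1 - a₃) φ₀ - j‖ +
        2 * transitConst a₃ K E * ‖(p j).2‖ ≤ 2 * transitConst a₃ K E * ‖(p 0).2‖ +
          100 * transitConst a₃ K E * (1 + 2 * K) * (transitPotential k N j + j / n) ∧
      ‖(p j).1‖ ≤ 10 / k ∧ ‖(p j).2‖ ≤ ‖(p 0).2‖ + 200 * K / k ^ 2 := by
  have hK := hT.one_le
  obtain ⟨hA60, -⟩ := transitConst_ge (a₃ := a₃) hK hS.nonneg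
  obtain ⟨hn, hMk, hkn⟩ := hN.bounds hT hS
  obtain ⟨hε0, hεn, hε, hεk, -⟩ := hN.eps_bounds hT hS
  have hM := hS.large hT
  have hkR : (1000000 : ℝ) ≤ k := hM.trans hMk
  have hk0 : (0 : ℝ) < k := by linarith
  have hn1 : (1 : ℝ) ≤ n := by exact_mod_cast hn
  have hkn' : (256 : ℝ) * k ≤ n := by exact_mod_cast hkn
  have hsmall := hS.small
  have hrho := hS.rho
  have herr := hS.error
  rw [transitError] at herr
  have hb : ‖1 - a₃‖ ≤ 1 + ‖a₃‖ := by simpa using norm_sub_le (1 : ℂ) a₃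
  have hlog : 0 ≤ Real.log n := Real.log_nonneg hn1
  have hS' : (N : ℝ) + 2 * k = 2 * n + 1 := by exact_mod_cast hN.steps
  have hM0 : 0 < M := by linarith
  have hinvk : 0 ≤ 1 / (k : ℝ) := by positivity
  have hk2 : 200 * K / (k : ℝ) ^ 2 ≤ 200 * K * (1 / k) := by
    rw [div_eq_mul_one_div]
    gcongr
    nlinarith
  have hinvn : 1 / (n : ℝ) ≤ 1 / k := one_div_le_one_div_of_le hk0 (by linarith)
  have hρk : 2 * (11 + 200 * K) * (1 / (k : ℝ)) ≤ ρ := by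
    rw [mul_one_div, div_le_iff₀ hk0, mul_comm ρ]
    exact hrho.trans (mul_le_mul_of_nonneg_right hMk hT.pos.le)
  have hAk : 128 * transitConst a₃ K E * (11 + 200 * K) * (1 / (k : ℝ)) ≤ 1 := by
    rw [mul_one_div, div_le_one hk0]
    exact hsmall.trans hMk
  have hx1 : 128 * transitConst a₃ K E * ‖(p 0).2‖ ≤ 1 := by
    refine le_trans ?_ hx₀
    gcongr
    refine le_trans ?_ hsmall
    nlinarith
  have hx2 : 2 * ‖(p 0).2‖ ≤ ρ := by
    have : M * (2 * ‖(p 0).2‖) ≤ M * ρ := by nlinarith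
    exact le_of_mul_le_mul_left this hM0
  have hstep' : ∀ (D : ℝ) (z x : ℂ), k ≤ D → ‖z‖ * D ≤ 10 →
      ‖x‖ ≤ ‖(p 0).2‖ + 200 * K / (k : ℝ) ^ 2 →
      ‖z‖ ≤ 10 * (1 / k) ∧ ‖z‖ ^ 2 ≤ 100 * (1 / D ^ 2) ∧ ‖z‖ ≤ ρ ∧ ‖x‖ ≤ ρ ∧
      transitConst a₃ K E * (‖z‖ + ‖x‖ + 1 / n) ≤ 1 / 64 := by
    intro D z x hD hz hx
    have hD0 : 0 < D := by linarith
    have hz1 : ‖z‖ ≤ 10 * (1 / k) := by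
      rw [mul_one_div, le_div_iff₀ hk0]
      exact le_trans (by gcongr) hz
    have hz2 : ‖z‖ ^ 2 ≤ 100 * (1 / D ^ 2) := by
      rw [mul_one_div, le_div_iff₀ (by positivity), ← mul_pow]
      calc (‖z‖ * D) ^ 2 ≤ 10 ^ 2 := by gcongr
        _ = 100 := by norm_num
    have hKk : 0 ≤ K * (1 / (k : ℝ)) := by positivity
    refine ⟨hz1, hz2, by linarith, by linarith, ?_⟩
    have h3 : transitConst a₃ K E * (‖z‖ + ‖x‖ + 1 / n) ≤ transitConst a₃ K E *
        (10 * (1 / k) + (‖(p 0).2‖ + 200 * K * (1 / k)) + 1 / k) := by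
      gcongr
      exact hx.trans (by linarith)
    linarith
  have hbase := fun (j : ℕ) (hj : j ≤ N) => hN.center_bound hj
  have hlogφ₀ : ‖Complex.log (Complex.cos φ₀)‖ ≤ Real.log n + 5 := by
    have h := hbase 0 (Nat.zero_le _)
    rw [Nat.cast_zero, zero_add] at h
    exact norm_log_cos_le hε0 hεn (by linarith) (by linarith) h.1 h.2
      (hφ₀'.trans (by linarith [mul_pos hε0 hk0])) hn1
  have hlogk : M * (Real.log n + 1) ≤ k := hN.log_le
  have hkε := mul_pos hε0 hk0
  intro j
  induction j with
  | zero =>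
    intro _
    refine ⟨φ₀, hφ₀, ?_, ?_, ?_, ?_⟩
    · rw [Nat.cast_zero, zero_add]
      linarith
    · have h := transitPotential_zero_nonneg (k := k) (N := N) (by linarith) N.cast_nonneg
      simp only [sub_self, Nat.cast_zero, norm_zero, zero_add, zero_div, add_zero]
      have : 0 ≤ 100 * transitConst a₃ K E * (1 + 2 * K) * transitPotential k N 0 := by positivity
      linarith
    · obtain ⟨h1, h2⟩ := hbase 0 (Nat.zero_le _)
      rw [Nat.cast_zero] at h1 h2
      have h3 := angular_norm_le hε0 hεn (by linarith) (by linarith) h1 h2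
        (by rw [zero_add]; linarith) hφ₀
      rw [le_div_iff₀ hk0]
      exact le_trans (by gcongr) h3
    · have : 0 ≤ 200 * K / (k : ℝ) ^ 2 := by positivity
      linarith
  | succ j ih =>
    intro hj
    obtain ⟨φ, hφ, hφc, hΩ, -, hx⟩ := ih (by omega)
    obtain ⟨hD, hc⟩ := hbase j (by omega)
    have hφc2 : ‖φ - ((ε * (j + k - n) : ℝ) : ℂ)‖ ≤ ε * k / 2 := by linarith
    obtain ⟨hsin, hcos2, hcos⟩ :=
      angular_bounds hε0 hεn (by linarith) (by linarith) hD hc hφc2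
    have hzD := angular_norm_le hε0 hεn (by linarith) (by linarith) hD hc hφc2 hφ
    obtain ⟨hz1, hz2, hzρ, hxρ, hsm⟩ := hstep' _ _ _ hD hzD hx
    obtain ⟨hsnd, hfst⟩ := hstep j (by omega) hzρ hxρ
    have hD0 : 0 < min ((k : ℝ) + j) (k + N - j) := by linarith
    obtain ⟨h, hh, hφ', hΩ'⟩ := hT.transit_step hS.nonneg hε0 hn1 hεn hzρ hxρ hsin hcos2 hφ hfst hε
      hsm (lt_of_lt_of_le (by positivity) hcos)
    have hxn : ‖(p (j + 1)).2‖ ≤ ‖(p j).2‖ / 2 + K * ‖(p j).1‖ ^ 2 := by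
      rw [hsnd]
      exact hT.snd _ _ hzρ hxρ
    obtain ⟨hD', hc'⟩ := hbase (j + 1) hj
    have hjN : (j : ℝ) + 1 ≤ N := by exact_mod_cast hj
    have hcast : ((j + 1 : ℕ) : ℝ) = j + 1 := by push_cast; ring
    -- A crude one-step bound suffices to estimate log cos(φ + h). The time coordinate then restores
    -- the sharper εk/4 below.
    have hrough : ‖φ + h - ((ε * ((j + 1 : ℕ) + k - n) : ℝ) : ℂ)‖ ≤ ε * k / 2 := by
      have e : φ + h - ((ε * ((j + 1 : ℕ) + k - n) : ℝ) : ℂ) =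
          (φ - ((ε * (j + k - n) : ℝ) : ℂ)) + (h - ε) := by
        push_cast; ring
      have h1 : ‖h - ε‖ ≤ 5 * ε := by
        refine (norm_sub_le _ _).trans ?_
        rw [Complex.norm_real, Real.norm_of_nonneg hε0.le]
        linarith
      have h2 : ε * 20 ≤ ε * k := by gcongr; linarith
      rw [e]
      refine (norm_add_le _ _).trans ?_
      linarith
    have hlogφ' := norm_log_cos_le hε0 hεn (by linarith) (by linarith) hD' hc' hrough hn1
    have hzD' := angular_norm_le hε0 hεn (by linarith) (by linarith) hD' hc' hrough hφ'
    have hpot := transitPotential_step (k := k) (N := N) (j := j) (by linarith) j.cast_nonneg hjN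
    have hpot1 := transitPotential_le_one (k := k) (N := N) (j := ((j + 1 : ℕ) : ℝ)) (by linarith)
      (Nat.cast_nonneg _) (by rw [hcast]; linarith)
    have hΩn : ‖omegaTransit ε (1 - a₃) (φ + h) - omegaTransit ε (1 - a₃) φ₀ - (j + 1 : ℕ)‖ +
        2 * transitConst a₃ K E * ‖(p (j + 1)).2‖ ≤ 2 * transitConst a₃ K E * ‖(p 0).2‖ +
          100 * transitConst a₃ K E * (1 + 2 * K) *
            (transitPotential k N (j + 1 : ℕ) + (j + 1 : ℕ) / n) := by
      have e : omegaTransit ε (1 - a₃) (φ + h) - omegaTransit ε (1 - a₃) φ₀ - (j + 1 : ℕ) =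
          (omegaTransit ε (1 - a₃) (φ + h) - omegaTransit ε (1 - a₃) φ - 1) +
          (omegaTransit ε (1 - a₃) φ - omegaTransit ε (1 - a₃) φ₀ - j) := by
        push_cast; ring
      have h1 := norm_add_le (omegaTransit ε (1 - a₃) (φ + h) - omegaTransit ε (1 - a₃) φ - 1)
        (omegaTransit ε (1 - a₃) φ - omegaTransit ε (1 - a₃) φ₀ - j)
      rw [← e] at h1
      rw [hcast]
      generalize transitConst a₃ K E = A at *
      have hA0 : 0 ≤ A := by linarith
      have h2 : 2 * A * ‖(p (j + 1)).2‖ ≤ 2 * A * (‖(p j).2‖ / 2 + K * ‖(p j).1‖ ^ 2) := by gcongr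
      have h3 : A * (1 + 2 * K) * ‖(p j).1‖ ^ 2 ≤ A * (1 + 2 * K) *
        (100 * (transitPotential k N (j + 1) - transitPotential k N j)) := by
        gcongr
        linarith
      have h4 : A * (1 / n) ≤ A * (1 / n) * (100 * (1 + 2 * K)) :=
        le_mul_of_one_le_right (by positivity) (by linarith)
      have e5 : ((j : ℝ) + 1) / n = j / n + 1 / n := by ring
      rw [e5]
      linarith
    refine ⟨φ + h, hφ', ?_, hΩn, ?_, ?_⟩
    · have e : φ + h - ((ε * ((j + 1 : ℕ) + k - n) : ℝ) : ℂ) =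
          (φ₀ - ((ε * (k - n) : ℝ) : ℂ)) +
          ε * ((omegaTransit ε (1 - a₃) (φ + h) - omegaTransit ε (1 - a₃) φ₀ - (j + 1 : ℕ)) +
            (1 - a₃) * (Complex.log (Complex.cos (φ + h)) - Complex.log (Complex.cos φ₀))) := by
        have hε' : (ε : ℂ) ≠ 0 := by exact_mod_cast hε0.ne'
        rw [omegaTransit, omegaTransit]
        push_cast
        field_simp
        ring
      rw [e]
      refine (norm_add_le _ _).trans ?_
      rw [norm_mul, Complex.norm_real, Real.norm_of_nonneg hε0.le]
      have hsum : ‖(omegaTransit ε (1 - a₃) (φ + h) - omegaTransit ε (1 - a₃) φ₀ - (j + 1 : ℕ)) +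
            (1 - a₃) * (Complex.log (Complex.cos (φ + h)) - Complex.log (Complex.cos φ₀))‖ ≤
          k / 8 := by
        refine (norm_add_le _ _).trans ?_
        rw [norm_mul]
        have h1 : ‖1 - a₃‖ * ‖Complex.log (Complex.cos (φ + h)) - Complex.log (Complex.cos φ₀)‖ ≤
            (1 + ‖a₃‖) * ((Real.log n + 5) + (Real.log n + 5)) := by
          gcongr
          exact (norm_sub_le _ _).trans (add_le_add hlogφ' hlogφ₀)
        have h2 : ((j + 1 : ℕ) : ℝ) / n ≤ 3 := by
          rw [div_le_iff₀ (by linarith), hcast]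
          linarith
        have h3 : 100 * transitConst a₃ K E * (1 + 2 * K) *
            (transitPotential k N (j + 1 : ℕ) + (j + 1 : ℕ) / n) ≤
            100 * transitConst a₃ K E * (1 + 2 * K) * 4 := by
          gcongr
          linarith
        have h4 : 0 ≤ 2 * transitConst a₃ K E * ‖(p (j + 1)).2‖ := by positivity
        generalize transitConst a₃ K E = A at *
        have h5 : 8 * (2 * A + 400 * A * (1 + 2 * K) + 10 * (1 + ‖a₃‖)) * (Real.log n + 1) ≤ k :=
          le_trans (by gcongr) hlogk
        have h6 : 0 ≤ A * Real.log n := by positivity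
        have h7 : 0 ≤ K * (A * Real.log n) := by positivity
        have h8 : 0 ≤ ‖a₃‖ * Real.log n := by positivity
        linarith
      have : ε * ‖(omegaTransit ε (1 - a₃) (φ + h) - omegaTransit ε (1 - a₃) φ₀ - (j + 1 : ℕ)) +
            (1 - a₃) * (Complex.log (Complex.cos (φ + h)) - Complex.log (Complex.cos φ₀))‖ ≤
          ε * (k / 8) := by gcongr
      linarith
    · rw [le_div_iff₀ hk0]
      exact le_trans (by gcongr) hzD'
    · have h1 : K * ‖(p j).1‖ ^ 2 ≤ K * (100 * (1 / (k : ℝ) ^ 2)) := by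
        gcongr
        refine hz2.trans ?_
        gcongr
      have e : 200 * K / (k : ℝ) ^ 2 = 2 * (K * (100 * (1 / (k : ℝ) ^ 2))) := by ring
      rw [e] at hx ⊢
      linarith [norm_nonneg (p 0).2]

end

/-! ### Passage through the gate: matching with the Fatou coordinates -/

theorem log_sin_eq {ε : ℝ} (hε0 : 0 < ε) {s θ : ℂ} (hs : ‖s‖ ≤ 1 / 4)
    (hθ : Complex.sin s = ε * θ * Complex.cos s) (hre : 0 < θ.re) :
    ‖Complex.log (Complex.sin s) - Real.log ε - Complex.log θ‖ ≤ 1 ∧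
      ‖s / ε - θ‖ ≤ 16 * ‖s‖ ^ 3 / ε := by
  have hc := half_le_re_cos hs
  have hc0 := cos_ne_zero_of_norm_le hs
  have hθ0 : θ ≠ 0 := by rintro rfl; simp at hre
  have hε' : (ε : ℂ) ≠ 0 := by exact_mod_cast hε0.ne'
  constructor
  · have h1 : ‖Complex.cos s - 1‖ ≤ 1 / 2 :=
      (norm_cos_sub_one_le (by linarith)).trans (by linarith)
    have h2 := Complex.norm_log_one_add_half_le_self h1
    rw [add_sub_cancel] at h2
    rw [hθ, mul_assoc, Complex.log_ofReal_mul hε0 (mul_ne_zero hθ0 hc0),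
      log_mul_of_re_pos hre (by linarith)]
    have e : (Real.log ε : ℂ) + (Complex.log θ + Complex.log (Complex.cos s)) - Real.log ε -
        Complex.log θ = Complex.log (Complex.cos s) := by ring
    rw [e]
    linarith
  · have h1 := norm_tan_sub_le hs
    have e1 : Complex.tan s = ε * θ := by
      rw [Complex.tan, hθ, mul_div_cancel_right₀ _ hc0]
    have e2 : s / ε - θ = -((Complex.tan s - s) / ε) := by
      rw [e1]; field_simp; ring
    rw [e2, norm_neg, norm_div, Complex.norm_real, Real.norm_of_nonneg hε0.le]
    gcongr

section
variable {T : ℂ × ℂ → ℂ × ℂ} {a₃ : ℂ} {ρ K E M ε : ℝ} {n k N : ℕ}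
  (hT : LocalForm T a₃ ρ K) (hS : TransitScale a₃ ρ K E M) (hN : TransitTimes M ε n k N)
include hT hS hN

/-- The error of tan s ≈ s at the ends of the gate, measured in steps, is (εk)³/ε = ε²k³. It is
bounded since k³ ≤ n². -/
theorem TransitTimes.cube_error {s : ℂ} (hs : ‖s‖ ≤ 5 / 4 * (ε * k)) :
    16 * ‖s‖ ^ 3 / ε ≤ 80 := by
  obtain ⟨hε0, -, -, -, h⟩ := hN.eps_bounds hT hS
  rw [div_le_iff₀ hε0]
  have h1 : ‖s‖ ^ 3 ≤ (5 / 4 * (ε * k)) ^ 3 := by gcongr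
  have h2 : ε * (ε ^ 2 * (k : ℝ) ^ 3) ≤ ε * (5 / 2) := by gcongr
  calc 16 * ‖s‖ ^ 3 ≤ 16 * (5 / 4 * (ε * k)) ^ 3 := by gcongr
    _ = 16 * (5 / 4) ^ 3 * (ε * (ε ^ 2 * (k : ℝ) ^ 3)) := by ring
    _ ≤ 16 * (5 / 4) ^ 3 * (ε * (5 / 2)) := by gcongr
    _ ≤ 80 * ε := by linarith

/-- With φ = s - π/2 the relation z = ε tan φ becomes tan s = ε(-1/z). Hence s/ε - n is -1/z - n up
to O(1), and cos φ = sin s ≈ ε(-1/z) produces the terms log ε and log(-1/z). -/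
theorem TransitTimes.exists_entry_angle {z : ℂ} (hz0 : z ≠ 0)
    (hz : ‖-1 / z - k‖ ≤ k / 16) :
    ∃ φ : ℂ, z * Complex.cos φ = ε * Complex.sin φ ∧
      ‖φ - ((ε * (k - n) : ℝ) : ℂ)‖ ≤ ε * k / 8 ∧
      ‖omegaTransit ε (1 - a₃) φ - (omegaIn (1 - a₃) z - n - (1 - a₃) * Real.log ε)‖ ≤
        80 + ‖1 - a₃‖ := by
  obtain ⟨hε0, hεn, hε, hεk, hk3⟩ := hN.eps_bounds hT hS
  have hM := hS.large hT
  obtain ⟨hn, hMk, hkn⟩ := hN.bounds hT hS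
  have hk0 : (0 : ℝ) < k := by linarith
  have hkε := mul_pos hε0 hk0
  have hε' : (ε : ℂ) ≠ 0 := by exact_mod_cast hε0.ne'
  set ζ := -1 / z with hζ
  have hζn : ‖ζ‖ ≤ 17 / 16 * k := by
    have := norm_add_le (ζ - k) k
    rw [sub_add_cancel, Complex.norm_natCast] at this
    linarith
  have hζre : 0 < ζ.re := by
    have h := (Complex.abs_re_le_norm _).trans hz
    rw [Complex.sub_re, Complex.natCast_re] at h
    linarith [(abs_le.1 h).1]
  have hτ : ‖(ε : ℂ) * ζ‖ ≤ 17 / 16 * (ε * k) := by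
    rw [norm_mul, Complex.norm_real, Real.norm_of_nonneg hε0.le]
    nlinarith
  have hτ8 : ‖(ε : ℂ) * ζ‖ ≤ 1 / 8 := by linarith
  have hs1 := norm_arctan_le hτ8
  have hs2 := norm_sub_arctan_le hτ8
  have hs3 := tan_arctan_of_norm_le hτ8
  set s := Complex.arctan (ε * ζ)
  have hs4 : ‖s‖ ≤ 1 / 4 := by linarith
  have hc0 := cos_ne_zero_of_norm_le hs4
  have hsin : Complex.sin s = ε * ζ * Complex.cos s := by
    rw [← hs3, Complex.tan, div_mul_cancel₀ _ hc0]
  have hτ3 : ‖(ε : ℂ) * ζ‖ ^ 3 ≤ (ε * k) * (1 / 4096) := by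
    calc ‖(ε : ℂ) * ζ‖ ^ 3 ≤ (17 / 16 * (ε * k)) ^ 3 := by gcongr
      _ = (ε * k) * ((17 / 16) ^ 3 * (ε * k) ^ 2) := by ring
      _ ≤ (ε * k) * ((17 / 16) ^ 3 * (1 / 160) ^ 2) := by gcongr
      _ ≤ (ε * k) * (1 / 4096) := by gcongr; norm_num
  have hsk : ‖s - ε * k‖ ≤ ε * k / 8 := by
    have e : s - ε * k = (s - ε * ζ) + ε * (ζ - k) := by ring
    have h1 : ‖(ε : ℂ) * (ζ - k)‖ ≤ ε * (k / 16) := by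
      rw [norm_mul, Complex.norm_real, Real.norm_of_nonneg hε0.le]
      gcongr
    rw [e]
    refine (norm_add_le _ _).trans ?_
    linarith
  have hsn : ‖s‖ ≤ 5 / 4 * (ε * k) := by
    have := norm_add_le (s - ε * k) (ε * k)
    rw [sub_add_cancel, norm_mul, Complex.norm_real, Real.norm_of_nonneg hε0.le,
      Complex.norm_natCast] at this
    linarith
  obtain ⟨h1, h2⟩ := log_sin_eq hε0 hs4 hsin hζre
  have h3 := hN.cube_error hT hS hsn
  have hpi : (Real.pi : ℂ) / 2 = ε * n := by
    rw [← Complex.ofReal_natCast, ← Complex.ofReal_mul, hεn]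
    push_cast; ring
  refine ⟨s - Real.pi / 2, ?_, ?_, ?_⟩
  · rw [Complex.cos_sub_pi_div_two, Complex.sin_sub_pi_div_two, hsin, hζ]
    field_simp
  · have e : s - Real.pi / 2 - ((ε * (k - n) : ℝ) : ℂ) = s - ε * k := by
      rw [hpi]; push_cast; ring
    rwa [e]
  · have e : omegaTransit ε (1 - a₃) (s - Real.pi / 2) -
        (omegaIn (1 - a₃) z - n - (1 - a₃) * Real.log ε) =
        (s / ε - ζ) - (1 - a₃) * (Complex.log (Complex.sin s) - Real.log ε - Complex.log ζ) := by
      rw [omegaTransit, omegaIn, Complex.cos_sub_pi_div_two, hpi, ← hζ]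
      field_simp
      ring
    have h4 : ‖(1 - a₃) * (Complex.log (Complex.sin s) - Real.log ε - Complex.log ζ)‖ ≤
        ‖1 - a₃‖ * 1 := by
      rw [norm_mul]; gcongr
    rw [e]
    refine (norm_sub_le _ _).trans ?_
    linarith

/-- The mirror image of the entry: φ = π/2 - s and tan s = ε/z. The term b log ε appears with the
same sign as at the entry, so it drops out of the elapsed time. -/
theorem TransitTimes.exit_angle {z φ : ℂ} (hφ : z * Complex.cos φ = ε * Complex.sin φ)
    (hφ' : ‖φ - ((ε * (N + k - n) : ℝ) : ℂ)‖ ≤ ε * k / 4) :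
    z ≠ 0 ∧ ‖omegaTransit ε (1 - a₃) φ - (omegaOut (1 - a₃) z + n - (1 - a₃) * Real.log ε)‖ ≤
        80 + ‖1 - a₃‖ := by
  obtain ⟨hε0, hεn, hε, hεk, hk3⟩ := hN.eps_bounds hT hS
  have hM := hS.large hT
  obtain ⟨hn, hMk, hkn⟩ := hN.bounds hT hS
  have hk1 : (1000000 : ℝ) ≤ k := by linarith
  have hk0 : (0 : ℝ) < k := by linarith
  have hkε := mul_pos hε0 hk0
  have hε' : (ε : ℂ) ≠ 0 := by exact_mod_cast hε0.ne'
  have hpi : (Real.pi : ℂ) / 2 = ε * n := by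
    rw [← Complex.ofReal_natCast, ← Complex.ofReal_mul, hεn]
    push_cast; ring
  obtain ⟨s, hs⟩ : ∃ s : ℂ, s = Real.pi / 2 - φ := ⟨_, rfl⟩
  have hφs : φ = Real.pi / 2 - s := by rw [hs]; ring
  have hsteps : (N : ℂ) + 2 * k = 2 * n + 1 := by exact_mod_cast hN.steps
  have hsk : ‖s - ε * (k - 1)‖ ≤ ε * k / 4 := by
    have e : φ - ((ε * (N + k - n) : ℝ) : ℂ) = -(s - ε * (k - 1)) := by
      rw [hφs, hpi]; push_cast
      linear_combination (-(ε : ℂ)) * hsteps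
    rwa [e, norm_neg] at hφ'
  have hεε : ε * 1000000 ≤ ε * k := by gcongr
  have hsn : ‖s‖ ≤ 5 / 4 * (ε * k) := by
    have h := norm_add_le (s - ε * (k - 1)) (ε * (k - 1))
    have e : (ε : ℂ) * (k - 1) = ((ε * (k - 1) : ℝ) : ℂ) := by push_cast; ring
    rw [sub_add_cancel, e, Complex.norm_real, Real.norm_of_nonneg
      (mul_nonneg hε0.le (by linarith)), ← e] at h
    linarith
  have hsre : ε * k / 2 ≤ s.re := by
    have e : (ε : ℂ) * (k - 1) = ((ε * (k - 1) : ℝ) : ℂ) := by push_cast; ring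
    have h := (Complex.abs_re_le_norm _).trans hsk
    rw [e, Complex.sub_re, Complex.ofReal_re] at h
    linarith [(abs_le.1 h).1]
  have hs4 : ‖s‖ ≤ 1 / 4 := by linarith
  have hc0 := cos_ne_zero_of_norm_le hs4
  rw [hφs, Complex.cos_pi_div_two_sub, Complex.sin_pi_div_two_sub] at hφ
  have hz0 : z ≠ 0 := by
    rintro rfl
    rw [zero_mul] at hφ
    exact mul_ne_zero hε' hc0 hφ.symm
  refine ⟨hz0, ?_⟩
  have hsin : Complex.sin s = ε * (1 / z) * Complex.cos s := by
    field_simp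
    linear_combination hφ
  have hre : 0 < (1 / z).re := by
    have h1 := norm_tan_sub_le hs4
    have e1 : Complex.tan s = ε * (1 / z) := by
      rw [Complex.tan, hsin, mul_div_cancel_right₀ _ hc0]
    have h2 := (Complex.abs_re_le_norm _).trans h1
    rw [e1, Complex.sub_re, Complex.re_ofReal_mul] at h2
    have h3 : ‖s‖ ^ 3 ≤ (ε * k) * (1 / 64) := by
      calc ‖s‖ ^ 3 ≤ (5 / 4 * (ε * k)) ^ 3 := by gcongr
        _ = (ε * k) * ((5 / 4) ^ 3 * (ε * k) ^ 2) := by ring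
        _ ≤ (ε * k) * ((5 / 4) ^ 3 * (1 / 160) ^ 2) := by gcongr
        _ ≤ (ε * k) * (1 / 64) := by gcongr; norm_num
    have h4 := (abs_le.1 h2).1
    have h5 : 0 < ε * (1 / z).re := by linarith
    exact pos_of_mul_pos_right h5 hε0.le
  obtain ⟨h1, h2⟩ := log_sin_eq hε0 hs4 hsin hre
  have h3 := hN.cube_error hT hS hsn
  have e : omegaTransit ε (1 - a₃) φ - (omegaOut (1 - a₃) z + n - (1 - a₃) * Real.log ε) =
      -(s / ε - 1 / z) - (1 - a₃) * (Complex.log (Complex.sin s) - Real.log ε -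
        Complex.log (1 / z)) := by
    rw [omegaTransit, omegaOut, hφs, Complex.cos_pi_div_two_sub, hpi]
    field_simp
    ring
  have h4 : ‖(1 - a₃) * (Complex.log (Complex.sin s) - Real.log ε - Complex.log (1 / z))‖ ≤
      ‖1 - a₃‖ * 1 := by
    rw [norm_mul]; gcongr
  rw [e]
  refine (norm_sub_le _ _).trans ?_
  rw [norm_neg]
  linarith

/-- The elapsed time is N + O(1), and the two ends shift it by 2n in total. From N = 2n + 1 - 2k and
ω^ι = k + O(1) at the entry there remains ω^o = -k + O(1); the summand 1 in the bound is the odd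
step in N. -/
theorem LocalForm.transit {p : ℕ → ℂ × ℂ} {B : ℝ} (hz0 : (p 0).1 ≠ 0)
    (hz : ‖-1 / (p 0).1 - k‖ ≤ k / 16) (hΦ : ‖omegaIn (1 - a₃) (p 0).1 - k‖ ≤ B)
    (hx₀ : M * ‖(p 0).2‖ ≤ 1)
    (hstep : ∀ j < N, ‖(p j).1‖ ≤ ρ → ‖(p j).2‖ ≤ ρ → (p (j + 1)).2 = (T (p j)).2 ∧
      ‖(p (j + 1)).1 - (T (p j)).1 - (ε : ℂ) ^ 2‖ ≤
        E * ε ^ 2 * (1 / n + ‖(p j).2‖ + ‖(p j).1‖ ^ 2)) :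
    (∀ j ≤ N, ‖(p j).1‖ ≤ 10 / k ∧ ‖(p j).2‖ ≤ ‖(p 0).2‖ + 200 * K / k ^ 2) ∧
      (p N).1 ≠ 0 ∧
      ‖omegaOut (1 - a₃) (p N).1 + k‖ ≤ transitError a₃ K E + B + 2 * (80 + ‖1 - a₃‖) + 1 := by
  obtain ⟨φ₀, hφ₀, hφ₀', hΩ₀⟩ := hN.exists_entry_angle hT hS hz0 hz
  have horb := hT.transit_orbit hS hN hφ₀ hφ₀' hx₀ hstep
  refine ⟨fun j hj => ?_, ?_⟩
  · obtain ⟨φ, -, -, -, h⟩ := horb j hj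
    exact h
  obtain ⟨φ, hφ, hφ', hΩ, -⟩ := horb N le_rfl
  obtain ⟨hzN, hout⟩ := hN.exit_angle hT hS hφ hφ'
  refine ⟨hzN, ?_⟩
  have hK := hT.one_le
  obtain ⟨hA60, -⟩ := transitConst_ge (a₃ := a₃) hK hS.nonneg
  obtain ⟨hn, hMk, hkn⟩ := hN.bounds hT hS
  have hM := hS.large hT
  have hn0 : (0 : ℝ) < n := by exact_mod_cast hn
  have hsteps : (N : ℝ) + 2 * k = 2 * n + 1 := by exact_mod_cast hN.steps
  have hsteps' : (N : ℂ) + 2 * k = 2 * n + 1 := by exact_mod_cast hN.steps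
  have hΩ' : ‖omegaTransit ε (1 - a₃) φ - omegaTransit ε (1 - a₃) φ₀ - N‖ ≤
      transitError a₃ K E := by
    have h1 := transitPotential_le_one (k := k) (N := N) (j := N) (by linarith)
      (Nat.cast_nonneg _) le_rfl
    have h2 : (N : ℝ) / n ≤ 3 := by
      rw [div_le_iff₀ hn0]
      have : (1 : ℝ) ≤ n := by exact_mod_cast hn
      linarith
    have h3 : 100 * transitConst a₃ K E * (1 + 2 * K) * (transitPotential k N N + N / n) ≤
        100 * transitConst a₃ K E * (1 + 2 * K) * 4 := by
      gcongr
      linarith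
    have h4 : 2 * transitConst a₃ K E * ‖(p 0).2‖ ≤ 2 * transitConst a₃ K E * 1 := by
      gcongr
      nlinarith [norm_nonneg (p 0).2]
    have h5 : 0 ≤ 2 * transitConst a₃ K E * ‖(p N).2‖ := by positivity
    rw [transitError]
    linarith
  have e : omegaOut (1 - a₃) (p N).1 + k =
      (omegaTransit ε (1 - a₃) φ - omegaTransit ε (1 - a₃) φ₀ - N) +
      (omegaIn (1 - a₃) (p 0).1 - k) +
      ((omegaTransit ε (1 - a₃) φ₀ - (omegaIn (1 - a₃) (p 0).1 - n - (1 - a₃) * Real.log ε)) -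
      (omegaTransit ε (1 - a₃) φ - (omegaOut (1 - a₃) (p N).1 + n - (1 - a₃) * Real.log ε))) +
      1 := by
    linear_combination hsteps'
  rw [e]
  refine (norm_add_le _ _).trans ?_
  rw [norm_one]
  have h1 := norm_sub_le
    (omegaTransit ε (1 - a₃) φ₀ - (omegaIn (1 - a₃) (p 0).1 - n - (1 - a₃) * Real.log ε))
    (omegaTransit ε (1 - a₃) φ - (omegaOut (1 - a₃) (p N).1 + n - (1 - a₃) * Real.log ε))
  have h2 := norm_add₃_le (a := omegaTransit ε (1 - a₃) φ - omegaTransit ε (1 - a₃) φ₀ - N)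
    (b := omegaIn (1 - a₃) (p 0).1 - k) (c :=
    (omegaTransit ε (1 - a₃) φ₀ - (omegaIn (1 - a₃) (p 0).1 - n - (1 - a₃) * Real.log ε)) -
    (omegaTransit ε (1 - a₃) φ - (omegaOut (1 - a₃) (p N).1 + n - (1 - a₃) * Real.log ε)))
  linarith

end

/-! ### The last steps before the exit from the repelling petal -/

/-- A slightly perturbed orbit shadows the orbit of a point over the same first coordinate until
both come within a bounded number of steps of the boundary of the repelling side. -/
theorem RepellingScale.shadow {T : ℂ × ℂ → ℂ × ℂ} {a₃ : ℂ} {ρ K Ra R κ B P : ℝ} {k κ₁ : ℕ}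
    (hR : RepellingScale a₃ ρ K Ra R κ) (hT : LocalForm T a₃ ρ K)
    (hκ₁ : R + B + 1 ≤ κ₁) (hκk : κ₁ ≤ k) (hP0 : 0 ≤ P)
    (hP : 1920 * (1 + ‖a₃‖) ^ 2 * (k : ℝ) ^ 3 * P ≤ 1 / 2)
    {p : ℕ → ℂ × ℂ} {u : ℂ} (hz0 : (p 0).1 ≠ 0) (hz : Ra ≤ ‖1 / (p 0).1‖)
    (hω : ‖omegaOut (1 - a₃) (p 0).1 + k‖ ≤ B) (hx : ‖(p 0).2‖ ≤ ρ) (hu : ‖u‖ ≤ ρ)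
    (hstep : ∀ j < k - κ₁, ‖(p j).1‖ ≤ ρ → ‖(p j).2‖ ≤ ρ → (p (j + 1)).2 = (T (p j)).2 ∧
      ‖(p (j + 1)).1 - (T (p j)).1‖ ≤ P) :
    (∀ j ≤ k - κ₁, ‖(p j).1‖ ≤ ρ ∧ ‖(p j).2‖ ≤ ρ ∧
      ‖(T^[j] ((p 0).1, u)).1‖ ≤ ρ ∧ ‖(T^[j] ((p 0).1, u)).2‖ ≤ ρ) ∧
    ‖p (k - κ₁) - T^[k - κ₁] ((p 0).1, u)‖ ≤
      2 * (‖(p 0).2‖ + ‖u‖ + 64 * (k : ℝ) ^ 3 * P) := by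
  have hK := hT.one_le
  have hRa := hR.one_le
  have hRR := hR.le
  have hB0 : 0 ≤ B := (norm_nonneg _).trans hω
  obtain ⟨N, hN⟩ : ∃ N, N = k - κ₁ := ⟨_, rfl⟩
  have hNk : (N : ℝ) = k - κ₁ := by rw [hN, Nat.cast_sub hκk]
  have hκk' : (κ₁ : ℝ) ≤ k := by exact_mod_cast hκk
  rw [← hN] at hstep ⊢
  have hk1 : (1 : ℝ) ≤ k := by linarith
  set W := omegaOut (1 - a₃) (p 0).1 with hWdef
  have hWre : W.re ≤ -(R + N) := by
    have h := (abs_le.1 ((Complex.abs_re_le_norm _).trans hω)).2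
    rw [Complex.add_re, Complex.natCast_re] at h
    linarith
  have hWj : ∀ j ≤ N, ‖W + j‖ ≤ 2 * k := by
    intro j hj
    have hjN : (j : ℝ) ≤ N := by exact_mod_cast hj
    have e : W + j = (W + k) - ((k - j : ℝ) : ℂ) := by push_cast; ring
    rw [e]
    refine (norm_sub_le _ _).trans ?_
    rw [Complex.norm_real, Real.norm_of_nonneg (by linarith)]
    have : (0 : ℝ) ≤ j := j.cast_nonneg
    linarith
  -- On this stretch |1/z| ≤ 4k, so an additive perturbation `P` is a relative one of size σ|z|².
  -- Over at most k steps it amounts to O(k³P).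
  set σ := 16 * (k : ℝ) ^ 2 * P with hσ
  have hσ0 : 0 ≤ σ := by positivity
  have hkσ : 120 * (1 + ‖a₃‖) ^ 2 * (k * σ) ≤ 1 / 2 := by
    refine le_trans (le_of_eq ?_) hP
    rw [hσ]; ring
  have hσk : σ ≤ k * σ := le_mul_of_one_le_left hσ0 hk1
  have hc : 1 + ‖a₃‖ ≤ (1 + ‖a₃‖) ^ 2 := by nlinarith [norm_nonneg a₃]
  have hσ1 : 128 * (1 + ‖a₃‖) * σ ≤ 1 := by
    have h1 : (1 + ‖a₃‖) * σ ≤ (1 + ‖a₃‖) ^ 2 * (k * σ) := by gcongr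
    linarith
  have hNσ : N * (120 * (1 + ‖a₃‖) ^ 2 * σ) ≤ 1 := by
    have h1 : (N : ℝ) * (120 * (1 + ‖a₃‖) ^ 2 * σ) ≤ k * (120 * (1 + ‖a₃‖) ^ 2 * σ) := by
      gcongr
      omega
    linarith
  have hω0 : ‖omegaOut (1 - a₃) (p 0).1 - W‖ ≤ 1 / 2 := by
    rw [← hWdef, sub_self, norm_zero]; norm_num
  have hPσ : ∀ z : ℂ, z ≠ 0 → ‖1 / z‖ ≤ 4 * k → P ≤ σ * ‖z‖ ^ 2 := by
    intro z hz0 hz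
    rw [norm_div, norm_one, div_le_iff₀ (norm_pos_iff.2 hz0)] at hz
    have h1 : 1 ≤ (4 * k * ‖z‖) ^ 2 := one_le_pow₀ hz
    calc P ≤ P * (4 * k * ‖z‖) ^ 2 := le_mul_of_one_le_right hP0 h1
      _ = σ * ‖z‖ ^ 2 := by rw [hσ]; ring
  have hp := hR.control hT hσ0 hσ1 hNσ hWre hz0 hz hx hω0 (fun j hj h1 h2 h3 _ h5 => by
    obtain ⟨s, hs, hsn⟩ := hT.exists_step h1 h2 h3
    obtain ⟨hsnd, hfst⟩ := hstep j hj h2 h3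
    have h6 := hPσ _ h1 (h5.trans (by linarith [hWj j hj.le]))
    refine ⟨s + ((p (j + 1)).1 - (T (p j)).1) / (p j).1 ^ 2, ?_, ?_, ?_⟩
    · have e : (p (j + 1)).1 = (T (p j)).1 + ((p (j + 1)).1 - (T (p j)).1) := by ring
      rw [e, hs]
      field_simp
      ring
    · refine (norm_add_le _ _).trans (add_le_add hsn ?_)
      rw [norm_div, norm_pow, div_le_iff₀ (by positivity)]
      exact hfst.trans h6
    · rw [hsnd]
      exact hT.snd _ _ h2 h3)
  have hq := hR.control_iterate hT (p := ((p 0).1, u)) hWre hz0 hz hu hω0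
  have hsmall : ∀ z : ℂ, z ≠ 0 → Ra ≤ ‖1 / z‖ → ‖z‖ ≤ ρ := by
    intro z h1 h2
    have := (hR.small' hT h1 h2 (σ := 0) (by norm_num)).1
    linarith [hT.pos]
  have hloc : ∀ j ≤ N, ‖(p j).1‖ ≤ ρ ∧ ‖(p j).2‖ ≤ ρ ∧
      ‖(T^[j] ((p 0).1, u)).1‖ ≤ ρ ∧ ‖(T^[j] ((p 0).1, u)).2‖ ≤ ρ := by
    intro j hj
    obtain ⟨a1, a2, a3, -⟩ := hp j hj
    obtain ⟨b1, b2, b3, -⟩ := hq j hj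
    exact ⟨hsmall _ a1 a2, a3, hsmall _ b1 b2, b3⟩
  refine ⟨hloc, ?_⟩
  have hcmp := hR.compare hT (p := p) (q := fun j => T^[j] ((p 0).1, u)) hσ0 hσ1
    (B := ‖(p 0).2‖ + ‖u‖ + 4 * N * σ)
    (fun j hj => by
      obtain ⟨a1, a2, a3, -, a5, a6, -⟩ := hp j hj
      exact ⟨a1, a2, a3, by linarith⟩)
    (fun j hj => by
      obtain ⟨a1, a2, a3, -, a5, a6, -⟩ := hq j hj
      exact ⟨a1, a2, a3, by linarith⟩)
    (fun j hj => by
      obtain ⟨a1, -, -, -, -, -, a7⟩ := hp j hj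
      obtain ⟨b1, -, -, -, -, b6, -⟩ := hq j hj
      rw [norm_div, norm_one] at a7 b6
      have hp0 := norm_pos_iff.2 a1
      have hq0 := norm_pos_iff.2 b1
      have h1 : 1 / ‖(p j).1‖ ≤ 4 * (1 / ‖(T^[j] ((p 0).1, u)).1‖) := by linarith
      rw [mul_one_div, div_le_div_iff₀ hp0 hq0] at h1
      linarith)
    (fun j hj => by
      obtain ⟨a1, a2, a3, -, a5, a6, a7⟩ := hp j hj.le
      obtain ⟨hsnd, hfst⟩ := hstep j hj (hsmall _ a1 a2) a3
      exact ⟨hfst.trans (hPσ _ a1 (by linarith [hWj j hj.le])), hsnd⟩)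
    (fun j _ => Function.iterate_succ_apply' _ _ _)
    (by
      simp only [Function.iterate_zero, id_eq, sub_self, norm_zero, zero_add]
      gcongr
      exact norm_sub_le _ _) N le_rfl
  obtain ⟨hcmp, -⟩ := hcmp
  obtain ⟨a1, a2, -⟩ := hp N le_rfl
  obtain ⟨b1, b2, -⟩ := hq N le_rfl
  have hle1 := hT.le_one
  have hz1 := hsmall _ a1 a2
  have hz2 := hsmall _ b1 b2
  generalize T^[N] ((p 0).1, u) = r at *
  have hdz : ‖(p N).1 - r.1‖ ≤ ‖-1 / (p N).1 - -1 / r.1‖ := by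
    have e : (p N).1 - r.1 = (p N).1 * r.1 * (-1 / (p N).1 - -1 / r.1) := by
      field_simp; ring
    conv_lhs => rw [e]
    rw [norm_mul, norm_mul]
    have : ‖(p N).1‖ * ‖r.1‖ ≤ 1 := mul_le_one₀ (by linarith) (norm_nonneg _) (by linarith)
    exact mul_le_of_le_one_left (norm_nonneg _) this
  have hd : ‖p N - r‖ ≤ ‖(p N).1 - r.1‖ + ‖(p N).2 - r.2‖ := by
    rw [Prod.norm_def]
    exact max_le (le_add_of_nonneg_right (norm_nonneg _)) (le_add_of_nonneg_left (norm_nonneg _))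
  have hNσ2 : 4 * N * σ ≤ 64 * (k : ℝ) ^ 3 * P := by
    calc 4 * N * σ ≤ 4 * k * σ := by gcongr; omega
      _ = 64 * (k : ℝ) ^ 3 * P := by rw [hσ]; ring
  linarith

/-! ### The driving sequence and the waiting times -/

theorem compSteps_add {X : Type*} (S : ℕ → X → X) (m i j : ℕ) (x : X) :
    compSteps S m (i + j) x = compSteps S (m + i) j (compSteps S m i x) := by
  induction j with
  | zero => rfl
  | succ j ih => rw [← add_assoc, compSteps, compSteps, ih, add_assoc]

/-- During the `n`-th cycle `w_m` is close to `1 / n²`. -/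
theorem exists_wSeq_near {q₂ : Polynomial ℂ} {δ : ℂ} (hq0 : q₂.coeff 0 = 0)
    (hq1 : q₂.coeff 1 = 0) (hq2 : q₂.coeff 2 = -1) (hδ0 : δ ≠ 0) (hδ : ‖δ‖ ≤ 1 / 64)
    {S : Set (ℂ × ℂ)} (hS : IsCompact S) (hSb : S ⊆ basin (mapG q₂ δ)) :
    ∃ C : ℝ, 0 ≤ C ∧ ∀ᶠ n : ℕ in atTop, ∀ g ∈ S, ∀ m, n ^ 2 ≤ m → m ≤ (n + 1) ^ 2 →
      ‖wSeq q₂ δ g m‖ ≤ 2 / (n : ℝ) ^ 2 ∧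
      ‖(n : ℂ) ^ 2 * wSeq q₂ δ g m - 1‖ ≤ C / n := by
  obtain ⟨C, M, h⟩ := exists_wSeq_bound hq0 hq1 hq2 hδ0 hδ hS hSb
  refine ⟨2 * (2 * |C| + 3), by positivity, ?_⟩
  filter_upwards [eventually_ge_atTop M, eventually_ge_atTop 1,
    tendsto_natCast_atTop_atTop.eventually_ge_atTop (2 * (2 * |C| + 3))]
    with n hnM hn1 hnC g hg m hm hm'
  obtain ⟨hw0, hw⟩ := h g hg m (hnM.trans ((Nat.le_self_pow two_ne_zero n).trans hm))
  have hn1' : (1 : ℝ) ≤ n := by exact_mod_cast hn1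
  have hmR : (n : ℝ) ^ 2 ≤ m := by exact_mod_cast hm
  have hmR' : (m : ℝ) ≤ ((n : ℝ) + 1) ^ 2 := by exact_mod_cast hm'
  have hsq : √(m : ℝ) ≤ n + 1 := Real.sqrt_le_iff.2 ⟨by linarith, hmR'⟩
  set w := wSeq q₂ δ g m
  have h1 : ‖1 / w - (n : ℂ) ^ 2‖ ≤ (2 * |C| + 3) * n := by
    have e : 1 / w - (n : ℂ) ^ 2 = (1 / w - m) + ((m - (n : ℝ) ^ 2 : ℝ) : ℂ) := by
      push_cast; ring
    have h2 : C * √(m : ℝ) ≤ |C| * (n + 1) :=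
      (mul_le_mul_of_nonneg_right (le_abs_self C) (Real.sqrt_nonneg _)).trans (by gcongr)
    rw [e]
    refine (norm_add_le _ _).trans ?_
    rw [Complex.norm_real, Real.norm_of_nonneg (by linarith)]
    nlinarith [abs_nonneg C]
  have h2 : (n : ℝ) ^ 2 / 2 ≤ ‖1 / w‖ := by
    have h3 := norm_sub_norm_le ((n : ℂ) ^ 2) (1 / w)
    rw [norm_sub_rev, norm_pow, Complex.norm_natCast] at h3
    nlinarith
  have hwn : ‖w‖ ≤ 2 / (n : ℝ) ^ 2 := by
    rw [norm_div, norm_one, div_le_div_iff₀ two_pos (norm_pos_iff.2 hw0)] at h2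
    rw [le_div_iff₀ (by positivity)]
    linarith
  refine ⟨hwn, ?_⟩
  have e : (n : ℂ) ^ 2 * w - 1 = -(w * (1 / w - (n : ℂ) ^ 2)) := by
    field_simp; ring
  rw [e, norm_neg, norm_mul]
  calc ‖w‖ * ‖1 / w - (n : ℂ) ^ 2‖ ≤ 2 / (n : ℝ) ^ 2 * ((2 * |C| + 3) * n) := by gcongr
    _ = 2 * (2 * |C| + 3) / n := by field_simp

theorem kSeq_le (α : ℝ) (n : ℕ) : (kSeq α n : ℝ) ≤ (n : ℝ) ^ α :=
  Nat.floor_le (Real.rpow_nonneg n.cast_nonneg α)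

theorem tendsto_kSeq {α : ℝ} (hα : 0 < α) : Tendsto (kSeq α) atTop atTop :=
  tendsto_nat_floor_atTop.comp ((tendsto_rpow_atTop hα).comp tendsto_natCast_atTop_atTop)

theorem eventually_mul_log_le_kSeq {α : ℝ} (hα : 0 < α) (M : ℝ) :
    ∀ᶠ n : ℕ in atTop, M * (Real.log n + 1) ≤ kSeq α n := by
  have h1 : (fun x : ℝ => M * (Real.log x + 1) + 1) =o[atTop] (fun x : ℝ => x ^ α) := by
    have hc : ∀ c : ℝ, (fun _ : ℝ => c) =o[atTop] (fun x : ℝ => x ^ α) := fun c =>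
      (Asymptotics.isLittleO_const_left.2 (Or.inr (tendsto_norm_atTop_atTop.comp
        (tendsto_rpow_atTop hα))))
    exact (((isLittleO_log_rpow_atTop hα).add (hc 1)).const_mul_left M).add (hc 1)
  filter_upwards [tendsto_natCast_atTop_atTop.eventually (h1.bound one_pos)] with n hn
  rw [one_mul, Real.norm_of_nonneg (Real.rpow_nonneg n.cast_nonneg α)] at hn
  have h2 : (n : ℝ) ^ α < kSeq α n + 1 := Nat.lt_floor_add_one _
  linarith [(le_abs_self _).trans hn]

/-- Here k³ ≤ n^(3α), and α < 2/3 makes 3α < 2. -/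
theorem eventually_kSeq_cube_le {α : ℝ} (hα : α < 2 / 3) {c : ℝ} (hc : 0 < c) :
    ∀ᶠ n : ℕ in atTop, (kSeq α n : ℝ) ^ 3 ≤ c * (n : ℝ) ^ 2 := by
  have h1 : Tendsto (fun x : ℝ => x ^ (-(2 - 3 * α))) atTop (𝓝 0) :=
    tendsto_rpow_neg_atTop (by linarith)
  filter_upwards [(h1.comp tendsto_natCast_atTop_atTop).eventually_le_const hc,
    eventually_ge_atTop 1] with n hn hn1
  have hn0 : (0 : ℝ) < n := by exact_mod_cast hn1
  have h2 : (kSeq α n : ℝ) ^ 3 ≤ ((n : ℝ) ^ α) ^ 3 :=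
    pow_le_pow_left₀ (Nat.cast_nonneg _) (kSeq_le α n) 3
  have e : ((n : ℝ) ^ α) ^ 3 = (n : ℝ) ^ (-(2 - 3 * α)) * (n : ℝ) ^ 2 := by
    rw [← Real.rpow_natCast, ← Real.rpow_natCast, ← Real.rpow_mul hn0.le, ← Real.rpow_add hn0]
    congr 1
    push_cast; ring
  rw [e] at h2
  exact h2.trans (mul_le_mul_of_nonneg_right hn (by positivity))

/-! ### One cycle -/

section
variable {S : ℂ → ℂ × ℂ → ℂ × ℂ} {T : ℂ × ℂ → ℂ × ℂ} {a₃ : ℂ} {ρ K : ℝ}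

/-- The scale ε = π/(2n) is the one for which (π²/4)/n² = ε². The precise bound serves the passage
through the gate, the crude O(ε²) one the last stretch. -/
theorem PerturbedForm.step_bounds (hS : PerturbedForm S T ρ K) (hT : LocalForm T a₃ ρ K)
    {n : ℕ} {ε C : ℝ} {w : ℂ} (hn : 1 ≤ n) (hε : ε = Real.pi / (2 * n)) (hC : 0 ≤ C)
    (hw : ‖w‖ ≤ 2 / (n : ℝ) ^ 2) (hwρ : ‖w‖ ≤ ρ) (hw' : ‖(n : ℂ) ^ 2 * w - 1‖ ≤ C / n)
    {p : ℂ × ℂ} (hz : ‖p.1‖ ≤ ρ) (hx : ‖p.2‖ ≤ ρ) :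
    (S w p).2 = (T p).2 ∧
    ‖(S w p).1 - (T p).1 - (ε : ℂ) ^ 2‖ ≤ (K + C) * ε ^ 2 * (1 / n + ‖p.2‖ + ‖p.1‖ ^ 2) ∧
    ‖(S w p).1 - (T p).1‖ ≤ (1 + 3 * (K + C)) * ε ^ 2 := by
  obtain ⟨z, x⟩ := p
  have hK := hT.one_le
  have hρ := hT.le_one
  have hn1 : (1 : ℝ) ≤ n := by exact_mod_cast hn
  have hn0 : (0 : ℝ) < n := by linarith
  have hεn : ε * n = Real.pi / 2 := by rw [hε]; field_simp
  have hεn' : (ε : ℂ) * n = Real.pi / 2 := by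
    rw [← Complex.ofReal_natCast, ← Complex.ofReal_mul, hεn]
    push_cast; ring
  have hwε : ‖w‖ ≤ ε ^ 2 := by
    refine hw.trans ?_
    rw [div_le_iff₀ (by positivity), ← mul_pow, hεn]
    nlinarith [Real.pi_gt_three]
  have e : (S w (z, x)).1 - (T (z, x)).1 - (ε : ℂ) ^ 2 =
      ((S w (z, x)).1 - (T (z, x)).1 - (Real.pi : ℂ) ^ 2 / 4 * w) +
        (ε : ℂ) ^ 2 * ((n : ℂ) ^ 2 * w - 1) := by
    linear_combination (-(ε * n + Real.pi / 2 : ℂ)) * w * hεn'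
  have h1 : ‖(S w (z, x)).1 - (T (z, x)).1 - (ε : ℂ) ^ 2‖ ≤
      (K + C) * ε ^ 2 * (1 / n + ‖x‖ + ‖z‖ ^ 2) := by
    rw [e]
    have h2 := hS.fst w z x hwρ hz hx
    have h3 : K * ‖w‖ * (‖x‖ + ‖z‖ ^ 2) ≤ K * ε ^ 2 * (‖x‖ + ‖z‖ ^ 2) := by gcongr
    have h4 : ‖(ε : ℂ) ^ 2 * ((n : ℂ) ^ 2 * w - 1)‖ ≤ ε ^ 2 * (C / n) := by
      rw [norm_mul, norm_pow, Complex.norm_real, Real.norm_eq_abs, sq_abs]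
      gcongr
    refine (norm_add_le _ _).trans ((add_le_add (h2.trans h3) h4).trans ?_)
    have h5 : 0 ≤ K * ε ^ 2 * (1 / n) + C * ε ^ 2 * (‖x‖ + ‖z‖ ^ 2) := by positivity
    have e2 : ε ^ 2 * (C / n) = C * ε ^ 2 * (1 / n) := by ring
    rw [e2]
    linarith
  refine ⟨hS.snd_eq w z x hwρ hz hx, h1, ?_⟩
  have e3 : (S w (z, x)).1 - (T (z, x)).1 =
      ((S w (z, x)).1 - (T (z, x)).1 - (ε : ℂ) ^ 2) + (ε : ℂ) ^ 2 := by ring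
  have h6 : 1 / (n : ℝ) + ‖x‖ + ‖z‖ ^ 2 ≤ 3 := by
    have h7 : 1 / (n : ℝ) ≤ 1 := by rw [div_le_one hn0]; exact hn1
    have h8 : ‖z‖ ^ 2 ≤ 1 := pow_le_one₀ (norm_nonneg z) (hz.trans hρ)
    simp only at hx
    linarith
  have h9 : (K + C) * ε ^ 2 * (1 / n + ‖x‖ + ‖z‖ ^ 2) ≤ (K + C) * ε ^ 2 * 3 := by gcongr
  rw [e3]
  refine (norm_add_le _ _).trans ?_
  rw [norm_pow (ε : ℂ), Complex.norm_real, Real.norm_eq_abs, sq_abs]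
  linarith

/-- Quantitative description of one cycle: passage through the gate and the orbit in the repelling
petal. -/
theorem LocalForm.cycle (hT : LocalForm T a₃ ρ K) (hS : PerturbedForm S T ρ K)
    {Ra R κ C M ε B X : ℝ} {n k N κ₁ : ℕ}
    (hR : RepellingScale a₃ ρ K Ra R κ) (hM : TransitScale a₃ ρ K (K + C) M)
    (hN : TransitTimes M ε n k N) (hC : 0 ≤ C) {w : ℕ → ℂ} (hnρ : 2 / (n : ℝ) ^ 2 ≤ ρ)
    (hw : ∀ m, n ^ 2 ≤ m → m ≤ (n + 1) ^ 2 →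
      ‖w m‖ ≤ 2 / (n : ℝ) ^ 2 ∧ ‖(n : ℂ) ^ 2 * w m - 1‖ ≤ C / n)
    (hκ₁ : R + (transitError a₃ K (K + C) + B + 2 * (80 + ‖1 - a₃‖) + 1) + 1 ≤ κ₁)
    (hκk : κ₁ ≤ k) (hRk : 10 * Ra ≤ k) (hKk : 400 * K ≤ ρ * k)
    (hP : 1920 * (1 + ‖a₃‖) ^ 2 * (k : ℝ) ^ 3 * ((1 + 3 * (K + C)) * ε ^ 2) ≤ 1 / 2)
    {p : ℂ × ℂ} (hz0 : p.1 ≠ 0) (hz : ‖-1 / p.1 - k‖ ≤ k / 16)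
    (hΦ : ‖omegaIn (1 - a₃) p.1 - k‖ ≤ B) (hx : ‖p.2‖ ≤ X) (hXM : M * X ≤ 1) (hXρ : 2 * X ≤ ρ) :
    (∀ j ≤ N + (k - κ₁), ‖(compSteps (fun m => S (w m)) (n ^ 2 + k) j p).1‖ ≤ ρ ∧
      ‖(compSteps (fun m => S (w m)) (n ^ 2 + k) j p).2‖ ≤ ρ) ∧
    (compSteps (fun m => S (w m)) (n ^ 2 + k) N p).1 ≠ 0 ∧
    Ra ≤ ‖1 / (compSteps (fun m => S (w m)) (n ^ 2 + k) N p).1‖ ∧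
    ‖omegaOut (1 - a₃) (compSteps (fun m => S (w m)) (n ^ 2 + k) N p).1 + k‖ ≤
      transitError a₃ K (K + C) + B + 2 * (80 + ‖1 - a₃‖) + 1 ∧
    ∀ u : ℂ, ‖u‖ ≤ 4 * K * ‖(compSteps (fun m => S (w m)) (n ^ 2 + k) N p).1‖ ^ 2 →
      (∀ j ≤ k - κ₁,
        ‖(T^[j] ((compSteps (fun m => S (w m)) (n ^ 2 + k) N p).1, u)).1‖ ≤ ρ ∧
        ‖(T^[j] ((compSteps (fun m => S (w m)) (n ^ 2 + k) N p).1, u)).2‖ ≤ ρ) ∧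
      ‖compSteps (fun m => S (w m)) (n ^ 2 + k) (N + (k - κ₁)) p -
        T^[k - κ₁] ((compSteps (fun m => S (w m)) (n ^ 2 + k) N p).1, u)‖ ≤
        2 * (X + 600 * K / k + 64 * (k : ℝ) ^ 3 * ((1 + 3 * (K + C)) * ε ^ 2)) := by
  obtain ⟨hn, hMk, hkn⟩ := hN.bounds hT hM
  have hM6 := hM.large hT
  have hK := hT.one_le
  have hk0 : (0 : ℝ) < k := by linarith
  have hsteps := hN.steps
  have hRa := hR.one_le
  set P := (1 + 3 * (K + C)) * ε ^ 2 with hPdef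
  set q : ℕ → ℂ × ℂ := fun j => compSteps (fun m => S (w m)) (n ^ 2 + k) j p with hq
  have hstep : ∀ j < N + (k - κ₁), ‖(q j).1‖ ≤ ρ → ‖(q j).2‖ ≤ ρ →
      (q (j + 1)).2 = (T (q j)).2 ∧
      ‖(q (j + 1)).1 - (T (q j)).1 - (ε : ℂ) ^ 2‖ ≤
        (K + C) * ε ^ 2 * (1 / n + ‖(q j).2‖ + ‖(q j).1‖ ^ 2) ∧
      ‖(q (j + 1)).1 - (T (q j)).1‖ ≤ P := by
    intro j hj h1 h2
    obtain ⟨hw1, hw2⟩ := hw (n ^ 2 + k + j) (by omega) (by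
      have : (n + 1) ^ 2 = n ^ 2 + 2 * n + 1 := by ring
      omega)
    exact hS.step_bounds hT hn hN.eps hC hw1 (hw1.trans hnρ) hw2 h1 h2
  obtain ⟨horb, hzN, hωN⟩ := hT.transit hM hN (p := q) hz0 hz hΦ
    (le_trans (mul_le_mul_of_nonneg_left hx (by linarith)) hXM) (fun j hj h1 h2 =>
      ⟨(hstep j (by omega) h1 h2).1, (hstep j (by omega) h1 h2).2.1⟩)
  have hk2 : ∀ c : ℝ, 0 ≤ c → c / (k : ℝ) ^ 2 ≤ c / k := by
    intro c hc
    gcongr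
    nlinarith
  have hKk' : 400 * K / k ≤ ρ := by rwa [div_le_iff₀ hk0]
  have hKk2 : 200 * K / (k : ℝ) ^ 2 ≤ 200 * K / k := hk2 _ (by linarith)
  have e400 : 400 * K / (k : ℝ) = 2 * (200 * K / k) := by ring
  have h10 : 10 / (k : ℝ) ≤ 400 * K / k := by gcongr; linarith
  have horbρ : ∀ j ≤ N, ‖(q j).1‖ ≤ ρ ∧ ‖(q j).2‖ ≤ ρ := by
    intro j hj
    obtain ⟨h1, h2⟩ := horb j hj
    have h3 : ‖(q 0).2‖ ≤ X := hx
    exact ⟨by linarith, by linarith⟩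
  have hzR : Ra ≤ ‖1 / (q N).1‖ := by
    have h := (horb N le_rfl).1
    rw [norm_div, norm_one, le_div_iff₀ (norm_pos_iff.2 hzN)]
    calc Ra * ‖(q N).1‖ ≤ Ra * (10 / k) := by gcongr
      _ = 10 * Ra / k := by ring
      _ ≤ 1 := by rwa [div_le_one hk0]
  have hP0 : 0 ≤ P := by positivity
  have hu' : ∀ u : ℂ, ‖u‖ ≤ 4 * K * ‖(q N).1‖ ^ 2 → ‖u‖ ≤ 400 * K / k := by
    intro u hu
    refine hu.trans (le_trans ?_ (hk2 _ (by linarith)))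
    calc 4 * K * ‖(q N).1‖ ^ 2 ≤ 4 * K * (10 / k) ^ 2 := by
          gcongr
          exact (horb N le_rfl).1
      _ = 400 * K / (k : ℝ) ^ 2 := by ring
  have hsh := fun (u : ℂ) (hu : ‖u‖ ≤ 4 * K * ‖(q N).1‖ ^ 2) =>
    hR.shadow hT hκ₁ hκk hP0 hP (p := fun j => q (N + j)) (u := u) hzN hzR hωN
      (horbρ N le_rfl).2 ((hu' u hu).trans hKk') (fun j hj h1 h2 =>
        ⟨(hstep (N + j) (by omega) h1 h2).1, (hstep (N + j) (by omega) h1 h2).2.2⟩)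
  refine ⟨fun j hj => ?_, hzN, hzR, hωN, fun u hu => ?_⟩
  · rcases le_total j N with h | h
    · exact horbρ j h
    · obtain ⟨i, rfl⟩ := Nat.exists_eq_add_of_le h
      obtain ⟨h1, h2, -⟩ := (hsh 0 (by rw [norm_zero]; positivity)).1 i (by omega)
      exact ⟨h1, h2⟩
  · obtain ⟨h1, h2⟩ := hsh u hu
    refine ⟨fun j hj => (h1 j hj).2.2, h2.trans ?_⟩
    have h3 := (horb N le_rfl).2
    have h4 : ‖(q 0).2‖ ≤ X := hx
    have h5 := hu' u hu
    have e600 : 600 * K / (k : ℝ) = 3 * (200 * K / k) := by ring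
    have h6 : ‖(q (N + 0)).2‖ = ‖(q N).2‖ := rfl
    have : ‖(q (N + 0)).2‖ + ‖u‖ ≤ X + 600 * K / k := by linarith
    linarith

end

/-! ### Entry points -/

theorem entry_coordinate_bound {k : ℕ} (hk : (0 : ℝ) < k) {z : ℂ} (h : ‖1 - -(k : ℂ) * z‖ ≤ 1 / 32) :
    z ≠ 0 ∧ ‖-1 / z - k‖ ≤ k / 16 ∧ ‖z‖ ≤ 2 / k := by
  have hz0 : z ≠ 0 := by
    rintro rfl
    norm_num at h
  have h1 : ‖(k : ℂ) * z‖ = k * ‖z‖ := by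
    rw [norm_mul, Complex.norm_natCast]
  have h2 := norm_sub_norm_le (1 : ℂ) (1 - -(k : ℂ) * z)
  have h3 := norm_sub_norm_le (k * z : ℂ) (-1)
  have e2 : (1 : ℂ) - (1 - -(k : ℂ) * z) = -(k * z) := by ring
  have e3 : (k * z : ℂ) - -1 = 1 - -(k : ℂ) * z := by ring
  rw [e2, norm_neg, h1, norm_one] at h2
  rw [e3, h1, norm_neg, norm_one] at h3
  have hzn : 0 < ‖z‖ := norm_pos_iff.2 hz0
  refine ⟨hz0, ?_, ?_⟩
  · have e : -1 / z - k = -((1 - -(k : ℂ) * z) / z) := by field_simp; ring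
    rw [e, norm_neg, norm_div, div_le_iff₀ hzn]
    nlinarith
  · rw [le_div_iff₀ hk]
    linarith

end Eggbeater

/-! ### Assembly: choice of the constants and verification of the conclusions. -/

set_option maxHeartbeats 1000000 in
theorem mainTheorem8 (a δ : ℂ) (q₂ : Polynomial ℂ)
    (hq0 : q₂.coeff 0 = 0) (hq1 : q₂.coeff 1 = 0) (hq2 : q₂.coeff 2 = -1)
    (hδ0 : 0 < ‖δ‖) (hδ1 : ‖δ‖ < 1 / (4 * Real.pi ^ 4))
    (U : OpenPartialHomeomorph (ℂ × ℂ) (ℂ × ℂ)) (a₃ : ℂ) (hU : IsNormalizingChart a δ U a₃) :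
    ∃ η₀ > (0 : ℝ), ∀ η : ℝ, 0 < η → η ≤ η₀ → ∃ R₀ > (0 : ℝ), ∀ R ≥ R₀,
      ∀ α : ℝ, 1 / 2 < α → α < 2 / 3 →
      ∀ C s : ℝ, 1 < C → 0 < s →
      ∀ C_G : Set (ℂ × ℂ), IsCompact C_G → C_G ⊆ basin (mapG q₂ δ) →
      ∀ (ι : Type*) (g : ι → ℂ × ℂ) (e : ι → ℕ → ℂ × ℂ), (∀ i, g i ∈ C_G) →
      IsEntryFamily a δ q₂ U a₃ R η s C α g e →
      ∃ κ₁ : ℕ, 1 ≤ κ₁ ∧ ∀ ε > (0 : ℝ), ∀ᶠ n : ℕ in atTop, κ₁ ≤ kSeq α n ∧ ∀ i : ι,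
        -- all perturbed iterates involved are well defined
        (∀ m : ℕ, n ^ 2 + kSeq α n ≤ m → m < (n + 1) ^ 2 - κ₁ →
          DefinedAt U (mapFw a δ (wSeq q₂ δ (g i) m))
            (tildeComp a δ U (wSeq q₂ δ (g i)) m (n ^ 2 + kSeq α n) (e i n))) ∧
        -- the inverse coordinate change is defined at the final point
        tildeComp a δ U (wSeq q₂ δ (g i)) ((n + 1) ^ 2 - κ₁) ((n + 1) ^ 2 - kSeq α n)
            (exitPoint a δ U (wSeq q₂ δ (g i)) α n (e i n)) ∈ U.target ∧
        -- the exit point lies over the repelling petal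
        (∃ u : ℂ, ((exitPoint a δ U (wSeq q₂ δ (g i)) α n (e i n)).1, u) ∈
          repPetal a₃ (localConj U (mapF a δ)) R) ∧
        ∀ u : ℂ, ((exitPoint a δ U (wSeq q₂ δ (g i)) α n (e i n)).1, u) ∈
            repPetal a₃ (localConj U (mapF a δ)) R →
          (∀ j < kSeq α n - κ₁, DefinedAt U (mapF a δ)
            ((localConj U (mapF a δ))^[j]
              ((exitPoint a δ U (wSeq q₂ δ (g i)) α n (e i n)).1, u))) ∧
          ‖tildeComp a δ U (wSeq q₂ δ (g i)) ((n + 1) ^ 2 - κ₁) ((n + 1) ^ 2 - kSeq α n)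
              (exitPoint a δ U (wSeq q₂ δ (g i)) α n (e i n))
            - (localConj U (mapF a δ))^[kSeq α n - κ₁]
              ((exitPoint a δ U (wSeq q₂ δ (g i)) α n (e i n)).1, u)‖ < ε := by

  have hpi4 : 81 ≤ Real.pi ^ 4 := by
    calc (81 : ℝ) = 3 ^ 4 := by norm_num
      _ ≤ Real.pi ^ 4 := by gcongr; exact Real.pi_gt_three.le
  have hδ64 : ‖δ‖ ≤ 1 / 64 :=
    hδ1.le.trans (one_div_le_one_div_of_le (by norm_num) (by linarith))
  obtain ⟨ρ, K, hT, hS, hD⟩ := hU.exists_localForm (by linarith)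
  obtain ⟨Ra, R₀, κ, hR⟩ := exists_repellingScale a₃ (K := K) hT.pos
  obtain ⟨Ratt, Catt, hatt⟩ := hT.exists_attFatou_sub_le
  have hRa := hR.one_le
  have hRR := hR.le
  have hK := hT.one_le
  have hρ := hT.pos
  refine ⟨1, one_pos, fun η _ _ => ⟨R₀, by linarith, ?_⟩⟩
  intro R hRR₀ α hα1 hα2 C s hC hs C_G hcomp hsub ι g e hg hE
  obtain ⟨Cw, hCw0, hwnear⟩ := exists_wSeq_near hq0 hq1 hq2 (norm_pos_iff.1 hδ0) hδ64 hcomp hsub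
  obtain ⟨M, hM⟩ := exists_transitScale a₃ (K := K) (E := K + Cw) hρ (by linarith)
  obtain ⟨Kf, hKf⟩ := hE.fatou
  set B := transitError a₃ K (K + Cw) + (Kf + Catt) + 2 * (80 + ‖1 - a₃‖) + 1 with hB
  -- `B` bounds |ω^o(z°) + k|. Stopping κ₁ ≥ R₀ + B + 1 steps early keeps ω^o(z°) + j in Re ≤ -R₀
  -- throughout, independently of n and of the parameter.
  obtain ⟨κ₁, hκ₁⟩ := exists_nat_ge (max 1 (R₀ + B + 1))
  have hκ₁1 : (1 : ℝ) ≤ κ₁ := (le_max_left _ _).trans hκ₁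
  have hκ₁B := (le_max_right _ _).trans hκ₁
  refine ⟨κ₁, by exact_mod_cast hκ₁1, fun ε₀ hε₀ => ?_⟩
  have hα0 : 0 < α := by linarith
  have hklarge : ∀ c L : ℝ, 0 < c → ∀ᶠ n : ℕ in atTop, L ≤ c * kSeq α n := by
    intro c L hc
    filter_upwards [(tendsto_natCast_atTop_atTop.comp
      (tendsto_kSeq hα0)).eventually_ge_atTop (L / c)] with n hn
    rwa [Function.comp_apply, div_le_iff₀ hc, mul_comm] at hn
  set Q := 1 + 3 * (K + Cw) with hQ
  have hQ0 : 0 < Q := by positivity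
  have ha0 := norm_nonneg a₃
  have hnear := Metric.tendstoUniformly_iff.1 hE.asymp (1 / 32) (by norm_num)
  -- The first cube bound gives k³ ≤ n² for the gate, the second makes the forcing admissible for
  -- the shadowing, and the third makes the total displacement 64k³P at most ε₀/8. The entry size X
  -- = 4C/k and the term 600K/k are made at most ε₀/8 as well, and twice the sum of the three is
  -- below ε₀.
  filter_upwards [eventually_mul_log_le_kSeq hα0 M, eventually_kSeq_cube_le hα2 one_pos,
    eventually_kSeq_cube_le hα2 (c := 1 / (16000 * (1 + ‖a₃‖) ^ 2 * Q)) (by positivity),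
    eventually_kSeq_cube_le hα2 (c := ε₀ / (2048 * Q)) (by positivity),
    hklarge 1 κ₁ one_pos, hklarge 1 (10 * Ra) one_pos, hklarge ρ (400 * K) hρ,
    hklarge 1 (4 * C * M) one_pos, hklarge ρ (8 * C) hρ, hklarge ε₀ (32 * C) hε₀,
    hklarge ε₀ (4800 * K) hε₀, hklarge 1 (R + 3 * B + 9) one_pos, hklarge 1 (2 * Ratt) one_pos,
    hwnear, hnear, hE.mem, hKf, eventually_ge_atTop 1,
    tendsto_natCast_atTop_atTop.eventually_ge_atTop (2 / ρ)]
    with n k1 k2 k3 k4 k5 k6 k7 k8 k9 k10 k11 k12 k13 hw has hmem hfat hn1 hnρ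
  simp only [exitPoint]
  simp only [one_mul] at k2 k5 k6 k8 k12 k13
  generalize kSeq α n = k at *
  have hκk : κ₁ ≤ k := by exact_mod_cast k5
  refine ⟨hκk, fun i => ?_⟩
  have hk1 : (1 : ℝ) ≤ k := hκ₁1.trans k5
  have hk0 : (0 : ℝ) < k := by linarith
  have hn1' : (1 : ℝ) ≤ n := by exact_mod_cast hn1
  have hcube : k ^ 3 ≤ n ^ 2 := by exact_mod_cast k2
  have hkn : k ≤ n := by
    have h1 : k ^ 2 ≤ k ^ 3 := Nat.pow_le_pow_right (by exact_mod_cast hk1) (by norm_num)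
    exact (Nat.pow_le_pow_iff_left two_ne_zero).1 (h1.trans hcube)
  have hsq : (n + 1) ^ 2 = n ^ 2 + 2 * n + 1 := by ring
  obtain ⟨N, hN⟩ : ∃ N, N = (n + 1) ^ 2 - k - (n ^ 2 + k) := ⟨_, rfl⟩
  have hNs : N + 2 * k = 2 * n + 1 := by omega
  have hTT : TransitTimes M (Real.pi / (2 * n)) n k N := ⟨rfl, hNs, k1, hcube⟩
  set w := wSeq q₂ δ (g i) with hwdef
  have hwi := fun m => hw (g i) (hg i) m
  have hnρ' : 2 / (n : ℝ) ^ 2 ≤ ρ := by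
    rw [div_le_iff₀ hρ] at hnρ
    rw [div_le_iff₀ (by positivity), mul_comm]
    have : (n : ℝ) * ρ ≤ (n : ℝ) ^ 2 * ρ := by gcongr; exact le_self_pow₀ hn1' two_ne_zero
    linarith
  obtain ⟨hz0, hzk, hz2⟩ := entry_coordinate_bound hk0 (z := (e i n).1) (by
    have := (has i).le
    rwa [dist_eq_norm] at this)
  obtain ⟨⟨-, hreg⟩, -⟩ := hmem i
  have hx : ‖(e i n).2‖ ≤ 4 * C / k := by
    have hwk := (hwi (n ^ 2 + k) (by omega) (by omega)).1
    have h1 : ‖w (n ^ 2 + k)‖ ≤ 2 / k := by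
      refine hwk.trans ?_
      gcongr
      exact le_trans (by exact_mod_cast hkn) (le_self_pow₀ hn1' two_ne_zero)
    have h2 : max (‖(e i n).1‖ ^ 2) (‖w (n ^ 2 + k)‖ ^ 2) ≤ (2 / (k : ℝ)) ^ 2 :=
      max_le (by gcongr) (by gcongr)
    refine (le_of_lt hreg).trans ((mul_le_mul_of_nonneg_left h2 (by linarith)).trans ?_)
    rw [div_pow, ← mul_div_assoc, div_le_div_iff₀ (by positivity) hk0]
    have : C * k * (1 : ℝ) ≤ C * k * k := by gcongr
    linarith
  have hXM : M * (4 * C / k) ≤ 1 := by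
    rw [← mul_div_assoc, div_le_one hk0]
    linarith
  have hXρ : 2 * (4 * C / k) ≤ ρ := by
    rw [← mul_div_assoc, div_le_iff₀ hk0]
    linarith
  have hΦ : ‖omegaIn (1 - a₃) (e i n).1 - k‖ ≤ Kf + Catt := by
    have hre : Ratt ≤ (-1 / (e i n).1).re := by
      have h := (abs_le.1 ((Complex.abs_re_le_norm _).trans hzk)).1
      rw [Complex.sub_re, Complex.natCast_re] at h
      linarith
    have h1 := hatt (e i n) hre (by linarith [norm_nonneg (e i n).2])
    have e1 : omegaIn (1 - a₃) (e i n).1 - k =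
        (attFatou a₃ (localConj U (mapF a δ)) (e i n) - k) -
        (attFatou a₃ (localConj U (mapF a δ)) (e i n) - omegaIn (1 - a₃) (e i n).1) := by ring
    rw [e1]
    exact (norm_sub_le _ _).trans (add_le_add (hfat i) h1)
  have hε2 : (Real.pi / (2 * n)) ^ 2 ≤ 4 / (n : ℝ) ^ 2 := by
    calc (Real.pi / (2 * n)) ^ 2 ≤ (4 / (2 * n)) ^ 2 := by gcongr; exact Real.pi_le_four
      _ = 4 / (n : ℝ) ^ 2 := by field_simp; norm_num
  have hkP : ∀ c : ℝ, 0 < c → (k : ℝ) ^ 3 ≤ c * (n : ℝ) ^ 2 →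
      (k : ℝ) ^ 3 * (Q * (Real.pi / (2 * n)) ^ 2) ≤ 4 * c * Q := by
    intro c hc h
    calc (k : ℝ) ^ 3 * (Q * (Real.pi / (2 * n)) ^ 2) ≤ c * (n : ℝ) ^ 2 * (Q * (4 / (n : ℝ) ^ 2)) := by
          gcongr
      _ = 4 * c * Q := by field_simp
  have hP1 : 1920 * (1 + ‖a₃‖) ^ 2 * (k : ℝ) ^ 3 * (Q * (Real.pi / (2 * n)) ^ 2) ≤ 1 / 2 := by
    have h := hkP _ (by positivity) k3
    have e1 : 4 * (1 / (16000 * (1 + ‖a₃‖) ^ 2 * Q)) * Q = 1 / 4000 * (1 / (1 + ‖a₃‖) ^ 2) := by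
      field_simp
      norm_num
    rw [e1] at h
    calc 1920 * (1 + ‖a₃‖) ^ 2 * (k : ℝ) ^ 3 * (Q * (Real.pi / (2 * n)) ^ 2)
        = 1920 * (1 + ‖a₃‖) ^ 2 * ((k : ℝ) ^ 3 * (Q * (Real.pi / (2 * n)) ^ 2)) := by ring
      _ ≤ 1920 * (1 + ‖a₃‖) ^ 2 * (1 / 4000 * (1 / (1 + ‖a₃‖) ^ 2)) := by gcongr
      _ = 1920 / 4000 := by field_simp
      _ ≤ 1 / 2 := by norm_num
  have hP2 : (k : ℝ) ^ 3 * (Q * (Real.pi / (2 * n)) ^ 2) ≤ ε₀ / 512 := by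
    refine (hkP _ (by positivity) k4).trans (le_of_eq ?_)
    field_simp
    norm_num
  obtain ⟨hpoly, hzN, hzR, hωN, hsh⟩ := hT.cycle hS hR hM hTT hCw0 hnρ' hwi hκ₁B hκk k6 k7 hP1 hz0
    hzk hΦ hx hXM hXρ
  have hlast : tildeComp a δ U w ((n + 1) ^ 2 - κ₁) ((n + 1) ^ 2 - k)
      (tildeComp a δ U w ((n + 1) ^ 2 - k) (n ^ 2 + k) (e i n)) =
      compSteps (fun m => localConj U (mapFw a δ (w m))) (n ^ 2 + k) (N + (k - κ₁)) (e i n) := by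
    have e1 : (n + 1) ^ 2 - κ₁ - ((n + 1) ^ 2 - k) = k - κ₁ := by omega
    have e2 : (n + 1) ^ 2 - k = n ^ 2 + k + N := by omega
    rw [tildeComp, tildeComp, ← hN, e1, e2, ← compSteps_add]
  have hexit : tildeComp a δ U w ((n + 1) ^ 2 - k) (n ^ 2 + k) (e i n) =
      compSteps (fun m => localConj U (mapFw a δ (w m))) (n ^ 2 + k) N (e i n) := by
    rw [tildeComp, ← hN]
  rw [hlast, hexit]
  generalize hq : compSteps (fun m => localConj U (mapFw a δ (w m))) (n ^ 2 + k) N (e i n) = q at *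
  refine ⟨fun m hm1 hm2 => ?_, ?_, ?_, ?_⟩
  · obtain ⟨h1, h2⟩ := hpoly (m - (n ^ 2 + k)) (by omega)
    exact (hD _ h1 h2).2 _ ((hwi m (by omega) (by omega)).1.trans hnρ')
  · obtain ⟨h1, h2⟩ := hpoly _ le_rfl
    exact (hD _ h1 h2).1.1
  · have hB0 : 0 ≤ B := (norm_nonneg _).trans hωN
    have hWre := (abs_le.1 ((Complex.abs_re_le_norm _).trans hωN)).2
    rw [Complex.add_re, Complex.natCast_re] at hWre
    have hWn := norm_sub_le (omegaOut (1 - a₃) q.1 + k) k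
    rw [add_sub_cancel_right, Complex.norm_natCast] at hWn
    -- The condition k ≥ R + 3B + 9 puts ω^o(z°) into the sector Re W ≤ -|W|/2, and far enough left
    -- that `Z`, at distance at most 8, still has Re Z < -R.
    obtain ⟨Z, hZ, hZq⟩ := hR.exists_repFatou_fst_eq hT hzN hzR rfl (by linarith) (by linarith)
    have hZre := (abs_le.1 ((Complex.abs_re_le_norm _).trans hZ)).2
    rw [Complex.sub_re] at hZre
    refine ⟨(repFatou a₃ (localConj U (mapF a δ)) Z).2, Z, ?_, Prod.ext hZq rfl⟩
    rw [Set.mem_ofPred_eq]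
    linarith
  · rintro u ⟨Z, hZ, hZq⟩
    rw [Set.mem_ofPred_eq] at hZ
    -- Whatever u is chosen, membership in the petal forces |u| ≤ 4K|z°|², the only property of u
    -- that the shadowing requires.
    obtain ⟨-, -, hu⟩ := hR.repFatou_bounds hT (Z := Z) (by linarith)
    rw [hZq] at hu
    obtain ⟨h1, h2⟩ := hsh u hu
    refine ⟨fun j hj => ?_, ?_⟩
    · obtain ⟨h3, h4⟩ := h1 j hj.le
      exact (hD _ h3 h4).1
    · refine lt_of_le_of_lt h2 ?_
      have h3 : 4 * C / (k : ℝ) ≤ ε₀ / 8 := by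
        rw [div_le_iff₀ hk0]; linarith
      have h4 : 600 * K / (k : ℝ) ≤ ε₀ / 8 := by
        rw [div_le_iff₀ hk0]; linarith
      linarith
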